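/- Model. Base stations (BSs) form a homogeneous Poisson point process $\Phi_B$ of intensity $\lambda_B>0$ on $\mathbb{R}^2$; the typical user is at the origin $o$. Each BS carries independent marks, independent of the locations and i.i.d. across BSs except that the link type depends on the BS's distance and the fading law on the link type, as follows. The link from a BS at $x$ to $o$ is line-of-sight (type $L$) with probability $C\in[0,1]$ if $\|x\|\le D$ and with probability $0$ if $\|x\|>D$, where $D>0$; otherwise it is of type $N$. A link of type $j\in\{L,N\}$ has path loss $L(x,o)=C_j\|x\|^{-\alpha_j}$ with $C_j,\alpha_j>0$, and a small-scale gain $h_{xo}\sim\mathrm{gamma}(N_j,1)$ (shape $N_j$, scale $1$), where $N_j\ge1$ is an integer. It is assumed that $C_ND^{-\alpha_N}\le C_LD^{-\alpha_L}$. The user is served by the BS $x^*=\arg\max_{x\in\Phi_B}L(x,o)$. Every other BS has an independent boresight angle, uniform on $[-180^\circ,180^\circ]$. If the absolute value of the angle is at most $\theta_b\in[0^\circ,180^\circ]$, the BS radiates its confidential signal towards $o$ with power $p_s=M_s\phi P_t$; otherwise it radiates artificial noise towards $o$ with power $p_a=M_a(1-\phi)P_t$. The two probabilities are $\mathrm{Pr}_x(s)=\theta_b/180$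 and $\mathrm{Pr}_x(a)=(180-\theta_b)/180$. Here $P_t,M_s>0$, $M_a\ge0$, $0<\phi\le1$. Let $\Phi_I$ and $\Phi_A$ be the two sets of interfering BSs $y\neq x^*$ obtained in this way, let $N_0>0$, $T_c>0$, and $$\mathrm{SINR}_U=\frac{\phi P_tM_sh_{x^*o}L(x^*,o)}{I_B+N_0},\qquad I_B=\sum_{y\in\Phi_I}p_s\,h_{yo}L(y,o)+\sum_{y\in\Phi_A}p_a\,h_{yo}L(y,o)$$ (with $\mathrm{SINR}_U=0$ if $I_B=\infty$). Notation. For $r\ge0$ let $\rho_N(r)=\left(\frac{C_N}{C_L}\right)^{1/\alpha_N}r^{\alpha_L/\alpha_N}$, $\rho_L(r)=\left(\frac{C_L}{C_N}\right)^{1/\alpha_L}r^{\alpha_N/\alpha_L}$, $\mu=\rho_N(D)$, and $$A_N=\int_0^{\mu}\left(e^{-\pi C\lambda_B\rho_L(x)^2}-e^{-\pi C\lambda_BD^2}\right)2\pi(1-C)\lambda_Bx\,e^{-\pi(1-C)\lambda_Bx^2}dx+e^{-\pi C\lambda_BD^2},\qquad A_L=1-A_N$$ (the probabilities of being served by a BS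 of type $N$, $L$). For $r\in[0,D]$, $$f_{r_L}(r)=\frac{1}{A_L}e^{-(1-C)\lambda_B\pi\rho_N(r)^2}\,2\pi C\lambda_Br\,e^{-C\lambda_B\pi r^2}$$ (read as $0$ if $A_L=0$, i.e. $C=0$), and for $r\ge0$ $$f_{r_N}(r)=\frac{2\pi\lambda_Bre^{-\pi\lambda_Br^2}\left((1-C)e^{\pi C\lambda_B(r^2-D^2)}\mathbb{I}(r\le D)+\mathbb{I}(r\ge D)\right)}{A_N}+\frac{2\pi(1-C)\lambda_Bre^{-(1-C)\lambda_B\pi r^2}\left(e^{-C\lambda_B\pi\rho_L(r)^2}-e^{-C\lambda_B\pi D^2}\right)}{A_N}\mathbb{I}(r\le\mu).$$ For $j\in\{L,N\}$ let $a_j=(N_j!)^{-1/N_j}$ and $\Theta_j(n)=\frac{T_c\,n\,a_j}{\phi P_tM_sC_j}$. For $i\in\{s,a\}$ and $0\le v\le w\le\infty$ let $$F_{j,i}(c,d;y)=1-\frac{1}{\left(1+c\,d\,p_i\,C_j\,y^{-\alpha_j}\right)^{N_j}},\qquad \Delta_{j,i}(z,v,w,c,d)=\exp\left(-2\pi z\lambda_B\mathrm{Pr}_x(i)\int_v^{w}F_{j,i}(c,d;y)\,y\,dy\right),$$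 with $e^{-\infty}=0$ and $0\cdot\infty=0$. For $i\in\{s,a\}$ put $$\varpi_i(n)=\Delta_{L,i}\left(C,r,D,\Theta_L(n),r^{\alpha_L}\right)\Delta_{N,i}\left(1-C,\min(\rho_N(r),D),D,\Theta_L(n),r^{\alpha_L}\right)\Delta_{N,i}\left(1,\max(\rho_N(r),D),\infty,\Theta_L(n),r^{\alpha_L}\right),$$ $$\varphi_i(n)=\Delta_{L,i}\left(C,\min(\rho_L(r),D),D,\Theta_N(n),r^{\alpha_N}\right)\Delta_{N,i}\left(1-C,\min(r,D),D,\Theta_N(n),r^{\alpha_N}\right)\Delta_{N,i}\left(1,\max(r,D),\infty,\Theta_N(n),r^{\alpha_N}\right),$$ $$\Xi_L(r)=\sum_{n=1}^{N_L}(-1)^{n+1}\binom{N_L}{n}e^{-\Theta_L(n)r^{\alpha_L}N_0}\varpi_s(n)\varpi_a(n),\qquad \Xi_N(r)=\sum_{n=1}^{N_N}(-1)^{n+1}\binom{N_N}{n}e^{-\Theta_N(n)r^{\alpha_N}N_0}\varphi_s(n)\varphi_a(n).$$ Theorem 6. The functions $\Xi_Lf_{r_L}$ and $\Xi_Nf_{r_N}$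 are integrable on $(0,D]$ and $(0,\infty)$, and the connection probability satisfies $$p_{con}=\Pr(\mathrm{SINR}_U\ge T_c)\le A_L\int_0^D\Xi_L(r)f_{r_L}(r)\,dr+A_N\int_0^{\infty}\Xi_N(r)f_{r_N}(r)\,dr.$$ -/

import Mathlib

open MeasureTheory ProbabilityTheory

noncomputable section

namespace MmWave

/-- The plane in which base stations (BSs) live; the typical user is at the origin. -/
abbrev Plane := EuclideanSpace ℝ (Fin 2)

/-- A radio link is line-of-sight or non-line-of-sight. -/
inductive Link
  | los
  | nlos

/-- A BS radiates its confidential signal inside its main sector, and artificial noise (AN)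
outside it. -/
inductive Sector
  | signal
  | noise

/-! ### Poisson point processes -/

/-- Number of points of the configuration `(X i ω)ᵢ` in the set `B`. -/
def count {Ω E : Type*} (X : ℕ → Ω → E) (B : Set E) (ω : Ω) : ℕ∞ :=
  {i | X i ω ∈ B}.encard

/-- The points `X 0, X 1, …` enumerate a Poisson point process of intensity measure `Λ`: counts in
sets of finite intensity are Poisson distributed, and counts in disjoint sets are independent.
(A process enumerated by `ℕ` has infinitely many points, which is almost surely the case when
`Λ` has infinite total mass.) -/
structure IsPoissonProcess {Ω E : Type*} [MeasurableSpace Ω] [MeasurableSpace E]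
    (P : Measure Ω) (X : ℕ → Ω → E) (Λ : Measure E) : Prop where
  measurable : ∀ i, Measurable (X i)
  hasLaw_count : ∀ B : Set E, MeasurableSet B → Λ B ≠ ⊤ →
    HasLaw (count X B) ((poissonMeasure (Λ B).toNNReal).map (Nat.cast : ℕ → ℕ∞)) P
  indep_count : ∀ (n : ℕ) (B : Fin n → Set E), (∀ k, MeasurableSet (B k)) → (∀ k, Λ (B k) ≠ ⊤) →
    Pairwise (fun k l => Disjoint (B k) (B l)) → iIndepFun (fun k => count X (B k)) P

/-! ### The network -/

/-- The numerical parameters of the network. -/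
structure Params where
  /-- intensity of the BS process -/
  lam : ℝ
  /-- probability that a link of length at most `D` is LOS -/
  C : ℝ
  /-- radius of the LOS ball -/
  D : ℝ
  /-- path-loss intercepts `C_L`, `C_N` -/
  coef : Link → ℝ
  /-- path-loss exponents `α_L`, `α_N` -/
  expo : Link → ℝ
  /-- Nakagami parameters `N_L`, `N_N` -/
  nak : Link → ℕ
  /-- total transmit power of a BS -/
  Pt : ℝ
  /-- main lobe gain of the confidential signal -/
  Ms : ℝ
  /-- main lobe gain of the AN -/
  Ma : ℝ
  /-- fraction of the power that is given to the confidential signal -/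
  phi : ℝ
  /-- beam width of the confidential signal, in degrees -/
  thetab : ℝ
  /-- noise power -/
  N0 : ℝ

/-- The random objects of the network. The link from the BS `i` to the origin carries a blockage
variable, the angle (in degrees) between the boresight of the BS and the origin, and one
small-scale fading gain for either type of the link. -/
structure Network (Ω : Type*) where
  loc : ℕ → Ω → Plane
  block : ℕ → Ω → ℝ
  angle : ℕ → Ω → ℝ
  fade : Link → ℕ → Ω → ℝ

/-- The marks of the BS `i`. -/
def Network.mark {Ω : Type*} (S : Network Ω) (i : ℕ) (ω : Ω) : ℝ × ℝ × ℝ × ℝ :=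
  (S.block i ω, S.angle i ω, S.fade Link.los i ω, S.fade Link.nlos i ω)

/-- The uniform distribution on `[a, b]`. -/
def uniformLaw (a b : ℝ) : Measure ℝ := cond volume (Set.Icc a b)

/-- The probabilistic model: the BSs form a homogeneous Poisson point process; the marks of
different BSs are i.i.d. and independent of the locations; for one BS, the blockage variable is
uniform on `[0, 1]`, the angle is uniform on `[-180, 180]`, the power gains of the Nakagami fading
are gamma distributed with shape `N_L` resp. `N_N` and scale `1`, and all of these are
independent. -/
structure IsModel (p : Params) {Ω : Type*} [MeasurableSpace Ω] (P : Measure Ω) (S : Network Ω) :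
    Prop where
  poisson : IsPoissonProcess P S.loc (ENNReal.ofReal p.lam • (volume : Measure Plane))
  measurable_mark : ∀ i, Measurable (S.mark i)
  hasLaw_mark : ∀ i, HasLaw (S.mark i)
    ((uniformLaw 0 1).prod ((uniformLaw (-180) 180).prod
      ((gammaMeasure (p.nak Link.los) 1).prod (gammaMeasure (p.nak Link.nlos) 1)))) P
  iIndep_mark : iIndepFun S.mark P
  indep_loc_mark : IndepFun (fun ω i => S.loc i ω) (fun ω i => S.mark i ω) P

section Model

variable (p : Params) {Ω : Type*} (S : Network Ω)

/-- Probability `q_L(r)` that a link of length `r` is LOS. -/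
def losProb (r : ℝ) : ℝ := if r ≤ p.D then p.C else 0

/-- Type of the link from the BS `i` to the typical user: given the locations, it is LOS with
probability `q_L` of its length. -/
def link (i : ℕ) (ω : Ω) : Link :=
  if S.block i ω < losProb p ‖S.loc i ω‖ then Link.los else Link.nlos

/-- What the BS `i` radiates towards the typical user when it does not serve that user. -/
def sector (i : ℕ) (ω : Ω) : Sector :=
  if |S.angle i ω| ≤ p.thetab then Sector.signal else Sector.noise

/-- Effective power radiated inside and outside the main sector, `M_s φ P_t` and
`M_a (1 - φ) P_t`. -/
def power : Sector → ℝ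
  | Sector.signal => p.Ms * p.phi * p.Pt
  | Sector.noise => p.Ma * (1 - p.phi) * p.Pt

/-- Probability of either sector, `θ_b / 180` and `(180 - θ_b) / 180`. -/
def sectorProb : Sector → ℝ
  | Sector.signal => p.thetab / 180
  | Sector.noise => (180 - p.thetab) / 180

/-- The path loss `L(x, o) = C_j ‖x‖ ^ (-α_j)` of the link from the BS `i` to the typical user. -/
def pathLoss (i : ℕ) (ω : Ω) : ℝ :=
  p.coef (link p S i ω) * ‖S.loc i ω‖ ^ (-p.expo (link p S i ω))

/-- Small-scale channel gain of the link from the BS `i` to the typical user. -/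
def fading (i : ℕ) (ω : Ω) : ℝ := S.fade (link p S i ω) i ω

/-- The BS `i` serves the typical user: it maximizes `L(x, o)`. -/
def Serves (i : ℕ) (ω : Ω) : Prop := ∀ k, pathLoss p S k ω ≤ pathLoss p S i ω

/-- Interference at the typical user when it is served by the BS `i`; it is `⊤` when the series
diverges. -/
def interference (i : ℕ) (ω : Ω) : ENNReal :=
  ∑' k : {k : ℕ // k ≠ i},
    ENNReal.ofReal (power p (sector p S k ω) * fading p S k ω * pathLoss p S k ω)

/-- SINR of the typical user when it is served by the BS `i`. -/
def sinr (i : ℕ) (ω : Ω) : ENNReal :=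
  ENNReal.ofReal (p.phi * p.Pt * p.Ms * fading p S i ω * pathLoss p S i ω) /
    (interference p S i ω + ENNReal.ofReal p.N0)

/-- The connection probability `Pr (SINR_U ≥ T_c)`. -/
def connProb [MeasurableSpace Ω] (P : Measure Ω) (Tc : ℝ) : ℝ :=
  P.real {ω | ∃ i, Serves p S i ω ∧ ENNReal.ofReal Tc ≤ sinr p S i ω}

end Model

/-! ### The analytical expressions -/

section Formulas

open Real

variable (p : Params)

/-- Distance at which a NLOS BS has the same path loss as a LOS BS at distance `r`. -/
def toNlos (r : ℝ) : ℝ :=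
  (p.coef Link.nlos / p.coef Link.los) ^ (1 / p.expo Link.nlos) *
    r ^ (p.expo Link.los / p.expo Link.nlos)

/-- Distance at which a LOS BS has the same path loss as a NLOS BS at distance `r`. -/
def toLos (r : ℝ) : ℝ :=
  (p.coef Link.los / p.coef Link.nlos) ^ (1 / p.expo Link.los) *
    r ^ (p.expo Link.nlos / p.expo Link.los)

/-- Probability `A_N` of being served by a NLOS BS. -/
def assocN : ℝ :=
  (∫ x in (0 : ℝ)..toNlos p p.D,
    (exp (-(π * p.C * p.lam * toLos p x ^ 2)) - exp (-(π * p.C * p.lam * p.D ^ 2))) *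
      (2 * π * (1 - p.C) * p.lam * x) * exp (-(π * (1 - p.C) * p.lam * x ^ 2))) +
    exp (-(π * p.C * p.lam * p.D ^ 2))

/-- Probability `A_L` of being served by a LOS BS. -/
def assocL : ℝ := 1 - assocN p

/-- Density `f_{r_L}` on `[0, D]` of the distance to the serving BS, given that it is LOS. -/
def pdfL (r : ℝ) : ℝ :=
  exp (-((1 - p.C) * p.lam * π * toNlos p r ^ 2)) *
    (2 * π * p.C * p.lam * r * exp (-(p.C * p.lam * π * r ^ 2))) / assocL p

/-- Density `f_{r_N}` on `[0, ∞)` of the distance to the serving BS, given that it is NLOS. -/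
def pdfN (r : ℝ) : ℝ :=
  2 * π * p.lam * r * exp (-(π * p.lam * r ^ 2)) *
      ((1 - p.C) * exp (π * p.C * p.lam * (r ^ 2 - p.D ^ 2)) * (if r ≤ p.D then 1 else 0) +
        (if p.D ≤ r then 1 else 0)) / assocN p +
    2 * π * (1 - p.C) * p.lam * r * exp (-((1 - p.C) * p.lam * π * r ^ 2)) *
      (exp (-(p.C * p.lam * π * toLos p r ^ 2)) - exp (-(p.C * p.lam * π * p.D ^ 2))) /
        assocN p * (if r ≤ toNlos p p.D then 1 else 0)

/-- `a_j = (N_j !) ^ (-1 / N_j)`. -/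
def alzer (j : Link) : ℝ := ((p.nak j).factorial : ℝ) ^ (-(1 / (p.nak j : ℝ)))

/-- `Θ_j(n)`. -/
def Theta (Tc : ℝ) (j : Link) (n : ℕ) : ℝ :=
  Tc * n * alzer p j / (p.phi * p.Pt * p.Ms * p.coef j)

/-- `F_j`, for interferers with link type `j`, sector `s` and distance `y`. -/
def F (j : Link) (s : Sector) (c d y : ℝ) : ℝ :=
  1 - 1 / (1 + c * d * power p s * p.coef j * y ^ (-p.expo j)) ^ p.nak j

/-- `Δ_j`, for interferers with link type `j` and sector `s` whose distance ranges over the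
interval `I`: the exponential of `-2 π z λ_B Pr(s) ∫_I F_j y dy`, with `exp (-∞) = 0`. -/
def Delta (j : Link) (s : Sector) (z : ℝ) (I : Set ℝ) (c d : ℝ) : ℝ :=
  (EReal.exp (-((ENNReal.ofReal (2 * π * z * p.lam * sectorProb p s) *
    ∫⁻ y in I, ENNReal.ofReal (F p j s c d y * y) : ENNReal) : EReal))).toReal

/-- `ϖ₁ ϖ₂ ϖ₃` for interferers in the sector `s`. -/
def varpi (Tc r : ℝ) (s : Sector) (n : ℕ) : ℝ :=
  Delta p Link.los s p.C (Set.Ioc r p.D) (Theta p Tc Link.los n) (r ^ p.expo Link.los) *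
  Delta p Link.nlos s (1 - p.C) (Set.Ioc (min (toNlos p r) p.D) p.D)
    (Theta p Tc Link.los n) (r ^ p.expo Link.los) *
  Delta p Link.nlos s 1 (Set.Ioi (max (toNlos p r) p.D))
    (Theta p Tc Link.los n) (r ^ p.expo Link.los)

/-- `φ₁ φ₂ φ₃` for interferers in the sector `s`. -/
def varphi (Tc r : ℝ) (s : Sector) (n : ℕ) : ℝ :=
  Delta p Link.los s p.C (Set.Ioc (min (toLos p r) p.D) p.D)
    (Theta p Tc Link.nlos n) (r ^ p.expo Link.nlos) *
  Delta p Link.nlos s (1 - p.C) (Set.Ioc (min r p.D) p.D)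
    (Theta p Tc Link.nlos n) (r ^ p.expo Link.nlos) *
  Delta p Link.nlos s 1 (Set.Ioi (max r p.D))
    (Theta p Tc Link.nlos n) (r ^ p.expo Link.nlos)

/-- `Ξ_L`. -/
def XiL (Tc r : ℝ) : ℝ :=
  ∑ n ∈ Finset.Icc 1 (p.nak Link.los), (-1 : ℝ) ^ (n + 1) * ((p.nak Link.los).choose n : ℝ) *
    exp (-(Theta p Tc Link.los n * r ^ p.expo Link.los * p.N0)) *
    varpi p Tc r Sector.signal n * varpi p Tc r Sector.noise n

/-- `Ξ_N`. -/
def XiN (Tc r : ℝ) : ℝ :=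
  ∑ n ∈ Finset.Icc 1 (p.nak Link.nlos), (-1 : ℝ) ^ (n + 1) * ((p.nak Link.nlos).choose n : ℝ) *
    exp (-(Theta p Tc Link.nlos n * r ^ p.expo Link.nlos * p.N0)) *
    varphi p Tc r Sector.signal n * varphi p Tc r Sector.noise n

end Formulas

end MmWave

end

/-! Cover the connection event by the events, indexed by a base station `i` and a link type `j`,
that `i` serves over a link of type `j` and that its gain reaches a threshold proportional to
interference plus noise. Given the locations and the marks of all other stations, that gain is gamma
distributed, and Alzer's inequality (`pow_one_sub_exp_le_integral_erlang`) bounds its tail at `x` by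
`1 - (1 - e^{-a x})^N`. The result is `condBound`; from there on the computation consists of
identities.

Expanding the power makes the bound an alternating sum of exponentials that are linear in the
interference. The condition that no competitor is stronger goes into the same exponential: a
stronger competitor gets exponent `∞`, and `e^{-∞} = 0` (`rivalExponent`). Each term then has the
form `f(X_i) exp(-∑_{k ≠ i} w(‖X_i‖, X_k, Y_k))`, and the Mecke formula for marked processes
(`IsPoissonProcess.mecke_marked`) gives its expectation summed over `i`. That formula is built up
from counts: the generating function and the shift identity `n P(n) = λ P(n-1)` of the Poisson law,
then simple exponents, monotone limits, and finally exponents that depend monotonically on the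
reference point, by discretising it from both sides.

In polar coordinates the competitors of type `k` split at the distance where their path loss equals
that of the server. Closer ones contribute their whole intensity, which yields a void probability;
farther ones contribute `F`, the defect of a gamma Laplace transform, which yields the factors
`Delta` (`nexp_lintegral_rivals`). The void probabilities times the intensity of the server form
`servingDensity`, which is `A_j f_{r_j}` (`pdfL_eq`, `pdfN_eq`); the comparison of the path losses
at `D` enters here, through `ρ_N(r) ≤ D` for `r ≤ D`.

Expectations are taken in `[0, ∞]`, so the negative terms of the alternating sum stand on the other
side of the equation until everything is known to be finite. Finiteness and integrability follow
from a bound of `servingDensity` by a multiple of `r e^{-πλr²}`. -/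

noncomputable section

namespace MmWave

/-! ### The function `x ↦ exp (-x)` on `[0, ∞]` -/

/-- `exp (-x)` for `x ∈ [0, ∞]`, with `exp (-∞) = 0`. -/
def nexp (x : ENNReal) : ENNReal := EReal.exp (-(x : EReal))

/-- The inverse of `nexp` on `[0, 1]`. -/
def nlog (u : ENNReal) : ENNReal := (-ENNReal.log u).toENNReal

@[simp] lemma nexp_zero : nexp 0 = 1 := by simp [nexp]

@[simp] lemma nexp_top : nexp ⊤ = 0 := by simp [nexp]

lemma nexp_antitone : Antitone nexp := fun a b h => by
  unfold nexp
  exact EReal.exp_monotone (EReal.neg_le_neg_iff.2 (by exact_mod_cast h))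

lemma nexp_le_one (x : ENNReal) : nexp x ≤ 1 := by
  simpa using nexp_antitone (zero_le (a := x))

lemma nexp_ne_top (x : ENNReal) : nexp x ≠ ⊤ := ((nexp_le_one x).trans_lt ENNReal.one_lt_top).ne

lemma nexp_add (a b : ENNReal) : nexp (a + b) = nexp a * nexp b := by
  unfold nexp
  rw [← EReal.exp_add, EReal.coe_ennreal_add, EReal.neg_add, sub_eq_add_neg]
  · left; simp
  · right; simp

lemma continuous_nexp : Continuous nexp := by
  unfold nexp
  exact ENNReal.continuous_exp.comp (continuous_neg.comp continuous_coe_ennreal_ereal)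

lemma measurable_nexp : Measurable nexp := continuous_nexp.measurable

lemma nexp_ofReal {a : ℝ} (ha : 0 ≤ a) : nexp (ENNReal.ofReal a) = ENNReal.ofReal (Real.exp (-a)) := by
  unfold nexp
  rw [EReal.coe_ennreal_ofReal, max_eq_left ha, ← EReal.coe_neg, EReal.exp_coe]

lemma nexp_sum {ι : Type*} (s : Finset ι) (f : ι → ENNReal) :
    nexp (∑ i ∈ s, f i) = ∏ i ∈ s, nexp (f i) := by
  classical
  induction s using Finset.induction_on with
  | empty => simp
  | insert a s ha ih => rw [Finset.sum_insert ha, Finset.prod_insert ha, nexp_add, ih]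

lemma nexp_natCast_mul (n : ℕ) (x : ENNReal) : nexp (n * x) = nexp x ^ n := by
  have := nexp_sum (Finset.range n) (fun _ => x)
  simpa using this

/-- For `u ≤ 1` the number `-log u` is nonnegative, so its truncation to `[0, ∞]` loses nothing; `u
= 0` corresponds to the exponent `∞`. This lets a mean of exponentials be read as a single
exponential. -/
lemma nexp_nlog {u : ENNReal} (hu : u ≤ 1) : nexp (nlog u) = u := by
  unfold nexp nlog
  rw [EReal.coe_toENNReal, neg_neg, ENNReal.exp_log]
  rw [EReal.neg_nonneg]
  exact ENNReal.log_le_zero_iff.2 hu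

lemma nlog_antitone : Antitone nlog := fun a b h => by
  unfold nlog
  exact EReal.toENNReal_le_toENNReal (EReal.neg_le_neg_iff.2 (ENNReal.log_monotone h))

lemma measurable_nlog : Measurable nlog := by
  unfold nlog
  exact (continuous_neg.measurable.comp ENNReal.measurable_log).ereal_toENNReal

/-- Replaces an infinite product by a limit of finite ones, to which independence applies.
Continuity of `nexp` at `∞` covers divergent series. -/
lemma tendsto_nexp_tsum {ι : Type*} (f : ι → ENNReal) :
    Filter.Tendsto (fun s : Finset ι => ∏ i ∈ s, nexp (f i)) Filter.atTop
      (nhds (nexp (∑' i, f i))) := by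
  simp_rw [← nexp_sum]
  exact (continuous_nexp.tendsto _).comp ENNReal.summable.hasSum

/-! ### Poisson processes: Laplace functional and Mecke formula -/

section Poisson

open Filter Topology Set

/-- The index set `T` is arbitrary because the Mecke formula needs sums over all points and sums
that omit one index. -/
lemma tsum_indicator_one {E : Type*} {T : Set ℕ} (x : ℕ → E) (B : Set E) :
    ∑' k : T, B.indicator (1 : E → ENNReal) (x k) =
      ({k | k ∈ T ∧ x k ∈ B}.encard : ENNReal) := by
  rw [← ENNReal.tsum_set_one, tsum_subtype T (fun k => B.indicator (1 : E → ENNReal) (x k)),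
    tsum_subtype _ (fun _ => (1 : ENNReal))]
  refine tsum_congr fun k => ?_
  by_cases h1 : k ∈ T <;> by_cases h2 : x k ∈ B <;> simp [h1, h2]

lemma coe_count {Ω E : Type*} (X : ℕ → Ω → E) (B : Set E) (ω : Ω) :
    (count X B ω : ENNReal) = ∑' i, B.indicator (1 : E → ENNReal) (X i ω) := by
  have := tsum_indicator_one (T := univ) (fun k => X k ω) B
  rw [tsum_univ (fun k => B.indicator (1 : E → ENNReal) (X k ω))] at this
  rw [this]
  simp [count]

variable {Ω E : Type*} [MeasurableSpace Ω] [MeasurableSpace E] {P : Measure Ω}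
  {X : ℕ → Ω → E} {Λ : Measure E}

lemma measurable_count (hX : ∀ i, Measurable (X i)) {B : Set E} (hB : MeasurableSet B) :
    Measurable (count X B) := by
  have h : Measurable fun ω => (count X B ω : ENNReal) := by
    simp_rw [coe_count]
    exact Measurable.tsum fun i => (measurable_const.indicator hB).comp (hX i)
  refine measurable_to_countable' fun n => ?_
  have : count X B ⁻¹' {n} = (fun ω => (count X B ω : ENNReal)) ⁻¹' {(n : ENNReal)} := by
    ext ω; simp
  rw [this]
  exact h (measurableSet_singleton _)

lemma IsPoissonProcess.lintegral_count (hX : IsPoissonProcess P X Λ) {B : Set E}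
    (hB : MeasurableSet B) (hΛ : Λ B ≠ ⊤) (g : ℕ∞ → ENNReal) :
    ∫⁻ ω, g (count X B ω) ∂P = ∑' n : ℕ,
      ENNReal.ofReal (Real.exp (-(Λ B).toReal) * (Λ B).toReal ^ n / n.factorial) * g n := by
  rw [(hX.hasLaw_count B hB hΛ).lintegral_comp (measurable_of_countable g).aemeasurable,
    lintegral_map (measurable_of_countable g) (measurable_of_countable _), lintegral_countable']
  refine tsum_congr fun n => ?_
  rw [poissonMeasure_singleton, mul_comm]
  rfl

/-- The generating function `E[u^N] = e^{-(1-u)Λ(B)}` at `u = e^{-c}`. The case `c = ∞`, `u = 0`, is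
the void probability. -/
lemma IsPoissonProcess.lintegral_nexp_count (hX : IsPoissonProcess P X Λ) {B : Set E}
    (hB : MeasurableSet B) (hΛ : Λ B ≠ ⊤) (c : ENNReal) :
    ∫⁻ ω, nexp (c * count X B ω) ∂P = nexp ((1 - nexp c) * Λ B) := by
  rw [hX.lintegral_count hB hΛ (fun n => nexp (c * n))]
  set l := (Λ B).toReal with hl
  have hl0 : 0 ≤ l := ENNReal.toReal_nonneg
  set u := (nexp c).toReal with hu
  have hu0 : 0 ≤ u := ENNReal.toReal_nonneg
  have hcu : nexp c = ENNReal.ofReal u := (ENNReal.ofReal_toReal (nexp_ne_top c)).symm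
  have hu1 : u ≤ 1 := ENNReal.toReal_le_of_le_ofReal zero_le_one (by simpa using nexp_le_one c)
  have hLB : Λ B = ENNReal.ofReal l := (ENNReal.ofReal_toReal hΛ).symm
  have hterm : ∀ n : ℕ, ENNReal.ofReal (Real.exp (-l) * l ^ n / n.factorial) *
      nexp (c * ((n : ℕ∞) : ENNReal)) =
      ENNReal.ofReal (Real.exp (-l) * ((l * u) ^ n / n.factorial)) := fun n => by
    rw [ENat.toENNReal_coe, mul_comm c, nexp_natCast_mul, hcu, ← ENNReal.ofReal_pow hu0,
      ← ENNReal.ofReal_mul (by positivity)]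
    congr 1
    rw [mul_pow]
    ring
  simp_rw [hterm]
  have hs : HasSum (fun n : ℕ => Real.exp (-l) * ((l * u) ^ n / n.factorial))
      (Real.exp (-l) * Real.exp (l * u)) := by
    have := NormedSpace.expSeries_div_hasSum_exp (𝔸 := ℝ) (l * u)
    rw [← Real.exp_eq_exp_ℝ] at this
    exact this.mul_left _
  rw [← ENNReal.ofReal_tsum_of_nonneg (fun n => by positivity) hs.summable, hs.tsum_eq, hcu, hLB,
    ← ENNReal.ofReal_one, ← ENNReal.ofReal_sub _ hu0, ← ENNReal.ofReal_mul (by linarith),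
    nexp_ofReal (mul_nonneg (by linarith) hl0), ← Real.exp_add]
  congr 2
  ring

/-- The shift identity `(n+1) P(N = n+1) = Λ(B) P(N = n)`: the weight `N` makes the remaining `N -
1` points Poisson again. The term `n = 0` vanishes, so truncated subtraction does no harm. -/
lemma IsPoissonProcess.lintegral_count_mul_nexp (hX : IsPoissonProcess P X Λ) {B : Set E}
    (hB : MeasurableSet B) (hΛ : Λ B ≠ ⊤) (c : ENNReal) :
    ∫⁻ ω, count X B ω * nexp (c * (count X B ω - 1 : ℕ∞)) ∂P =
      Λ B * ∫⁻ ω, nexp (c * count X B ω) ∂P := by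
  rw [hX.lintegral_count hB hΛ (fun n => nexp (c * n)),
    hX.lintegral_count hB hΛ (fun n => n * nexp (c * (n - 1 : ℕ∞))),
    tsum_eq_zero_add' ENNReal.summable, ← ENNReal.tsum_mul_left]
  simp only [Nat.cast_zero, ENat.toENNReal_zero, zero_mul, mul_zero, zero_add]
  refine tsum_congr fun n => ?_
  have h1 : (((n + 1 : ℕ) : ℕ∞) - 1 : ℕ∞) = n := by
    have := ENat.natCast_sub (n + 1) 1
    rw [Nat.add_sub_cancel] at this
    exact this.symm
  rw [h1, ← mul_assoc, ← mul_assoc]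
  congr 1
  set l := (Λ B).toReal with hl
  rw [show Λ B = ENNReal.ofReal l from (ENNReal.ofReal_toReal hΛ).symm]
  have hl0 : 0 ≤ l := ENNReal.toReal_nonneg
  rw [ENat.toENNReal_coe, ← ENNReal.ofReal_natCast (n + 1), ← ENNReal.ofReal_mul (by positivity),
    ← ENNReal.ofReal_mul hl0]
  congr 1
  rw [Nat.factorial_succ]
  push_cast
  field_simp
  ring

lemma IsPoissonProcess.lintegral_prod_count (hX : IsPoissonProcess P X Λ) {ι : Type*} [Fintype ι]
    {B : ι → Set E} (hB : ∀ k, MeasurableSet (B k)) (hΛ : ∀ k, Λ (B k) ≠ ⊤)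
    (hdisj : Pairwise fun k l => Disjoint (B k) (B l)) (g : ι → ℕ∞ → ENNReal) :
    ∫⁻ ω, ∏ k, g k (count X (B k) ω) ∂P = ∏ k, ∫⁻ ω, g k (count X (B k) ω) ∂P := by
  have e := Fintype.equivFin ι
  have h1 := hX.indep_count (Fintype.card ι) (fun k => B (e.symm k)) (fun k => hB _)
    (fun k => hΛ _) (fun k l hkl => hdisj (by simpa using hkl))
  have h2 : iIndepFun (fun k => count X (B k)) P := by
    have := h1.precomp (g := e) e.injective
    simpa using this
  have h3 := h2.comp g (fun k => measurable_of_countable _)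
  exact lintegral_prod_eq_prod_lintegral_of_indepFun Finset.univ _ h3
    fun k => (measurable_of_countable _).comp (measurable_count hX.measurable (hB k))

end Poisson

/-! ### Laplace functional and Mecke formula for simple exponents -/

section Poisson

open Filter Topology Set

variable {Ω E : Type*} [MeasurableSpace Ω] [MeasurableSpace E] {P : Measure Ω}
  {X : ℕ → Ω → E} {Λ : Measure E}

/-- The value `0` is left out because its level set may have infinite intensity, where nothing is
known about counts. -/
lemma simpleFunc_apply_eq_sum (f : SimpleFunc E ENNReal) (y : E) :
    f y = ∑ d : {d // d ∈ f.range.erase 0}, (d : ENNReal) * (f ⁻¹' {(d : ENNReal)}).indicator 1 y := by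
  rw [Finset.sum_coe_sort (f.range.erase 0) (fun d => d * (f ⁻¹' {d}).indicator 1 y)]
  by_cases h : f y = 0
  · rw [h, Finset.sum_eq_zero]
    intro d hd
    have : d ≠ 0 := (Finset.mem_erase.1 hd).1
    simp [h, this.symm]
  · rw [Finset.sum_eq_single (f y)]
    · simp
    · intro d _ hd
      simp [hd.symm]
    · intro h'
      exact absurd (Finset.mem_erase.2 ⟨h, SimpleFunc.mem_range_self f y⟩) h'

lemma tsum_simpleFunc {Ω : Type*} {X : ℕ → Ω → E} (f : SimpleFunc E ENNReal) (ω : Ω) :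
    ∑' k, f (X k ω) = ∑ d : {d // d ∈ f.range.erase 0},
      (d : ENNReal) * count X (f ⁻¹' {(d : ENNReal)}) ω := by
  simp_rw [coe_count, ← ENNReal.tsum_mul_left]
  rw [← Summable.tsum_finsetSum (fun _ _ => ENNReal.summable)]
  exact tsum_congr fun k => simpleFunc_apply_eq_sum f _

lemma measure_preimage_ne_top {f : SimpleFunc E ENNReal} (hf : Λ {y | f y ≠ 0} ≠ ⊤)
    {d : ENNReal} (hd : d ≠ 0) : Λ (f ⁻¹' {d}) ≠ ⊤ := by
  refine measure_ne_top_of_subset (fun y hy => ?_) hf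
  have : f y = d := hy
  simpa [this] using hd

/-- The level sets of `f` are disjoint, so their counts are independent and the expectation is a
product of generating functions. -/
lemma IsPoissonProcess.laplace_simpleFunc (hX : IsPoissonProcess P X Λ) (f : SimpleFunc E ENNReal)
    (hf : Λ {y | f y ≠ 0} ≠ ⊤) :
    ∫⁻ ω, nexp (∑' k, f (X k ω)) ∂P = nexp (∫⁻ y, (1 - nexp (f y)) ∂Λ) := by
  have hmeas : ∀ d : ENNReal, MeasurableSet (f ⁻¹' {d}) := fun d => f.measurableSet_preimage _
  have hfin : ∀ d : {d // d ∈ f.range.erase 0}, Λ (f ⁻¹' {(d : ENNReal)}) ≠ ⊤ := fun d =>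
    measure_preimage_ne_top hf (Finset.mem_erase.1 d.2).1
  simp_rw [tsum_simpleFunc, nexp_sum]
  rw [hX.lintegral_prod_count (B := fun d : {d // d ∈ f.range.erase 0} => f ⁻¹' {(d : ENNReal)})
    (fun d => hmeas d) hfin ?_
    (fun (d : {d // d ∈ f.range.erase 0}) n => nexp (d * n))]
  · simp_rw [fun d : {d // d ∈ f.range.erase 0} => hX.lintegral_nexp_count (hmeas d) (hfin d) d]
    rw [← nexp_sum]
    congr 1
    have h1 := SimpleFunc.map_lintegral (μ := Λ) (fun c : ENNReal => 1 - nexp c) f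
    rw [← SimpleFunc.lintegral_eq_lintegral] at h1
    simp only [SimpleFunc.map_apply] at h1
    rw [h1, Finset.sum_coe_sort (f.range.erase 0) (fun d => (1 - nexp d) * Λ (f ⁻¹' {d}))]
    refine Finset.sum_subset (Finset.erase_subset _ _) fun d hd hd' => ?_
    have : d = 0 := by
      by_contra h
      exact hd' (Finset.mem_erase.2 ⟨h, hd⟩)
    simp [this]
  · intro d d' hdd'
    refine Set.disjoint_left.2 fun y hy hy' => hdd' (Subtype.ext ?_)
    exact (show f y = d from hy).symm.trans hy'

/-- Mecke formula for an indicator weight and a simple exponent that is constant on its support. -/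
lemma IsPoissonProcess.mecke_of_subset_preimage (hX : IsPoissonProcess P X Λ)
    (f : SimpleFunc E ENNReal) (hf : Λ {y | f y ≠ 0} ≠ ⊤) {A : Set E} (hA : MeasurableSet A)
    (hΛA : Λ A ≠ ⊤) {c : ENNReal} (hAc : A ⊆ f ⁻¹' {c}) :
    ∫⁻ ω, ∑' i, A.indicator 1 (X i ω) * nexp (∑' k : {k : ℕ // k ≠ i}, f (X k ω)) ∂P =
      Λ A * ∫⁻ ω, nexp (∑' k, f (X k ω)) ∂P := by
  let ι := {d // d ∈ f.range.erase 0}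
  -- With `A` removed from every level set, `A` and the sets `B d` are disjoint cells that carry all
  -- of the exponent. The value `c` on `A` may be `0` or occur among the `d`.
  let B : ι → Set E := fun d => f ⁻¹' {(d : ENNReal)} \ A
  have hBm : ∀ d, MeasurableSet (B d) := fun d => (f.measurableSet_preimage _).diff hA
  have hBfin : ∀ d, Λ (B d) ≠ ⊤ := fun d => measure_ne_top_of_subset sdiff_subset
    (measure_preimage_ne_top hf (Finset.mem_erase.1 d.2).1)
  have hfy : ∀ y, f y = c * A.indicator 1 y + ∑ d : ι, (d : ENNReal) * (B d).indicator 1 y := by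
    intro y
    by_cases hy : y ∈ A
    · simp [hy, B, show f y = c from hAc hy]
    · rw [simpleFunc_apply_eq_sum f y]
      rw [indicator_of_notMem hy, mul_zero, zero_add]
      refine Finset.sum_congr rfl fun d _ => ?_
      congr 1
      by_cases h : y ∈ f ⁻¹' {(d : ENNReal)}
      · rw [indicator_of_mem h, indicator_of_mem (show y ∈ B d from ⟨h, hy⟩)]
      · rw [indicator_of_notMem h, indicator_of_notMem fun h' : y ∈ B d => h h'.1]
  have hall : ∀ (T : Set ℕ) ω, ∑' k : T, f (X k ω) =
      c * ({k | k ∈ T ∧ X k ω ∈ A}.encard : ENNReal) +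
      ∑ d : ι, (d : ENNReal) * ({k | k ∈ T ∧ X k ω ∈ B d}.encard : ENNReal) := by
    intro T ω
    simp_rw [← tsum_indicator_one (fun k => X k ω)]
    simp_rw [← ENNReal.tsum_mul_left]
    rw [← Summable.tsum_finsetSum (fun _ _ => ENNReal.summable), ← ENNReal.tsum_add]
    exact tsum_congr fun k => hfy _
  let C : Option ι → Set E := fun o => o.elim A B
  have hCm : ∀ o, MeasurableSet (C o) := fun o => by cases o <;> simp [C, hA, hBm]
  have hCfin : ∀ o, Λ (C o) ≠ ⊤ := fun o => by cases o <;> simp [C, hΛA, hBfin]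
  have hCd : Pairwise fun k l => Disjoint (C k) (C l) := by
    intro o o' hoo'
    rcases o with _ | d <;> rcases o' with _ | d'
    · exact absurd rfl hoo'
    · exact disjoint_sdiff_self_right
    · exact disjoint_sdiff_self_left
    · refine Set.disjoint_left.2 fun y hy hy' => hoo' ?_
      exact congrArg some (Subtype.ext ((show f y = d from hy.1).symm.trans hy'.1))
  -- The two sides of the formula differ only in the factor of the cell `A`: the weight is `n` and
  -- the omitted point lowers the exponent to `n - 1`, against plain `n` in `g'`.
  let g : Option ι → ℕ∞ → ENNReal := fun o n =>
    o.elim ((n : ENNReal) * nexp (c * (n - 1 : ℕ∞))) (fun d : ι => nexp (d * n))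
  let g' : Option ι → ℕ∞ → ENNReal := fun o n =>
    o.elim (nexp (c * n)) (fun d : ι => nexp (d * n))
  have hL : ∀ ω, ∑' i, A.indicator 1 (X i ω) * nexp (∑' k : {k : ℕ // k ≠ i}, f (X k ω)) =
      ∏ o : Option ι, g o (count X (C o) ω) := by
    intro ω
    rw [Fintype.prod_option]
    simp only [Option.elim, C, g]
    rw [mul_assoc, coe_count, ← ENNReal.tsum_mul_right]
    refine tsum_congr fun i => ?_
    by_cases hi : X i ω ∈ A
    · congr 1
      rw [← nexp_sum, ← nexp_add]
      congr 1
      -- Point `i` lies in `A`, so leaving it out lowers the count of `A` by one and does not touch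
      -- the cells `B d`.
      refine (hall {k | k ≠ i} ω).trans ?_
      congr 1
      · congr 2
        rw [count, ← Set.encard_sdiff_singleton_of_mem (show i ∈ {k | X k ω ∈ A} from hi)]
        congr 1
        ext k
        simp [and_comm]
      · refine Finset.sum_congr rfl fun d _ => ?_
        congr 2
        rw [count]
        congr 1
        ext k
        simp only [mem_ofPred_eq, and_iff_right_iff_imp]
        rintro hk rfl
        exact hk.2 hi
    · simp [hi]
  have hR : ∀ ω, nexp (∑' k, f (X k ω)) =
      ∏ o : Option ι, g' o (count X (C o) ω) := by
    intro ω
    rw [Fintype.prod_option]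
    simp only [Option.elim, C, g']
    rw [← nexp_sum, ← nexp_add, ← tsum_univ (fun k => f (X k ω)), hall]
    simp [count]
  rw [lintegral_congr hL, lintegral_congr hR, hX.lintegral_prod_count hCm hCfin hCd, hX.lintegral_prod_count hCm hCfin hCd,
    Fintype.prod_option, Fintype.prod_option, ← mul_assoc]
  congr 1
  exact hX.lintegral_count_mul_nexp hA hΛA c

/-- Both sides are additive in `A`, so `A` can be cut along the level sets of `f`, on each of which
the exponent of the reference point is constant. -/
lemma IsPoissonProcess.mecke_simpleFunc (hX : IsPoissonProcess P X Λ)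
    (f : SimpleFunc E ENNReal) (hf : Λ {y | f y ≠ 0} ≠ ⊤) {A : Set E} (hA : MeasurableSet A)
    (hΛA : Λ A ≠ ⊤) :
    ∫⁻ ω, ∑' i, A.indicator 1 (X i ω) * nexp (∑' k : {k : ℕ // k ≠ i}, f (X k ω)) ∂P =
      Λ A * ∫⁻ ω, nexp (∑' k, f (X k ω)) ∂P := by
  have hind : ∀ y, A.indicator (1 : E → ENNReal) y =
      ∑ c ∈ f.range, (A ∩ f ⁻¹' {c}).indicator 1 y := by
    intro y
    rw [Finset.sum_eq_single (f y)]
    · by_cases hy : y ∈ A <;> simp [indicator, hy]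
    · intro c _ hc
      simp [indicator, hc.symm]
    · exact fun h => absurd (SimpleFunc.mem_range_self f y) h
  have hΛ : Λ A = ∑ c ∈ f.range, Λ (A ∩ f ⁻¹' {c}) := by
    rw [← lintegral_indicator_one hA]
    simp_rw [hind]
    rw [lintegral_finsetSum]
    · refine Finset.sum_congr rfl fun c _ => ?_
      exact lintegral_indicator_one (hA.inter (f.measurableSet_preimage _))
    · exact fun c _ => measurable_one.indicator (hA.inter (f.measurableSet_preimage _))
  simp_rw [hind, Finset.sum_mul]
  simp_rw [Summable.tsum_finsetSum (fun _ _ => ENNReal.summable)]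
  have hm : ∀ i, Measurable fun ω => nexp (∑' k : {k : ℕ // k ≠ i}, f (X k ω)) := fun i =>
    measurable_nexp.comp (Measurable.tsum fun k => f.measurable.comp (hX.measurable _))
  rw [lintegral_finsetSum]
  · rw [hΛ, Finset.sum_mul]
    refine Finset.sum_congr rfl fun c _ => ?_
    exact hX.mecke_of_subset_preimage f hf (hA.inter (f.measurableSet_preimage _))
      (measure_ne_top_of_subset inter_subset_left hΛA) inter_subset_right
  · intro c _
    exact Measurable.tsum fun i => ((measurable_one.indicator
      (hA.inter (f.measurableSet_preimage _))).comp (hX.measurable i)).mul (hm i)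

end Poisson

/-! ### Passage to measurable exponents -/

section Poisson

open Filter Topology Set

variable {Ω E : Type*} [MeasurableSpace Ω] [MeasurableSpace E] {P : Measure Ω}
  {X : ℕ → Ω → E} {Λ : Measure E}

/-- Standard simple approximations are cut off to an exhaustion by sets of finite measure; each
point eventually lies in the exhaustion, so the limit is unchanged. -/
lemma exists_monotone_simpleFunc_tendsto (Λ : Measure E) [SigmaFinite Λ] {v : E → ENNReal}
    (hv : Measurable v) :
    ∃ f : ℕ → SimpleFunc E ENNReal, (∀ y, Monotone fun n => f n y) ∧
      (∀ n, Λ {y | f n y ≠ 0} ≠ ⊤) ∧ ∀ y, Tendsto (fun n => f n y) atTop (𝓝 (v y)) := by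
  have happ : ∀ n y, (SimpleFunc.eapprox v n).restrict (spanningSets Λ n) y =
      (spanningSets Λ n).indicator (SimpleFunc.eapprox v n) y := fun n y => by
    rw [SimpleFunc.restrict_apply _ (measurableSet_spanningSets Λ n)]
  refine ⟨fun n => (SimpleFunc.eapprox v n).restrict (spanningSets Λ n), fun y m n hmn => ?_,
    fun n => ?_, fun y => ?_⟩
  · simp only [happ]
    exact (indicator_le_indicator_of_subset (monotone_spanningSets Λ hmn) (fun _ => zero_le) y).trans
      (indicator_le_indicator (SimpleFunc.monotone_eapprox v hmn y))
  · refine measure_ne_top_of_subset (fun y hy => ?_) (measure_spanningSets_lt_top Λ n).ne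
    by_contra h
    exact hy (by rw [happ, indicator_of_notMem h])
  · have h1 : Tendsto (fun n => SimpleFunc.eapprox v n y) atTop (𝓝 (v y)) :=
      SimpleFunc.tendsto_eapprox hv y
    refine h1.congr' ?_
    filter_upwards [eventually_ge_atTop (spanningSetsIndex Λ y)] with n hn
    rw [happ, indicator_of_mem]
    exact monotone_spanningSets Λ hn (mem_spanningSetsIndex Λ y)

lemma tendsto_tsum_of_monotone {ι : Type*} {f : ℕ → ι → ENNReal} {g : ι → ENNReal}
    (hf : ∀ i, Monotone fun n => f n i) (hg : ∀ i, Tendsto (fun n => f n i) atTop (𝓝 (g i))) :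
    Tendsto (fun n => ∑' i, f n i) atTop (𝓝 (∑' i, g i)) := by
  let _ : MeasurableSpace ι := ⊤
  simp_rw [← lintegral_count]
  exact lintegral_tendsto_of_tendsto_of_monotone (fun n => measurable_from_top.aemeasurable)
    (ae_of_all _ hf) (ae_of_all _ hg)

lemma measurable_nexp_tsum {ι : Type*} [Countable ι] (hX : ∀ i, Measurable (X i)) {v : E → ENNReal}
    (hv : Measurable v) (e : ι → ℕ) : Measurable fun ω => nexp (∑' k, v (X (e k) ω)) :=
  measurable_nexp.comp (Measurable.tsum fun _ => hv.comp (hX _))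

/-- The exponents increase, so the exponentials decrease; the constant `1` dominates them on a
probability space. -/
lemma tendsto_lintegral_nexp_tsum [IsProbabilityMeasure P] (hX : ∀ i, Measurable (X i))
    {f : ℕ → SimpleFunc E ENNReal} {v : E → ENNReal} (hf : ∀ y, Monotone fun n => f n y)
    (hv : ∀ y, Tendsto (fun n => f n y) atTop (𝓝 (v y))) :
    Tendsto (fun n => ∫⁻ ω, nexp (∑' k, f n (X k ω)) ∂P) atTop
      (𝓝 (∫⁻ ω, nexp (∑' k, v (X k ω)) ∂P)) := by
  refine tendsto_lintegral_of_dominated_convergence (fun _ => 1)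
    (fun n => measurable_nexp_tsum hX (f n).measurable id)
    (fun n => ae_of_all _ fun ω => nexp_le_one _) (by simp) (ae_of_all _ fun ω => ?_)
  exact (continuous_nexp.tendsto _).comp
    (tendsto_tsum_of_monotone (fun _ => hf _) (fun _ => hv _))

/-- The Laplace functional of a Poisson process. -/
lemma IsPoissonProcess.laplace [IsProbabilityMeasure P] [SigmaFinite Λ]
    (hX : IsPoissonProcess P X Λ) {v : E → ENNReal} (hv : Measurable v) :
    ∫⁻ ω, nexp (∑' k, v (X k ω)) ∂P = nexp (∫⁻ y, (1 - nexp (v y)) ∂Λ) := by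
  obtain ⟨f, hf, hfin, hlim⟩ := exists_monotone_simpleFunc_tendsto Λ hv
  refine tendsto_nhds_unique (tendsto_lintegral_nexp_tsum hX.measurable hf hlim) ?_
  simp_rw [fun n => hX.laplace_simpleFunc (f n) (hfin n)]
  refine (continuous_nexp.tendsto _).comp ?_
  refine lintegral_tendsto_of_tendsto_of_monotone
    (fun n => (measurable_const.sub (measurable_nexp.comp (f n).measurable)).aemeasurable)
    (ae_of_all _ fun y m n hmn => tsub_le_tsub_left (nexp_antitone (hf y hmn)) 1)
    (ae_of_all _ fun y => ?_)
  exact ENNReal.Tendsto.sub tendsto_const_nhds ((continuous_nexp.tendsto _).comp (hlim y))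
    (Or.inl ENNReal.one_ne_top)

lemma IsPoissonProcess.mecke_indicator [IsProbabilityMeasure P] [SigmaFinite Λ]
    (hX : IsPoissonProcess P X Λ) {v : E → ENNReal} (hv : Measurable v) {A : Set E}
    (hA : MeasurableSet A) (hΛA : Λ A ≠ ⊤) :
    ∑' i, ∫⁻ ω, A.indicator 1 (X i ω) * nexp (∑' k : {k : ℕ // k ≠ i}, v (X k ω)) ∂P =
      Λ A * nexp (∫⁻ y, (1 - nexp (v y)) ∂Λ) := by
  have hAm : ∀ i, Measurable fun ω => A.indicator (1 : E → ENNReal) (X i ω) := fun i =>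
    (measurable_one.indicator hA).comp (hX.measurable i)
  have hm : ∀ {w : E → ENNReal}, Measurable w → ∀ i, Measurable fun ω =>
      A.indicator 1 (X i ω) * nexp (∑' k : {k : ℕ // k ≠ i}, w (X k ω)) := fun hw i =>
    (hAm i).mul (measurable_nexp_tsum hX.measurable hw Subtype.val)
  have hsimple : ∀ f : SimpleFunc E ENNReal, Λ {y | f y ≠ 0} ≠ ⊤ →
      ∑' i, ∫⁻ ω, A.indicator 1 (X i ω) * nexp (∑' k : {k : ℕ // k ≠ i}, f (X k ω)) ∂P =
      Λ A * ∫⁻ ω, nexp (∑' k, f (X k ω)) ∂P := fun f hf => by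
    rw [← lintegral_tsum fun i => (hm f.measurable i).aemeasurable]
    exact hX.mecke_simpleFunc f hf hA hΛA
  -- The case of exponent `0` says that the mean number of points in `A` is `Λ A`. This is the
  -- dominating mass for both limits below, over `i` and over `ω`.
  have hfin : ∑' i, ∫⁻ ω, A.indicator 1 (X i ω) ∂P ≠ ⊤ := by
    have := hsimple 0 (by simp)
    simp only [SimpleFunc.coe_zero, Pi.zero_apply, tsum_zero, nexp_zero, mul_one, lintegral_const,
      measure_univ] at this
    rwa [this]
  rw [← hX.laplace hv]
  obtain ⟨f, hf, hffin, hlim⟩ := exists_monotone_simpleFunc_tendsto Λ hv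
  refine tendsto_nhds_unique (f := fun n => ∑' i, ∫⁻ ω, A.indicator 1 (X i ω) *
    nexp (∑' k : {k : ℕ // k ≠ i}, f n (X k ω)) ∂P) (l := atTop) ?_ ?_
  · have hbound : ∀ (w : E → ENNReal) i ω, A.indicator 1 (X i ω) *
        nexp (∑' k : {k : ℕ // k ≠ i}, w (X k ω)) ≤ A.indicator 1 (X i ω) := fun w i ω =>
      mul_le_of_le_one_right' (nexp_le_one _)
    simp_rw [← MeasureTheory.lintegral_count (α := ℕ)]
    refine tendsto_lintegral_of_dominated_convergence
      (fun i => ∫⁻ ω, A.indicator 1 (X i ω) ∂P) (fun n => measurable_of_countable _)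
      (fun n => ae_of_all _ fun i => lintegral_mono (hbound _ i)) (by rwa [MeasureTheory.lintegral_count])
      (ae_of_all _ fun i => ?_)
    refine tendsto_lintegral_of_dominated_convergence (fun ω => A.indicator 1 (X i ω))
      (fun n => hm (f n).measurable i) (fun n => ae_of_all _ (hbound _ i))
      (ENNReal.ne_top_of_tsum_ne_top hfin i) (ae_of_all _ fun ω => ?_)
    refine ENNReal.Tendsto.const_mul ?_ (Or.inr ?_)
    · exact (continuous_nexp.tendsto _).comp
        (tendsto_tsum_of_monotone (fun _ => hf _) (fun _ => hlim _))
    · by_cases h : X i ω ∈ A <;> simp [h]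
  · simp_rw [fun n => hsimple (f n) (hffin n)]
    exact ENNReal.Tendsto.const_mul (tendsto_lintegral_nexp_tsum hX.measurable hf hlim)
      (Or.inr hΛA)

end Poisson

/-! ### Exponents that depend on the reference point -/

section Poisson

open Filter Topology Set

variable {Ω E : Type*} [MeasurableSpace Ω] [MeasurableSpace E] {P : Measure Ω}
  {X : ℕ → Ω → E} {Λ : Measure E}

lemma measurable_nexp_tsum_param (hX : ∀ i, Measurable (X i)) {v : ℝ → E → ENNReal}
    (hv : Measurable (Function.uncurry v)) {τ : E → ℝ} (hτ : Measurable τ) (i : ℕ) :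
    Measurable fun ω => nexp (∑' k : {k : ℕ // k ≠ i}, v (τ (X i ω)) (X k ω)) :=
  measurable_nexp.comp (Measurable.tsum fun k =>
    hv.comp ((hτ.comp (hX i)).prodMk (hX k)))

/-- Mecke formula when the exponent depends on the reference point through a label. -/
lemma IsPoissonProcess.mecke_countable [IsProbabilityMeasure P] [SigmaFinite Λ]
    (hX : IsPoissonProcess P X Λ) {v : ℤ → E → ENNReal} (hv : ∀ z, Measurable (v z))
    {q : E → ℤ} (hq : Measurable q) {A : Set E} (hA : MeasurableSet A) (hΛA : Λ A ≠ ⊤) :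
    ∑' i, ∫⁻ ω, A.indicator 1 (X i ω) *
        nexp (∑' k : {k : ℕ // k ≠ i}, v (q (X i ω)) (X k ω)) ∂P =
      ∫⁻ x, A.indicator 1 x * nexp (∫⁻ y, (1 - nexp (v (q x) y)) ∂Λ) ∂Λ := by
  have hAz : ∀ z, MeasurableSet (A ∩ q ⁻¹' {z}) := fun z => hA.inter (hq (measurableSet_singleton z))
  -- Cutting `A` into the countably many sets with constant label freezes the exponent, which
  -- reduces the claim to `mecke_indicator`.
  have hsplit : ∀ (x : E) (g : ℤ → ENNReal), A.indicator 1 x * g (q x) =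
      ∑' z, (A ∩ q ⁻¹' {z}).indicator 1 x * g z := by
    intro x g
    rw [tsum_eq_single (q x)]
    · by_cases hx : x ∈ A <;> simp [indicator, hx]
    · intro z hz
      simp [indicator, hz.symm]
  have h1 : ∀ i, ∫⁻ ω, A.indicator 1 (X i ω) *
        nexp (∑' k : {k : ℕ // k ≠ i}, v (q (X i ω)) (X k ω)) ∂P =
      ∑' z, ∫⁻ ω, (A ∩ q ⁻¹' {z}).indicator 1 (X i ω) *
        nexp (∑' k : {k : ℕ // k ≠ i}, v z (X k ω)) ∂P := fun i => by
    refine (lintegral_congr fun ω => hsplit _ (fun z => nexp (∑' k : {k : ℕ // k ≠ i},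
      v z (X k ω)))).trans (lintegral_tsum fun z => ?_)
    exact (((measurable_one.indicator (hAz z)).comp (hX.measurable i)).mul
      (measurable_nexp_tsum hX.measurable (hv z) Subtype.val)).aemeasurable
  simp_rw [h1]
  rw [ENNReal.tsum_comm]
  simp_rw [fun z => hX.mecke_indicator (hv z) (hAz z)
    (measure_ne_top_of_subset inter_subset_left hΛA)]
  refine Eq.trans ?_ ((lintegral_congr fun x => hsplit x
    (fun z => nexp (∫⁻ y, (1 - nexp (v z y)) ∂Λ))).trans (lintegral_tsum fun z => ?_)).symm
  · refine tsum_congr fun z => ?_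
    rw [lintegral_mul_const _ (measurable_one.indicator (hAz z)), lintegral_indicator_one (hAz z)]
  · exact ((measurable_one.indicator (hAz z)).mul measurable_const).aemeasurable

/-- Mecke formula when the exponent increases with a parameter of the reference point. -/
lemma IsPoissonProcess.mecke_monotone_indicator [IsProbabilityMeasure P] [SigmaFinite Λ]
    (hX : IsPoissonProcess P X Λ) {v : ℝ → E → ENNReal} (hv : Measurable (Function.uncurry v))
    (hmono : ∀ y, Monotone fun r => v r y) {τ : E → ℝ} (hτ : Measurable τ)
    (hτ0 : ∀ c, Λ (τ ⁻¹' {c}) = 0) {A : Set E} (hA : MeasurableSet A) (hΛA : Λ A ≠ ⊤) :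
    ∑' i, ∫⁻ ω, A.indicator 1 (X i ω) *
        nexp (∑' k : {k : ℕ // k ≠ i}, v (τ (X i ω)) (X k ω)) ∂P =
      ∫⁻ x, A.indicator 1 x * nexp (∫⁻ y, (1 - nexp (v (τ x) y)) ∂Λ) ∂Λ := by
  have hvr : ∀ r, Measurable (v r) := fun r => hv.comp measurable_prodMk_left
  set H : ℝ → ENNReal := fun r => nexp (∫⁻ y, (1 - nexp (v r y)) ∂Λ) with hH
  have hHanti : Antitone H := fun r s hrs => nexp_antitone
    (lintegral_mono fun y => tsub_le_tsub_left (nexp_antitone (hmono y hrs)) 1)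
  -- `H` is monotone, so it has only countably many discontinuities, and `τ` takes each of these
  -- values on a null set. Hence any approximation of `τ` may be used inside `H`.
  have hlim : ∀ (e : ℕ → ℝ → ℝ), (∀ n, Measurable (e n)) →
      (∀ t, Tendsto (fun n => e n t) atTop (𝓝 t)) →
      Tendsto (fun n => ∫⁻ x, A.indicator 1 x * H (e n (τ x)) ∂Λ) atTop
        (𝓝 (∫⁻ x, A.indicator 1 x * H (τ x) ∂Λ)) := by
    intro e he het
    refine tendsto_lintegral_of_dominated_convergence (A.indicator 1)
      (fun n => (measurable_one.indicator hA).mul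
        (hHanti.measurable.comp ((he n).comp hτ)))
      (fun n => ae_of_all _ fun x => mul_le_of_le_one_right' (nexp_le_one _))
      (by rwa [lintegral_indicator_one hA]) ?_
    have hnull : Λ (τ ⁻¹' {r | ¬ ContinuousAt H r}) = 0 := by
      rw [← biUnion_preimage_singleton]
      exact (measure_biUnion_null_iff hHanti.countable_not_continuousAt).2 fun c _ => hτ0 c
    have hae : ∀ᵐ x ∂Λ, ContinuousAt H (τ x) := by
      rw [ae_iff]
      exact hnull
    filter_upwards [hae] with x hx
    refine ENNReal.Tendsto.const_mul (hx.tendsto.comp (het _)) (Or.inr ?_)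
    by_cases h : x ∈ A <;> simp [h]
  -- Rounding `τ` to the grid of mesh `1 / (n + 1)` makes the dependence countable. The choice `a =
  -- 0` rounds down and bounds the left side from above; `a = 1` rounds up and bounds it from below.
  have hcell : ∀ (n : ℕ) (a : ℝ), ∑' i, ∫⁻ ω, A.indicator 1 (X i ω) *
        nexp (∑' k : {k : ℕ // k ≠ i}, v ((⌊((n : ℝ) + 1) * τ (X i ω)⌋ + a) / ((n : ℝ) + 1))
          (X k ω)) ∂P =
      ∫⁻ x, A.indicator 1 x * H ((⌊((n : ℝ) + 1) * τ x⌋ + a) / ((n : ℝ) + 1)) ∂Λ := fun n a =>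
    hX.mecke_countable (v := fun z => v ((z + a) / ((n : ℝ) + 1))) (fun z => hvr _)
      (q := fun x => ⌊((n : ℝ) + 1) * τ x⌋) (Int.measurable_floor.comp (hτ.const_mul _)) hA hΛA
  have hmeas : ∀ (n : ℕ) (a : ℝ),
      Measurable fun t : ℝ => ((⌊((n : ℝ) + 1) * t⌋ : ℝ) + a) / ((n : ℝ) + 1) := fun n a => by
    fun_prop
  have hconv : ∀ a ∈ Icc (0 : ℝ) 1, ∀ t : ℝ, Tendsto
      (fun n : ℕ => ((⌊((n : ℝ) + 1) * t⌋ : ℝ) + a) / ((n : ℝ) + 1)) atTop (𝓝 t) := by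
    intro a ha t
    rw [tendsto_iff_dist_tendsto_zero]
    refine squeeze_zero (fun _ => dist_nonneg) (fun n => ?_)
      (tendsto_one_div_add_atTop_nhds_zero_nat (𝕜 := ℝ))
    have hn : (0 : ℝ) < n + 1 := by positivity
    have e : ((⌊((n : ℝ) + 1) * t⌋ : ℝ) + a) / ((n : ℝ) + 1) - t =
      ((⌊((n : ℝ) + 1) * t⌋ : ℝ) + a - (n + 1) * t) / ((n : ℝ) + 1) := by field_simp
    rw [Real.dist_eq, e, abs_div, abs_of_pos hn]
    gcongr
    have h1 := Int.floor_le (((n : ℝ) + 1) * t)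
    have h2 := Int.lt_floor_add_one (((n : ℝ) + 1) * t)
    rw [abs_le]
    constructor <;> linarith [ha.1, ha.2]
  have hle : ∀ {r s : ℝ}, r ≤ s → ∀ i ω,
      A.indicator 1 (X i ω) * nexp (∑' k : {k : ℕ // k ≠ i}, v s (X k ω)) ≤
      A.indicator 1 (X i ω) * nexp (∑' k : {k : ℕ // k ≠ i}, v r (X k ω)) := fun hrs i ω => by
    gcongr
    exact nexp_antitone (ENNReal.tsum_le_tsum fun k => hmono _ hrs)
  refine le_antisymm ?_ ?_
  · refine ge_of_tendsto' (hlim _ (fun n => hmeas n 0) (hconv 0 (by simp))) fun n => ?_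
    rw [← hcell n 0]
    refine ENNReal.tsum_le_tsum fun i => lintegral_mono fun ω => hle ?_ i ω
    rw [add_zero, div_le_iff₀ (by positivity), mul_comm (τ _)]
    exact Int.floor_le _
  · refine le_of_tendsto' (hlim _ (fun n => hmeas n 1) (hconv 1 (by simp))) fun n => ?_
    rw [← hcell n 1]
    refine ENNReal.tsum_le_tsum fun i => lintegral_mono fun ω => hle ?_ i ω
    rw [le_div_iff₀ (by positivity), mul_comm (τ _)]
    exact (Int.lt_floor_add_one _).le

/-- Mecke formula with a weight. -/
lemma IsPoissonProcess.mecke [IsProbabilityMeasure P] [SigmaFinite Λ]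
    (hX : IsPoissonProcess P X Λ) {v : ℝ → E → ENNReal} (hv : Measurable (Function.uncurry v))
    (hmono : ∀ y, Monotone fun r => v r y) {τ : E → ℝ} (hτ : Measurable τ)
    (hτ0 : ∀ c, Λ (τ ⁻¹' {c}) = 0) {f : E → ENNReal} (hf : Measurable f) :
    ∑' i, ∫⁻ ω, f (X i ω) * nexp (∑' k : {k : ℕ // k ≠ i}, v (τ (X i ω)) (X k ω)) ∂P =
      ∫⁻ x, f x * nexp (∫⁻ y, (1 - nexp (v (τ x) y)) ∂Λ) ∂Λ := by
  set g : ℕ → Ω → ENNReal := fun i ω => nexp (∑' k : {k : ℕ // k ≠ i}, v (τ (X i ω)) (X k ω))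
    with hg
  have hgm : ∀ i, Measurable (g i) := fun i => measurable_nexp_tsum_param hX.measurable hv hτ i
  set H : E → ENNReal := fun x => nexp (∫⁻ y, (1 - nexp (v (τ x) y)) ∂Λ) with hH
  have hHm : Measurable H := measurable_nexp.comp (Measurable.lintegral_prod_right'
    (f := fun z : E × E => 1 - nexp (v (τ z.1) z.2)) (measurable_const.sub (measurable_nexp.comp
      (hv.comp ((hτ.comp measurable_fst).prodMk measurable_snd)))))
  -- As functions of `f`, both sides are integrals against measures on `E`. It suffices that these
  -- measures agree on sets of finite intensity, which the previous lemma gives, and σ-finiteness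
  -- does the rest.
  let M : Measure E := Measure.sum fun i => (P.withDensity (g i)).map (X i)
  have hM : ∀ {h : E → ENNReal}, Measurable h →
      ∫⁻ x, h x ∂M = ∑' i, ∫⁻ ω, h (X i ω) * g i ω ∂P := by
    intro h hh
    rw [lintegral_sum_measure]
    refine tsum_congr fun i => ?_
    rw [lintegral_map hh (hX.measurable i)]
    refine (lintegral_withDensity_eq_lintegral_mul P (hgm i) (hh.comp (hX.measurable i))).trans ?_
    exact lintegral_congr fun ω => mul_comm _ _
  have hN : ∀ {h : E → ENNReal}, Measurable h →
      ∫⁻ x, h x ∂(Λ.withDensity H) = ∫⁻ x, h x * H x ∂Λ := fun hh => by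
    rw [lintegral_withDensity_eq_lintegral_mul _ hHm hh]
    exact lintegral_congr fun ω => mul_comm _ _
  have hMN : M = Λ.withDensity H := by
    have hfin : ∀ A, MeasurableSet A → Λ A ≠ ⊤ → M A = Λ.withDensity H A := fun A hA hΛA => by
      rw [← lintegral_indicator_one hA, ← lintegral_indicator_one hA,
        hM (measurable_one.indicator hA), hN (measurable_one.indicator hA)]
      exact hX.mecke_monotone_indicator hv hmono hτ hτ0 hA hΛA
    ext A hA
    have hU : A = ⋃ n, A ∩ spanningSets Λ n := by
      rw [← inter_iUnion, iUnion_spanningSets, inter_univ]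
    have hmonoA : Monotone fun n => A ∩ spanningSets Λ n := fun m n hmn =>
      inter_subset_inter_right _ (monotone_spanningSets Λ hmn)
    rw [hU]
    refine tendsto_nhds_unique (tendsto_measure_iUnion_atTop hmonoA) ?_
    refine (tendsto_measure_iUnion_atTop hmonoA).congr fun n => (hfin _ ?_ ?_).symm
    · exact hA.inter (measurableSet_spanningSets Λ n)
    · exact measure_ne_top_of_subset inter_subset_right (measure_spanningSets_lt_top Λ n).ne
  rw [← hM hf, hMN, hN hf]

end Poisson

/-! ### Alzer's inequality and the gamma distribution -/

section Alzer

open Filter Topology Set Real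

lemma hasDerivAt_exp_neg_mul (c t : ℝ) :
    HasDerivAt (fun t => exp (-(c * t))) (-(c * exp (-(c * t)))) t := by
  have h := ((hasDerivAt_id' t).const_mul (-c)).exp
  simp only [neg_mul, mul_one, mul_neg] at h
  rwa [mul_comm] at h

lemma integral_exp_neg_mul_eq {c : ℝ} (hc : 0 < c) :
    ∫ t in (0 : ℝ)..1, exp (-(c * t)) = (1 - exp (-c)) / c := by
  have h : ∀ t ∈ uIcc (0 : ℝ) 1,
      HasDerivAt (fun t => -(exp (-(c * t)) / c)) (exp (-(c * t))) t := fun t _ => by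
    have h1 := ((hasDerivAt_exp_neg_mul c t).div_const c).fun_neg
    rwa [neg_div, mul_div_cancel_left₀ _ hc.ne', neg_neg] at h1
  rw [intervalIntegral.integral_eq_sub_of_hasDerivAt h (by
    apply Continuous.intervalIntegrable; fun_prop)]
  simp
  field_simp
  ring

/-- `(1 - e^{-c}) / c` is the mean of `e^{-ct}` over `[0, 1]`, and `e^{-yt}` is its power with
exponent `y / c ≥ 1`, so this is Jensen's inequality. -/
lemma one_sub_exp_neg_div_rpow_le {c y : ℝ} (hc : 0 < c) (hcy : c ≤ y) :
    ((1 - exp (-c)) / c) ^ (y / c) ≤ (1 - exp (-y)) / y := by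
  rw [← integral_exp_neg_mul_eq hc, ← integral_exp_neg_mul_eq (hc.trans_le hcy),
    intervalIntegral.integral_of_le zero_le_one, intervalIntegral.integral_of_le zero_le_one]
  have hpow : ∀ t, exp (-(y * t)) = exp (-(c * t)) ^ (y / c) := fun t => by
    rw [← exp_mul]
    congr 1
    field_simp
  have hint : ∀ d : ℝ, IntegrableOn (fun t => exp (-(d * t))) (Ioc 0 1) := fun d =>
    (Continuous.integrableOn_Icc (by fun_prop)).mono_set Ioc_subset_Icc_self
  have : IsProbabilityMeasure (volume.restrict (Ioc (0 : ℝ) 1)) := ⟨by simp⟩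
  have hp : 1 ≤ y / c := (one_le_div hc).2 hcy
  have := (convexOn_rpow hp).map_integral_le (μ := volume.restrict (Ioc (0 : ℝ) 1))
    (f := fun t => exp (-(c * t))) (continuousOn_id.rpow_const fun _ _ => Or.inr (by linarith))
    isClosed_Ici (ae_of_all _ fun t => (exp_pos _).le) (hint c) (by
      refine (hint y).congr (ae_of_all _ fun t => ?_)
      exact hpow t)
  refine this.trans_eq (integral_congr_ae (ae_of_all _ fun t => ?_))
  exact (hpow t).symm

lemma hasDerivAt_erlang_sub (m : ℕ) (a x : ℝ) :
    HasDerivAt (fun x => (∫ t in (0 : ℝ)..x, t ^ m * exp (-t) / m.factorial) -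
      (1 - exp (-(a * x))) ^ (m + 1))
      (x ^ m * exp (-x) / m.factorial -
        (m + 1) * (1 - exp (-(a * x))) ^ m * (a * exp (-(a * x)))) x := by
  have hg : Continuous fun t : ℝ => t ^ m * exp (-t) / m.factorial := by fun_prop
  refine (intervalIntegral.integral_hasDerivAt_right (hg.intervalIntegrable _ _)
    hg.stronglyMeasurable.stronglyMeasurableAtFilter hg.continuousAt).sub ?_
  have h1 := ((hasDerivAt_exp_neg_mul a x).const_sub 1).fun_pow (m + 1)
  rw [Nat.add_sub_cancel, neg_neg] at h1
  exact_mod_cast h1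

lemma integrableOn_erlang (m : ℕ) :
    IntegrableOn (fun t : ℝ => t ^ m * exp (-t) / m.factorial) (Ioi 0) := by
  have := GammaIntegral_convergent (s := (m : ℝ) + 1) (by positivity)
  refine IntegrableOn.congr_fun (this.div_const (m.factorial : ℝ)) (fun t ht => ?_)
    measurableSet_Ioi
  simp [mul_comm]

lemma integral_erlang (m : ℕ) :
    ∫ t in Ioi (0 : ℝ), t ^ m * exp (-t) / m.factorial = 1 := by
  have := Gamma_eq_integral (s := (m : ℝ) + 1) (by positivity)
  rw [Gamma_nat_eq_factorial] at this
  rw [integral_div, div_eq_one_iff_eq (by positivity), this]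
  refine setIntegral_congr_fun measurableSet_Ioi fun t ht => ?_
  simp [mul_comm]

/-- **Alzer's inequality** for the distribution function of the gamma distribution. -/
theorem pow_one_sub_exp_le_integral_erlang {m : ℕ} {a : ℝ} (ha : 0 < a)
    (ham : a ^ (m + 1) * (m + 1).factorial = 1) {x : ℝ} (hx : 0 ≤ x) :
    (1 - exp (-(a * x))) ^ (m + 1) ≤ ∫ t in (0 : ℝ)..x, t ^ m * exp (-t) / m.factorial := by
  by_contra! hlt
  set d : ℝ → ℝ := fun x => (∫ t in (0 : ℝ)..x, t ^ m * exp (-t) / m.factorial) -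
      (1 - exp (-(a * x))) ^ (m + 1) with hd
  set d' : ℝ → ℝ := fun x => x ^ m * exp (-x) / m.factorial -
        (m + 1) * (1 - exp (-(a * x))) ^ m * (a * exp (-(a * x))) with hd'
  have hderiv : ∀ x, HasDerivAt d (d' x) x := hasDerivAt_erlang_sub m a
  have hcont : Continuous d := continuous_iff_continuousAt.2 fun x => (hderiv x).continuousAt
  have hdx : d x < 0 := by simp only [hd]; linarith
  have hd0 : d 0 = 0 := by simp [hd]
  have hx0 : 0 < x := by
    rcases hx.lt_or_eq with h | h
    · exact h
    · rw [← h, hd0] at hdx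
      exact absurd hdx (lt_irrefl _)
  -- The normalisation of `a` reads `1 / m! = (m + 1) a^{m+1}`. After factoring, the sign of `d'` is
  -- that of `e^{-(1-a)y}` minus the `m`-th power of `(1 - e^{-ay}) / (ay)`.
  have hform : ∀ y, 0 < y → d' y = (m + 1) * a * (a * y) ^ m * exp (-(a * y)) *
      (exp (-((1 - a) * y)) - ((1 - exp (-(a * y))) / (a * y)) ^ m) := by
    intro y hy
    have h1 : (1 : ℝ) / m.factorial = (m + 1) * a ^ (m + 1) := by
      rw [Nat.factorial_succ] at ham
      push_cast at ham
      have : (m.factorial : ℝ) ≠ 0 := by positivity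
      field_simp
      linarith
    have h2 : exp (-y) = exp (-(a * y)) * exp (-((1 - a) * y)) := by
      rw [← exp_add]
      congr 1
      ring
    simp only [hd']
    rw [div_eq_mul_one_div, h1, h2, div_pow]
    have : (a * y) ^ m ≠ 0 := by positivity
    field_simp
    ring
  -- Since `d 0 = 0` and `d x < 0`, the derivative is negative somewhere before `x`.
  obtain ⟨c, ⟨hc0, hcx⟩, hc⟩ := exists_hasDerivAt_eq_slope d d' hx0 hcont.continuousOn
    fun y _ => hderiv y
  have hc' : d' c < 0 := by
    rw [hc, hd0]
    exact div_neg_of_neg_of_pos (by linarith) (by linarith)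
  have hexpc : exp (-((1 - a) * c)) < ((1 - exp (-(a * c))) / (a * c)) ^ m := by
    rw [hform c hc0] at hc'
    by_contra! h
    exact absurd hc' (not_lt.2 (mul_nonneg (by positivity) (sub_nonneg.2 h)))
  -- A negative sign at `c` persists: raising the inequality at `c` to the power `y / c` turns
  -- `e^{-(1-a)c}` into `e^{-(1-a)y}`, and Jensen controls the other side.
  have hneg : ∀ y, c ≤ y → d' y ≤ 0 := by
    intro y hcy
    have hy0 : 0 < y := hc0.trans_le hcy
    rw [hform y hy0]
    refine mul_nonpos_of_nonneg_of_nonpos (by positivity) (sub_nonpos.2 ?_)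
    have hbase : 0 ≤ (1 - exp (-(a * c))) / (a * c) := by
      refine div_nonneg ?_ (by positivity)
      rw [sub_nonneg, exp_le_one_iff]
      nlinarith [mul_pos ha hc0]
    have h1 := one_sub_exp_neg_div_rpow_le (mul_pos ha hc0) (mul_le_mul_of_nonneg_left hcy ha.le)
    rw [mul_div_mul_left _ _ ha.ne'] at h1
    calc exp (-((1 - a) * y)) = exp (-((1 - a) * c)) ^ (y / c) := by
          rw [← exp_mul]
          congr 1
          field_simp
      _ ≤ (((1 - exp (-(a * c))) / (a * c)) ^ m) ^ (y / c) :=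
          rpow_le_rpow (exp_pos _).le hexpc.le (by positivity)
      _ = (((1 - exp (-(a * c))) / (a * c)) ^ (y / c)) ^ m := by
          rw [← rpow_natCast, ← rpow_mul hbase, mul_comm (m : ℝ), rpow_mul hbase, rpow_natCast]
      _ ≤ _ := pow_le_pow_left₀ (rpow_nonneg hbase _) h1 m
  have hanti : AntitoneOn d (Ici c) := by
    refine antitoneOn_of_deriv_nonpos (convex_Ici c) hcont.continuousOn
      (fun y _ => (hderiv y).differentiableAt.differentiableWithinAt) fun y hy => ?_
    rw [interior_Ici] at hy
    rw [(hderiv y).deriv]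
    exact hneg y (le_of_lt hy)
  -- The limit is `0`. As `d` decreases on `[c, ∞)`, it cannot lie below this limit at `x`, which is
  -- the contradiction.
  have hlim : Tendsto d atTop (𝓝 (1 - (1 - 0) ^ (m + 1))) := by
    refine Tendsto.sub ?_ ((tendsto_const_nhds.sub ?_).pow _)
    · rw [← integral_erlang m]
      exact intervalIntegral_tendsto_integral_Ioi 0 (integrableOn_erlang m) tendsto_id
    · exact tendsto_exp_neg_atTop_nhds_zero.comp (tendsto_id.const_mul_atTop ha)
  have h0 : (1 : ℝ) - (1 - 0) ^ (m + 1) ≤ d x := by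
    refine le_of_tendsto hlim ?_
    filter_upwards [eventually_ge_atTop x] with y hy
    exact hanti hcx.le (hcx.le.trans hy) hy
  simp only [sub_zero, one_pow, sub_self] at h0
  linarith

lemma gammaMeasure_Iio (m : ℕ) {x : ℝ} (hx : 0 ≤ x) :
    gammaMeasure ((m : ℝ) + 1) 1 (Iio x) =
      ENNReal.ofReal (∫ t in (0 : ℝ)..x, t ^ m * exp (-t) / m.factorial) := by
  have hg : Continuous fun t : ℝ => t ^ m * exp (-t) / m.factorial := by fun_prop
  have hU : Iio x = Iio 0 ∪ Ico 0 x := (Iio_union_Ico_eq_Iio hx).symm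
  rw [gammaMeasure, withDensity_apply _ measurableSet_Iio, hU,
    lintegral_union measurableSet_Ico (by
      rw [Set.disjoint_left]; exact fun y hy hy' => not_lt.2 hy'.1 hy),
    lintegral_gammaPDF_of_nonpos le_rfl, zero_add, intervalIntegral.integral_of_le hx,
    ← integral_Ico_eq_integral_Ioc, ofReal_integral_eq_lintegral_ofReal]
  · refine setLIntegral_congr_fun measurableSet_Ico fun t ht => ?_
    rw [gammaPDF_of_nonneg ht.1, Gamma_nat_eq_factorial]
    congr 1
    simp
    ring
  · exact (hg.integrableOn_Icc).mono_set Ico_subset_Icc_self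
  · filter_upwards [ae_restrict_mem measurableSet_Ico] with t ht
    have := ht.1
    positivity

/-- Alzer's inequality for the tail of the gamma distribution. -/
lemma gammaMeasure_Ici_le {m : ℕ} {a : ℝ} (ha : 0 < a)
    (ham : a ^ (m + 1) * (m + 1).factorial = 1) {x : ℝ} (hx : 0 ≤ x) :
    gammaMeasure ((m : ℝ) + 1) 1 (Ici x) ≤
      1 - (1 - nexp (ENNReal.ofReal (a * x))) ^ (m + 1) := by
  have : IsProbabilityMeasure (gammaMeasure ((m : ℝ) + 1) 1) :=
    isProbabilityMeasure_gammaMeasure (by positivity) one_pos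
  rw [← compl_Iio, prob_compl_eq_one_sub measurableSet_Iio, gammaMeasure_Iio m hx,
    nexp_ofReal (by positivity), ← ENNReal.ofReal_one, ← ENNReal.ofReal_sub _ (exp_pos _).le,
    ← ENNReal.ofReal_pow (by
      rw [sub_nonneg, exp_le_one_iff]; nlinarith [mul_nonneg ha.le hx])]
  exact tsub_le_tsub_left (ENNReal.ofReal_le_ofReal (pow_one_sub_exp_le_integral_erlang ha ham hx)) _

/-- Exponential tilting: `e^{-sh}` times the density with rate `1` is `(1 + s)^{-n}` times the
density with rate `1 + s`. -/
lemma lintegral_nexp_gammaMeasure {n : ℝ} (hn : 0 < n) {s : ℝ} (hs : 0 ≤ s) :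
    ∫⁻ h, nexp (ENNReal.ofReal (s * h)) ∂gammaMeasure n 1 =
      ENNReal.ofReal (1 / (1 + s) ^ n) := by
  refine (lintegral_withDensity_eq_lintegral_mul volume (f := gammaPDF n 1)
    (measurable_gammaPDFReal _ _).ennreal_ofReal
    (measurable_nexp.comp (ENNReal.measurable_ofReal.comp (measurable_const_mul s)))).trans ?_
  simp only [Function.comp_def]
  have h1 : ∀ h, (gammaPDF n 1 * fun h => nexp (ENNReal.ofReal (s * h))) h =
      ENNReal.ofReal (1 / (1 + s) ^ n) * gammaPDF n (1 + s) h := by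
    intro h
    rw [Pi.mul_apply]
    rcases lt_or_ge h 0 with hh | hh
    · simp [gammaPDF_of_neg hh]
    · rw [gammaPDF_of_nonneg hh, gammaPDF_of_nonneg hh, nexp_ofReal (mul_nonneg hs hh),
        ← ENNReal.ofReal_mul (by have := Gamma_pos_of_pos hn; positivity),
        ← ENNReal.ofReal_mul (by positivity)]
      congr 1
      have h2 : exp (-((1 + s) * h)) = exp (-(1 * h)) * exp (-(s * h)) := by
        rw [← exp_add]; congr 1; ring
      have h3 : (1 + s) ^ n ≠ 0 := by positivity
      have := (Gamma_pos_of_pos hn).ne'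
      rw [h2, one_rpow]
      field_simp
  have h2 : Measurable (gammaPDF n (1 + s)) := (measurable_gammaPDFReal _ _).ennreal_ofReal
  rw [lintegral_congr h1, lintegral_const_mul _ h2,
    lintegral_gammaPDF_eq_one hn (by linarith), mul_one]

end Alzer

/-! ### Independent marks -/

section Marks

open Filter Topology Set

variable {Ω E M : Type*} [MeasurableSpace Ω] [MeasurableSpace E] [MeasurableSpace M]
  {P : Measure Ω} {X : ℕ → Ω → E} {Y : ℕ → Ω → M} {Λ : Measure E} {ν : Measure M}

/-- Independence factors the mean over the marks, and taking `nlog` of each factor restores a sum of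
exponents. Averaging out the marks therefore leads back to an exponential functional of the
locations. -/
lemma lintegral_nexp_tsum_mark [IsProbabilityMeasure P] {ι : Type*} [Countable ι] {e : ι → ℕ}
    (he : Function.Injective e) (hY : ∀ i, Measurable (Y i)) (hlaw : ∀ i, HasLaw (Y i) ν P)
    (hind : iIndepFun Y P) {W : ι → M → ENNReal} (hW : ∀ k, Measurable (W k)) :
    ∫⁻ ω, nexp (∑' k, W k (Y (e k) ω)) ∂P = nexp (∑' k, nlog (∫⁻ m, nexp (W k m) ∂ν)) := by
  have hmark : ∀ k, ∫⁻ ω, nexp (W k (Y (e k) ω)) ∂P = ∫⁻ m, nexp (W k m) ∂ν := fun k =>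
    (hlaw (e k)).lintegral_comp (f := fun m => nexp (W k m))
      (measurable_nexp.comp (hW k)).aemeasurable
  have hle : ∀ k, ∫⁻ m, nexp (W k m) ∂ν ≤ 1 := fun k => by
    rw [← hmark]
    calc _ ≤ ∫⁻ _, 1 ∂P := lintegral_mono fun ω => nexp_le_one _
      _ = 1 := by simp
  have hterm : ∀ k, Measurable fun ω => nexp (W k (Y (e k) ω)) := fun k =>
    measurable_nexp.comp ((hW k).comp (hY _))
  have h1 : Tendsto (fun s : Finset ι => ∫⁻ ω, ∏ k ∈ s, nexp (W k (Y (e k) ω)) ∂P) atTop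
      (𝓝 (∫⁻ ω, nexp (∑' k, W k (Y (e k) ω)) ∂P)) := by
    refine tendsto_lintegral_filter_of_dominated_convergence (fun _ => 1)
      (Eventually.of_forall fun s => Finset.measurable_fun_prod _ fun k _ => hterm k)
      (Eventually.of_forall fun s => ae_of_all _ fun ω =>
        Finset.prod_le_one' fun k _ => nexp_le_one _)
      (by simp) (ae_of_all _ fun ω => tendsto_nexp_tsum _)
  refine tendsto_nhds_unique h1 ?_
  refine (tendsto_nexp_tsum _).congr fun s => ?_
  have hind' := (hind.precomp he).comp (fun k m => nexp (W k m))
    fun k => measurable_nexp.comp (hW k)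
  refine Eq.trans ?_ (lintegral_prod_eq_prod_lintegral_of_indepFun s _ hind' hterm).symm
  refine Finset.prod_congr rfl fun k _ => ?_
  rw [nexp_nlog (hle k), ← hmark]
  rfl

lemma indepFun_compl_of_iIndepFun (hY : ∀ i, Measurable (Y i)) (hind : iIndepFun Y P) (i : ℕ) :
    IndepFun (Y i) (fun ω (k : {k : ℕ // k ≠ i}) => Y k ω) P := by
  have h1 := indep_iSup_of_disjoint (fun k => (hY k).comap_le) hind
    (S := {i}) (T := {i}ᶜ) disjoint_compl_right
  refine indep_of_indep_of_le_left (indep_of_indep_of_le_right h1 ?_) ?_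
  · refine Measurable.comap_le ?_
    refine @measurable_pi_lambda _ _ _ (_) _ _ fun k => ?_
    refine Measurable.mono (comap_measurable (Y k)) ?_ le_rfl
    exact le_iSup₂_of_le (f := fun n (_ : n ∈ ({i}ᶜ : Set ℕ)) => MeasurableSpace.comap (Y n) _)
      (k : ℕ) k.2 le_rfl
  · exact le_iSup₂_of_le (f := fun n (_ : n ∈ ({i} : Set ℕ)) => MeasurableSpace.comap (Y n) _)
      i rfl le_rfl

/-- Fubini for the joint law of one mark and all the others; it allows conditioning on everything
but the mark of the server. -/
lemma lintegral_mark_eq_lintegral_lintegral [IsProbabilityMeasure P] (hY : ∀ i, Measurable (Y i))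
    (hlaw : ∀ i, HasLaw (Y i) ν P) (hind : iIndepFun Y P) (i : ℕ)
    {Ψ : M × ({k : ℕ // k ≠ i} → M) → ENNReal} (hΨ : Measurable Ψ) :
    ∫⁻ ω, Ψ (Y i ω, fun k => Y k ω) ∂P = ∫⁻ ω, ∫⁻ m, Ψ (m, fun k => Y k ω) ∂ν ∂P := by
  have hY' : Measurable fun ω (k : {k : ℕ // k ≠ i}) => Y k ω :=
    measurable_pi_lambda _ fun k => hY k
  have hν : IsProbabilityMeasure ν := by
    rw [← (hlaw i).map_eq]; exact Measure.isProbabilityMeasure_map (hY i).aemeasurable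
  have h := (indepFun_iff_map_prod_eq_prod_map_map (hY i).aemeasurable hY'.aemeasurable).1
    (indepFun_compl_of_iIndepFun hY hind i)
  have h2 : IsProbabilityMeasure (P.map fun ω (k : {k : ℕ // k ≠ i}) => Y k ω) :=
    Measure.isProbabilityMeasure_map hY'.aemeasurable
  rw [← lintegral_map (f := Ψ) hΨ ((hY i).prodMk hY'), h, (hlaw i).map_eq,
    lintegral_prod_symm' _ hΨ, lintegral_map hΨ.lintegral_prod_left' hY']

lemma lintegral_indep_eq_lintegral_lintegral [IsProbabilityMeasure P]
    (hX : ∀ i, Measurable (X i)) (hY : ∀ i, Measurable (Y i))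
    (hXY : IndepFun (fun ω i => X i ω) (fun ω i => Y i ω) P)
    {Φ : (ℕ → E) × (ℕ → M) → ENNReal} (hΦ : Measurable Φ) :
    ∫⁻ ω, Φ (fun i => X i ω, fun i => Y i ω) ∂P =
      ∫⁻ ω, ∫⁻ ω', Φ (fun i => X i ω, fun i => Y i ω') ∂P ∂P := by
  have hX' : Measurable fun ω i => X i ω := measurable_pi_lambda _ hX
  have hY' : Measurable fun ω i => Y i ω := measurable_pi_lambda _ hY
  have h := (indepFun_iff_map_prod_eq_prod_map_map hX'.aemeasurable hY'.aemeasurable).1 hXY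
  have h1 : IsProbabilityMeasure (P.map fun ω i => Y i ω) :=
    Measure.isProbabilityMeasure_map hY'.aemeasurable
  rw [← lintegral_map (f := Φ) hΦ (hX'.prodMk hY'), h, lintegral_prod _ hΦ.aemeasurable,
    lintegral_map hΦ.lintegral_prod_right' hX']
  refine lintegral_congr fun ω => ?_
  exact lintegral_map (f := fun y => Φ (fun i => X i ω, y))
    (hΦ.comp measurable_prodMk_left) hY'

/-- Mecke formula for an independently marked Poisson process. -/
lemma IsPoissonProcess.mecke_marked [IsProbabilityMeasure P] [SigmaFinite Λ]
    (hX : IsPoissonProcess P X Λ) (hY : ∀ i, Measurable (Y i)) (hlaw : ∀ i, HasLaw (Y i) ν P)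
    (hind : iIndepFun Y P) (hXY : IndepFun (fun ω i => X i ω) (fun ω i => Y i ω) P)
    {w : ℝ × E × M → ENNReal} (hw : Measurable w) (hmono : ∀ y m, Monotone fun r => w (r, y, m))
    {τ : E → ℝ} (hτ : Measurable τ) (hτ0 : ∀ c, Λ (τ ⁻¹' {c}) = 0) {f : E → ENNReal}
    (hf : Measurable f) :
    ∑' i, ∫⁻ ω, f (X i ω) *
        nexp (∑' k : {k : ℕ // k ≠ i}, w (τ (X i ω), X k ω, Y k ω)) ∂P =
      ∫⁻ x, f x * nexp (∫⁻ y, (1 - ∫⁻ m, nexp (w (τ x, y, m)) ∂ν) ∂Λ) ∂Λ := by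
  have hν : IsProbabilityMeasure ν := by
    rw [← (hlaw 0).map_eq]; exact Measure.isProbabilityMeasure_map (hY 0).aemeasurable
  -- The effective exponent of an unmarked point at `y`. It inherits monotonicity in `r`, so the
  -- unmarked Mecke formula applies to it.
  let v : ℝ → E → ENNReal := fun r y => nlog (∫⁻ m, nexp (w (r, y, m)) ∂ν)
  have hv : Measurable (Function.uncurry v) := by
    refine measurable_nlog.comp (Measurable.lintegral_prod_right'
      (f := fun z : (ℝ × E) × M => nexp (w (z.1.1, z.1.2, z.2))) (measurable_nexp.comp (hw.comp ?_)))
    fun_prop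
  have hvmono : ∀ y, Monotone fun r => v r y := fun y r s hrs =>
    nlog_antitone (lintegral_mono fun m => nexp_antitone (hmono y m hrs))
  have hle : ∀ r y, ∫⁻ m, nexp (w (r, y, m)) ∂ν ≤ 1 := fun r y => by
    calc _ ≤ ∫⁻ _, 1 ∂ν := lintegral_mono fun ω => nexp_le_one _
      _ = 1 := by simp
  have hmecke := hX.mecke hv hvmono hτ hτ0 hf
  simp only [v, nexp_nlog (hle _ _)] at hmecke
  rw [← hmecke]
  refine tsum_congr fun i => ?_
  have hΦ : Measurable fun z : (ℕ → E) × (ℕ → M) => f (z.1 i) *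
      nexp (∑' k : {k : ℕ // k ≠ i}, w (τ (z.1 i), z.1 k, z.2 k)) := by
    refine (hf.comp (by fun_prop)).mul (measurable_nexp.comp (Measurable.tsum fun k => hw.comp ?_))
    fun_prop
  rw [lintegral_indep_eq_lintegral_lintegral hX.measurable hY hXY hΦ]
  refine lintegral_congr fun ω => ?_
  have hm : Measurable fun ω' =>
      nexp (∑' k : {k : ℕ // k ≠ i}, w (τ (X i ω), X k ω, Y k ω')) :=
    measurable_nexp.comp (Measurable.tsum fun k => hw.comp (by fun_prop))
  refine (lintegral_const_mul (f (X i ω)) hm).trans ?_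
  congr 1
  exact lintegral_nexp_tsum_mark Subtype.val_injective hY hlaw hind
    (W := fun (k : {k : ℕ // k ≠ i}) m => w (τ (X i ω), X k ω, m)) fun k => hw.comp (by fun_prop)

end Marks

/-! ### The mark of a single base station -/

section SingleMark

open Filter Topology Set

instance : DecidableEq Link
  | .los, .los | .nlos, .nlos => isTrue rfl
  | .los, .nlos | .nlos, .los => isFalse nofun

instance : DecidableEq Sector
  | .signal, .signal | .noise, .noise => isTrue rfl
  | .signal, .noise | .noise, .signal => isFalse nofun

instance : Fintype Link := ⟨⟨[Link.los, Link.nlos], by simp⟩, by rintro (_ | _) <;> simp⟩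

instance : Fintype Sector :=
  ⟨⟨[Sector.signal, Sector.noise], by simp⟩, by rintro (_ | _) <;> simp⟩

instance : MeasurableSpace Link := ⊤

instance : MeasurableSpace Sector := ⊤

instance : DiscreteMeasurableSpace Link := ⟨fun _ => trivial⟩

instance : DiscreteMeasurableSpace Sector := ⟨fun _ => trivial⟩

lemma sum_link {α : Type*} [AddCommMonoid α] (f : Link → α) :
    ∑ k, f k = f Link.los + f Link.nlos := by
  change (f Link.los + (f Link.nlos + 0)) = _
  rw [add_zero]

lemma sum_sector {α : Type*} [AddCommMonoid α] (f : Sector → α) :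
    ∑ s, f s = f Sector.signal + f Sector.noise := by
  change (f Sector.signal + (f Sector.noise + 0)) = _
  rw [add_zero]

/-- Blockage variable, boresight angle and fading gains of one base station. -/
abbrev Mark := ℝ × ℝ × ℝ × ℝ

/-- The fading gain of a link of the given type. -/
def gain (m : Mark) : Link → ℝ
  | Link.los => m.2.2.1
  | Link.nlos => m.2.2.2

/-- The probability of a link type at distance `t`. -/
def linkProb (p : Params) (t : ℝ) : Link → ℝ
  | Link.los => losProb p t
  | Link.nlos => 1 - losProb p t

/-- The type of the link of length `t` to a base station with mark `m`. -/
def markLink (p : Params) (t : ℝ) (m : Mark) : Link :=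
  if m.1 < losProb p t then Link.los else Link.nlos

/-- The sector in which a base station with mark `m` radiates towards the user. -/
def markSector (p : Params) (m : Mark) : Sector :=
  if |m.2.1| ≤ p.thetab then Sector.signal else Sector.noise

/-- The law of the mark of one base station. -/
def markLaw (p : Params) : Measure Mark :=
  (uniformLaw 0 1).prod ((uniformLaw (-180) 180).prod
    ((gammaMeasure (p.nak Link.los) 1).prod (gammaMeasure (p.nak Link.nlos) 1)))

lemma isProbabilityMeasure_uniformLaw {a b : ℝ} (hab : a < b) :
    IsProbabilityMeasure (uniformLaw a b) := by
  refine cond_isProbabilityMeasure_of_finite ?_ ?_ <;> simp [hab]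

lemma isProbabilityMeasure_fading {p : Params} (hnak : ∀ j, 1 ≤ p.nak j) (j : Link) :
    IsProbabilityMeasure (gammaMeasure (p.nak j) 1) :=
  isProbabilityMeasure_gammaMeasure (by exact_mod_cast hnak j) one_pos

lemma uniformLaw_lt {q : ℝ} (h1 : q ≤ 1) :
    uniformLaw 0 1 {b | b < q} = ENNReal.ofReal q := by
  rw [uniformLaw, cond_apply measurableSet_Icc]
  have : Icc (0 : ℝ) 1 ∩ {b | b < q} = Ico 0 q := by
    ext b
    simp only [mem_inter_iff, mem_Icc, mem_ofPred_eq, mem_Ico]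
    constructor
    · rintro ⟨⟨h2, h3⟩, h4⟩; exact ⟨h2, h4⟩
    · rintro ⟨h2, h4⟩; exact ⟨⟨h2, by linarith⟩, h4⟩
  rw [this]
  simp

lemma uniformLaw_abs_le {q : ℝ} (h1 : q ≤ 180) :
    uniformLaw (-180) 180 {b | |b| ≤ q} = ENNReal.ofReal (q / 180) := by
  rw [uniformLaw, cond_apply measurableSet_Icc]
  have : Icc (-180 : ℝ) 180 ∩ {b | |b| ≤ q} = Icc (-q) q := by
    ext b
    simp only [mem_inter_iff, mem_Icc, mem_ofPred_eq, abs_le]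
    constructor
    · rintro ⟨_, h⟩; exact h
    · rintro ⟨h2, h4⟩; exact ⟨⟨by linarith, by linarith⟩, h2, h4⟩
  rw [this, Real.volume_Icc, Real.volume_Icc, ← ENNReal.ofReal_inv_of_pos (by norm_num),
    ← ENNReal.ofReal_mul (by norm_num)]
  congr 1
  ring

lemma losProb_nonneg {p : Params} (hC₀ : 0 ≤ p.C) (t : ℝ) : 0 ≤ losProb p t := by
  unfold losProb; split_ifs <;> simp [hC₀]

lemma losProb_le_one {p : Params} (hC₁ : p.C ≤ 1) (t : ℝ) : losProb p t ≤ 1 := by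
  unfold losProb; split_ifs <;> simp [hC₁]

lemma linkProb_nonneg {p : Params} (hC₀ : 0 ≤ p.C) (hC₁ : p.C ≤ 1) (t : ℝ) (k : Link) :
    0 ≤ linkProb p t k := by
  cases k
  · exact losProb_nonneg hC₀ t
  · exact sub_nonneg.2 (losProb_le_one hC₁ t)

lemma sectorProb_nonneg {p : Params} (h0 : 0 ≤ p.thetab) (h1 : p.thetab ≤ 180) (s : Sector) :
    0 ≤ sectorProb p s := by
  cases s
  · exact div_nonneg h0 (by norm_num)
  · exact div_nonneg (by linarith) (by norm_num)

lemma lintegral_link {p : Params} (hC₀ : 0 ≤ p.C) (hC₁ : p.C ≤ 1) (t : ℝ) (k : Link) :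
    ∫⁻ b, (if (if b < losProb p t then Link.los else Link.nlos) = k then 1 else 0)
      ∂uniformLaw 0 1 = ENNReal.ofReal (linkProb p t k) := by
  have : IsProbabilityMeasure (uniformLaw 0 1) := isProbabilityMeasure_uniformLaw one_pos
  have hm : MeasurableSet {b | b < losProb p t} := measurableSet_Iio
  have h := uniformLaw_lt (losProb_le_one hC₁ t)
  cases k
  · rw [linkProb, ← h, ← lintegral_indicator_one hm]
    refine lintegral_congr fun b => ?_
    by_cases hb : b < losProb p t <;> simp [hb]
  · rw [linkProb, ENNReal.ofReal_sub _ (losProb_nonneg hC₀ t), ENNReal.ofReal_one, ← h,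
      ← prob_compl_eq_one_sub hm, ← lintegral_indicator_one hm.compl]
    refine lintegral_congr fun b => ?_
    by_cases hb : b < losProb p t <;> simp [hb]

lemma lintegral_sector {p : Params} (h0 : 0 ≤ p.thetab) (h1 : p.thetab ≤ 180) (s : Sector) :
    ∫⁻ b, (if (if |b| ≤ p.thetab then Sector.signal else Sector.noise) = s then 1 else 0)
      ∂uniformLaw (-180) 180 = ENNReal.ofReal (sectorProb p s) := by
  have : IsProbabilityMeasure (uniformLaw (-180) 180) :=
    isProbabilityMeasure_uniformLaw (by norm_num)
  have hm : MeasurableSet {b : ℝ | |b| ≤ p.thetab} :=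
    measurableSet_le (by fun_prop) measurable_const
  have h := uniformLaw_abs_le h1
  cases s
  · rw [sectorProb, ← h, ← lintegral_indicator_one hm]
    refine lintegral_congr fun b => ?_
    by_cases hb : |b| ≤ p.thetab <;> simp [hb]
  · rw [sectorProb, sub_div, div_self (by norm_num), ENNReal.ofReal_sub _ (by positivity),
      ENNReal.ofReal_one, ← h, ← prob_compl_eq_one_sub hm, ← lintegral_indicator_one hm.compl]
    refine lintegral_congr fun b => ?_
    by_cases hb : |b| ≤ p.thetab <;> simp [hb]

lemma measurable_gain (k : Link) : Measurable fun m : Mark => gain m k := by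
  cases k <;> simp only [gain] <;> fun_prop

lemma measurable_losProb (p : Params) : Measurable (losProb p) :=
  Measurable.ite measurableSet_Iic measurable_const measurable_const

lemma measurable_markLink (p : Params) : Measurable fun z : ℝ × Mark => markLink p z.1 z.2 :=
  Measurable.ite (measurableSet_lt (by fun_prop) ((measurable_losProb p).comp measurable_fst))
    measurable_const measurable_const

lemma measurable_markSector (p : Params) : Measurable (markSector p) :=
  Measurable.ite (measurableSet_le (by fun_prop) measurable_const)
    measurable_const measurable_const

/-- Averages over the mark of one base station. -/
lemma lintegral_markLaw {p : Params} (hC₀ : 0 ≤ p.C) (hC₁ : p.C ≤ 1) (hnak : ∀ j, 1 ≤ p.nak j)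
    (h0 : 0 ≤ p.thetab) (h1 : p.thetab ≤ 180) (t : ℝ) {G : Link → Sector → ℝ → ENNReal}
    (hG : ∀ k s, Measurable (G k s)) :
    ∫⁻ m, G (markLink p t m) (markSector p m) (gain m (markLink p t m)) ∂markLaw p =
      ∑ k, ∑ s, ENNReal.ofReal (linkProb p t k) * (ENNReal.ofReal (sectorProb p s) *
        ∫⁻ h, G k s h ∂gammaMeasure (p.nak k) 1) := by
  have i1 : IsProbabilityMeasure (uniformLaw 0 1) := isProbabilityMeasure_uniformLaw one_pos
  have i2 : IsProbabilityMeasure (uniformLaw (-180) 180) :=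
    isProbabilityMeasure_uniformLaw (by norm_num)
  have i3 : ∀ j, IsProbabilityMeasure (gammaMeasure (p.nak j) 1) :=
    isProbabilityMeasure_fading hnak
  let a : Link → ℝ → ENNReal := fun k b =>
    if (if b < losProb p t then Link.los else Link.nlos) = k then 1 else 0
  let c : Sector → ℝ → ENNReal := fun s b =>
    if (if |b| ≤ p.thetab then Sector.signal else Sector.noise) = s then 1 else 0
  have ha : ∀ k, Measurable (a k) := fun k =>
    (measurable_of_countable (fun l : Link => if l = k then (1 : ENNReal) else 0)).comp
      (Measurable.ite measurableSet_Iio measurable_const measurable_const)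
  have hc : ∀ s, Measurable (c s) := fun s =>
    (measurable_of_countable (fun l : Sector => if l = s then (1 : ENNReal) else 0)).comp
      (Measurable.ite (measurableSet_le (by fun_prop) measurable_const)
        measurable_const measurable_const)
  -- Indicators of link type and sector turn the integrand into a finite sum of products in separate
  -- coordinates of the mark, which integrate one by one; the fading of the other link type
  -- integrates to `1`.
  have hpt : ∀ m : Mark, G (markLink p t m) (markSector p m) (gain m (markLink p t m)) =
      ∑ k, ∑ s, a k m.1 * (c s m.2.1 * G k s (gain m k)) := by
    intro m
    rw [Finset.sum_eq_single (markLink p t m), Finset.sum_eq_single (markSector p m)]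
    · simp [a, c, markLink, markSector]
    · intro s _ hs
      simp only [c]
      rw [if_neg (fun h => hs h.symm)]
      simp
    · simp
    · intro k _ hk
      simp only [a]
      rw [if_neg (fun h => hk h.symm)]
      simp
    · simp
  have hGm : ∀ k s, Measurable fun m : Mark => a k m.1 * (c s m.2.1 * G k s (gain m k)) :=
    fun k s => ((ha k).comp (by fun_prop)).mul (((hc s).comp (by fun_prop)).mul
      ((hG k s).comp (measurable_gain k)))
  rw [lintegral_congr hpt, lintegral_finsetSum _ fun k _ => Finset.measurable_fun_sum _ fun s _ => hGm k s]
  refine Finset.sum_congr rfl fun k _ => ?_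
  rw [lintegral_finsetSum _ fun s _ => hGm k s]
  refine Finset.sum_congr rfl fun s _ => ?_
  have hfad : ∫⁻ h : ℝ × ℝ, G k s (gain (0, 0, h) k)
      ∂((gammaMeasure (p.nak Link.los) 1).prod (gammaMeasure (p.nak Link.nlos) 1)) =
      ∫⁻ h, G k s h ∂gammaMeasure (p.nak k) 1 := by
    cases k
    · have := lintegral_prod_mul (μ := gammaMeasure (p.nak Link.los) 1)
        (ν := gammaMeasure (p.nak Link.nlos) 1) (hG Link.los s).aemeasurable
        (g := fun _ => 1) aemeasurable_const
      simpa [gain] using this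
    · have := lintegral_prod_mul (μ := gammaMeasure (p.nak Link.los) 1)
        (ν := gammaMeasure (p.nak Link.nlos) 1) (f := fun _ => 1) aemeasurable_const
        (hG Link.nlos s).aemeasurable
      simpa [gain] using this
  have hgm : Measurable fun h : ℝ × ℝ => G k s (gain (0, 0, h) k) :=
    (hG k s).comp ((measurable_gain k).comp (by fun_prop))
  have hcm : Measurable fun z : ℝ × ℝ × ℝ => c s z.1 * G k s (gain (0, 0, z.2) k) :=
    ((hc s).comp measurable_fst).mul (hgm.comp measurable_snd)
  have hgain : ∀ m : Mark, gain m k = gain (0, 0, m.2.2) k := fun m => by cases k <;> rfl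
  simp_rw [hgain]
  rw [markLaw]
  refine (lintegral_prod_mul (f := a k) (g := fun z : ℝ × ℝ × ℝ => c s z.1 * G k s (gain (0, 0, z.2) k))
    (ha k).aemeasurable hcm.aemeasurable).trans ?_
  congr 1
  · exact lintegral_link hC₀ hC₁ t k
  refine (lintegral_prod_mul (f := c s) (g := fun h : ℝ × ℝ => G k s (gain (0, 0, h) k))
    (hc s).aemeasurable hgm.aemeasurable).trans ?_
  congr 1
  exact lintegral_sector h0 h1 s

end SingleMark

/-! ### Radial integrals -/

section Radial

open Filter Topology Set

lemma lintegral_fun_norm_plane (f : ℝ → ENNReal) (hf : Measurable f) :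
    ∫⁻ x : Plane, f ‖x‖ = ∫⁻ t in Ioi (0 : ℝ), ENNReal.ofReal (2 * Real.pi * t) * f t := by
  have hdim : Module.finrank ℝ Plane = 2 := by simp
  -- The total mass of the sphere is the dimension times the volume of the unit ball.
  have hsphere : (volume : Measure Plane).toSphere univ = ENNReal.ofReal (2 * Real.pi) := by
    rw [Measure.toSphere_apply_univ, hdim, EuclideanSpace.volume_ball_fin_two]
    rw [ENNReal.ofReal_mul (by norm_num)]
    simp
  calc ∫⁻ x : Plane, f ‖x‖ = ∫⁻ x : ({(0)}ᶜ : Set Plane), f ‖x.1‖ ∂(volume.comap Subtype.val) := by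
        rw [lintegral_subtype_comap (measurableSet_singleton _).compl fun x : Plane => f ‖x‖,
          restrict_compl_singleton]
    _ = ∫⁻ x, f x.2 ∂(volume : Measure Plane).toSphere.prod (.volumeIoiPow 1) := by
        have h := ((volume : Measure Plane).measurePreserving_homeomorphUnitSphereProd).lintegral_comp_emb
          (Homeomorph.measurableEmbedding _) (fun z => f z.2)
        simpa [hdim] using h
    _ = ENNReal.ofReal (2 * Real.pi) * ∫⁻ x : Ioi (0 : ℝ), f x ∂.volumeIoiPow 1 := by
        have h := lintegral_prod_mul (μ := (volume : Measure Plane).toSphere)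
          (ν := Measure.volumeIoiPow 1) (f := fun _ => 1) (g := fun x : Ioi (0 : ℝ) => f x)
          aemeasurable_const (hf.comp measurable_subtype_coe).aemeasurable
        simpa [hsphere] using h
    _ = _ := by
        have h1 : ∫⁻ x : Ioi (0 : ℝ), f x ∂.volumeIoiPow 1 =
            ∫⁻ x : Ioi (0 : ℝ), ENNReal.ofReal (x.1 ^ 1) * f x ∂(volume.comap Subtype.val) :=
          lintegral_withDensity_eq_lintegral_mul _ (by fun_prop) (hf.comp measurable_subtype_coe)
        rw [h1]
        have h := lintegral_subtype_comap (μ := volume) (measurableSet_Ioi (a := (0 : ℝ)))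
          (fun t => ENNReal.ofReal (t ^ 1) * f t)
        refine (congrArg _ h).trans ?_
        rw [← lintegral_const_mul _ (by fun_prop)]
        refine setLIntegral_congr_fun measurableSet_Ioi fun t ht => ?_
        rw [← mul_assoc, pow_one, ← ENNReal.ofReal_mul (by positivity)]

lemma lintegral_radial {lam : ℝ} (hlam : 0 ≤ lam) (f : ℝ → ENNReal) (hf : Measurable f) :
    ∫⁻ x, f ‖x‖ ∂(ENNReal.ofReal lam • (volume : Measure Plane)) =
      ∫⁻ t in Ioi (0 : ℝ), ENNReal.ofReal (2 * Real.pi * lam * t) * f t := by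
  rw [lintegral_smul_measure, lintegral_fun_norm_plane f hf, smul_eq_mul,
    ← lintegral_const_mul _ (by fun_prop)]
  refine setLIntegral_congr_fun measurableSet_Ioi fun t ht => ?_
  rw [← mul_assoc, ← ENNReal.ofReal_mul hlam]
  congr 2
  ring

/-- Supplies the absence of atoms that the Mecke formula asks of the distance of the reference
point. -/
lemma measure_norm_preimage_singleton (lam c : ℝ) :
    (ENNReal.ofReal lam • (volume : Measure Plane)) ((fun x => ‖x‖) ⁻¹' {c}) = 0 := by
  have h : (fun x : Plane => ‖x‖) ⁻¹' {c} = Metric.sphere 0 c := by ext; simp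
  rw [h, Measure.smul_apply, Measure.addHaar_sphere, smul_zero]

lemma lintegral_Ioc_two_mul {a b c : ℝ} (ha : 0 ≤ a) (hab : a ≤ b) (hc : 0 ≤ c) :
    ∫⁻ t in Ioc a b, ENNReal.ofReal (2 * c * t) = ENNReal.ofReal (c * (b ^ 2 - a ^ 2)) := by
  rw [← ofReal_integral_eq_lintegral_ofReal, ← intervalIntegral.integral_of_le hab]
  · rw [intervalIntegral.integral_const_mul, integral_id]
    congr 1
    ring
  · exact (Continuous.integrableOn_Icc (by fun_prop)).mono_set Ioc_subset_Icc_self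
  · filter_upwards [ae_restrict_mem measurableSet_Ioc] with t ht
    have := ha.trans ht.1.le
    positivity

end Radial

/-! ### The interference of a single base station -/

section Single

open Filter Topology Set

/-- Path loss at distance `t` for a base station with mark `m`. -/
def markLoss (p : Params) (t : ℝ) (m : Mark) : ℝ :=
  p.coef (markLink p t m) * t ^ (-p.expo (markLink p t m))

/-- Exponent of a competing base station: infinite when it is stronger than a serving base station
of type `j` at distance `z.1`, and proportional to its interference otherwise. -/
def rivalExponent (p : Params) (j : Link) (c : ℝ) (z : ℝ × Plane × Mark) : ENNReal :=
  -- Cutting the distance off at `0` makes the exponent monotone on all of `ℝ`, as the Mecke formula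
  -- requires, and changes nothing at actual distances.
  (if markLoss p ‖z.2.1‖ z.2.2 * max z.1 0 ^ p.expo j ≤ p.coef j then 0 else ⊤) +
    ENNReal.ofReal (c * max z.1 0 ^ p.expo j) *
      ENNReal.ofReal (power p (markSector p z.2.2) *
        gain z.2.2 (markLink p ‖z.2.1‖ z.2.2) * markLoss p ‖z.2.1‖ z.2.2)

lemma measurable_link_apply {α : Type*} [MeasurableSpace α] {β : Type*} [MeasurableSpace β]
    {f : Link → α → β} (hf : ∀ k, Measurable (f k)) {l : α → Link} (hl : Measurable l) :
    Measurable fun a => f (l a) a :=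
  (measurable_from_prod_countable_right (f := fun z : Link × α => f z.1 z.2) hf).comp
    (hl.prodMk measurable_id)

lemma measurable_markLoss (p : Params) : Measurable fun z : ℝ × Mark => markLoss p z.1 z.2 := by
  unfold markLoss
  exact measurable_link_apply (f := fun k (z : ℝ × Mark) => p.coef k * z.1 ^ (-p.expo k))
    (fun k => by fun_prop) (measurable_markLink p)

lemma measurable_markPower (p : Params) : Measurable fun z : ℝ × Mark =>
    power p (markSector p z.2) * gain z.2 (markLink p z.1 z.2) * markLoss p z.1 z.2 := by
  refine Measurable.mul (Measurable.mul ?_ ?_) (measurable_markLoss p)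
  · exact (measurable_of_countable (power p)).comp
      ((measurable_markSector p).comp measurable_snd)
  · exact measurable_link_apply (f := fun k (z : ℝ × Mark) => gain z.2 k)
      (fun k => (measurable_gain k).comp measurable_snd) (measurable_markLink p)

lemma measurable_rivalExponent (p : Params) (j : Link) (c : ℝ) :
    Measurable (rivalExponent p j c) := by
  have h1 : Measurable fun z : ℝ × Plane × Mark => markLoss p ‖z.2.1‖ z.2.2 :=
    (measurable_markLoss p).comp (f := fun z : ℝ × Plane × Mark => (‖z.2.1‖, z.2.2)) (by fun_prop)
  have h2 := (measurable_markPower p).comp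
    (f := fun z : ℝ × Plane × Mark => (‖z.2.1‖, z.2.2)) (by fun_prop)
  refine Measurable.add (Measurable.ite (measurableSet_le ?_ measurable_const)
    measurable_const measurable_const) (Measurable.mul ?_ h2.ennreal_ofReal)
  · exact h1.mul (by fun_prop)
  · fun_prop

lemma markLoss_nonneg {p : Params} (hcoef : ∀ j, 0 < p.coef j) {t : ℝ} (ht : 0 ≤ t) (m : Mark) :
    0 ≤ markLoss p t m :=
  mul_nonneg (hcoef _).le (Real.rpow_nonneg ht _)

lemma rivalExponent_monotone {p : Params} (hcoef : ∀ j, 0 < p.coef j) (hexpo : ∀ j, 0 < p.expo j)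
    (j : Link) {c : ℝ} (hc : 0 ≤ c) (y : Plane) (m : Mark) :
    Monotone fun r => rivalExponent p j c (r, y, m) := by
  intro r s hrs
  have h1 : max r 0 ^ p.expo j ≤ max s 0 ^ p.expo j :=
    Real.rpow_le_rpow (le_max_right _ _) (max_le_max_right 0 hrs) (hexpo j).le
  have h2 := markLoss_nonneg hcoef (norm_nonneg y) m
  unfold rivalExponent
  simp only
  refine add_le_add ?_ ?_
  · split_ifs with h3 h4
    · exact le_rfl
    · exact le_top
    · exact absurd ((mul_le_mul_of_nonneg_left h1 h2).trans ‹_›) h3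
    · exact le_rfl
  · gcongr

lemma power_nonneg {p : Params} (hPt : 0 < p.Pt) (hMs : 0 < p.Ms) (hMa : 0 ≤ p.Ma)
    (hphi₀ : 0 < p.phi) (hphi₁ : p.phi ≤ 1) (s : Sector) : 0 ≤ power p s := by
  have : 0 ≤ 1 - p.phi := by linarith
  cases s <;> simp only [power] <;> positivity

lemma F_denom_le {p : Params} (hcoef : ∀ j, 0 < p.coef j) (hpow : ∀ s, 0 ≤ power p s)
    (k : Link) (s : Sector) {c d t : ℝ} (hc : 0 ≤ c) (hd : 0 ≤ d) (ht : 0 ≤ t) :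
    1 ≤ (1 + c * d * power p s * p.coef k * t ^ (-p.expo k)) ^ p.nak k := by
  refine one_le_pow₀ ?_
  have := hpow s
  have := (hcoef k).le
  have : 0 ≤ c * d * power p s * p.coef k * t ^ (-p.expo k) := by positivity
  linarith

lemma F_nonneg {p : Params} (hcoef : ∀ j, 0 < p.coef j) (hpow : ∀ s, 0 ≤ power p s)
    (k : Link) (s : Sector) {c d t : ℝ} (hc : 0 ≤ c) (hd : 0 ≤ d) (ht : 0 ≤ t) :
    0 ≤ F p k s c d t := by
  have h := F_denom_le hcoef hpow k s hc hd ht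
  rw [F, sub_nonneg]
  exact (div_le_one (by linarith)).2 h

lemma F_le_one {p : Params} (hcoef : ∀ j, 0 < p.coef j) (hpow : ∀ s, 0 ≤ power p s)
    (k : Link) (s : Sector) {c d t : ℝ} (hc : 0 ≤ c) (hd : 0 ≤ d) (ht : 0 ≤ t) :
    F p k s c d t ≤ 1 := by
  have h := F_denom_le hcoef hpow k s hc hd ht
  have : 0 ≤ 1 / (1 + c * d * power p s * p.coef k * t ^ (-p.expo k)) ^ p.nak k := by
    positivity
  rw [F]
  linarith

lemma sum_linkProb {p : Params} (hC₀ : 0 ≤ p.C) (hC₁ : p.C ≤ 1) (t : ℝ) :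
    ∑ k, ENNReal.ofReal (linkProb p t k) = 1 := by
  rw [sum_link, ← ENNReal.ofReal_add (linkProb_nonneg hC₀ hC₁ t _) (linkProb_nonneg hC₀ hC₁ t _)]
  simp [linkProb]

lemma sum_sectorProb {p : Params} (h0 : 0 ≤ p.thetab) (h1 : p.thetab ≤ 180) :
    ∑ s, ENNReal.ofReal (sectorProb p s) = 1 := by
  rw [sum_sector, ← ENNReal.ofReal_add (sectorProb_nonneg h0 h1 _) (sectorProb_nonneg h0 h1 _)]
  simp only [sectorProb]
  rw [← ENNReal.ofReal_one]
  congr 1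
  ring

/-- Mean effect of one competing base station at distance `t = ‖y‖`. -/
lemma one_sub_lintegral_nexp_rivalExponent {p : Params} (hC₀ : 0 ≤ p.C) (hC₁ : p.C ≤ 1)
    (hnak : ∀ j, 1 ≤ p.nak j) (h0 : 0 ≤ p.thetab) (h1 : p.thetab ≤ 180)
    (hcoef : ∀ j, 0 < p.coef j) (hpow : ∀ s, 0 ≤ power p s) (j : Link) {c r : ℝ} (hc : 0 ≤ c)
    (hr : 0 ≤ r) (y : Plane) :
    1 - ∫⁻ m, nexp (rivalExponent p j c (r, y, m)) ∂markLaw p =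
      ∑ k, ∑ s, ENNReal.ofReal (linkProb p ‖y‖ k) * (ENNReal.ofReal (sectorProb p s) *
        if p.coef k * ‖y‖ ^ (-p.expo k) * r ^ p.expo j ≤ p.coef j then
          ENNReal.ofReal (F p k s c (r ^ p.expo j) ‖y‖) else 1) := by
  set t := ‖y‖ with ht
  have ht0 : 0 ≤ t := norm_nonneg y
  have hd : 0 ≤ r ^ p.expo j := Real.rpow_nonneg hr _
  let ok : Link → Prop := fun k => p.coef k * t ^ (-p.expo k) * r ^ p.expo j ≤ p.coef j
  let G : Link → Sector → ℝ → ENNReal := fun k s h => nexp ((if ok k then 0 else ⊤) +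
    ENNReal.ofReal (c * r ^ p.expo j) * ENNReal.ofReal (power p s * h *
      (p.coef k * t ^ (-p.expo k))))
  have hG : ∀ k s, Measurable (G k s) := fun k s => measurable_nexp.comp (by fun_prop)
  have hexp : ∀ m, nexp (rivalExponent p j c (r, y, m)) =
      G (markLink p t m) (markSector p m) (gain m (markLink p t m)) := fun m => by
    simp only [rivalExponent, markLoss, G, ok, max_eq_left hr, ← ht]
  have hGint : ∀ k s, ∫⁻ h, G k s h ∂gammaMeasure (p.nak k) 1 =
      if ok k then ENNReal.ofReal (1 - F p k s c (r ^ p.expo j) t) else 0 := by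
    intro k s
    have hk := (hcoef k).le
    have hs := hpow s
    have hq : 0 ≤ c * r ^ p.expo j * power p s * p.coef k * t ^ (-p.expo k) := by positivity
    split_ifs with hok
    · rw [F, sub_sub_cancel, ← Real.rpow_natCast,
        ← lintegral_nexp_gammaMeasure (by exact_mod_cast hnak k) hq]
      refine lintegral_congr fun h => ?_
      simp only [G, if_pos hok, zero_add]
      rw [← ENNReal.ofReal_mul (by positivity)]
      congr 2
      ring
    · simp [G, hok]
  rw [lintegral_congr hexp, lintegral_markLaw hC₀ hC₁ hnak h0 h1 t hG]
  -- The probabilities of type and sector sum to `1`, and each is split into `F` and `1 - F`, or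
  -- into `1` and `0` when a stronger competitor is excluded.
  have hsum : (1 : ENNReal) = (∑ k, ∑ s, ENNReal.ofReal (linkProb p t k) *
        (ENNReal.ofReal (sectorProb p s) *
        if ok k then ENNReal.ofReal (F p k s c (r ^ p.expo j) t) else 1)) +
      ∑ k, ∑ s, ENNReal.ofReal (linkProb p t k) * (ENNReal.ofReal (sectorProb p s) *
        ∫⁻ h, G k s h ∂gammaMeasure (p.nak k) 1) := by
    have hone : (1 : ENNReal) = ∑ k, ∑ s, ENNReal.ofReal (linkProb p t k) *
        ENNReal.ofReal (sectorProb p s) := by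
      simp_rw [← Finset.mul_sum, sum_sectorProb h0 h1, mul_one, sum_linkProb hC₀ hC₁]
    refine hone.trans ?_
    simp_rw [← Finset.sum_add_distrib, ← mul_add, hGint]
    refine Finset.sum_congr rfl fun k _ => Finset.sum_congr rfl fun s _ => ?_
    congr 1
    have hF0 := F_nonneg hcoef hpow k s hc hd ht0
    have hF1 := F_le_one hcoef hpow k s hc hd ht0
    split_ifs
    · rw [← ENNReal.ofReal_add hF0 (by linarith), add_sub_cancel, ENNReal.ofReal_one, mul_one]
    · simp
  refine ENNReal.sub_eq_of_eq_add ?_ hsum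
  intro h
  rw [h, add_top] at hsum
  exact ENNReal.one_ne_top hsum

end Single

/-! ### The total exponent of the competing base stations -/

section Total

open Filter Topology Set

/-- Distance at which a link of type `k` is as strong as a link of type `j` at distance `r`. -/
def equalLossDist (p : Params) (j k : Link) (r : ℝ) : ℝ :=
  (p.coef k / p.coef j) ^ (1 / p.expo k) * r ^ (p.expo j / p.expo k)

lemma equalLossDist_self {p : Params} (hcoef : ∀ j, 0 < p.coef j) (hexpo : ∀ j, 0 < p.expo j)
    (j : Link) (r : ℝ) : equalLossDist p j j r = r := by
  simp [equalLossDist, div_self (hcoef j).ne', div_self (hexpo j).ne']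

lemma equalLossDist_nonneg {p : Params} (hcoef : ∀ j, 0 < p.coef j) (j k : Link) {r : ℝ}
    (hr : 0 ≤ r) : 0 ≤ equalLossDist p j k r :=
  mul_nonneg (Real.rpow_nonneg (div_nonneg (hcoef k).le (hcoef j).le) _) (Real.rpow_nonneg hr _)

lemma equalLossDist_rpow {p : Params} (hcoef : ∀ j, 0 < p.coef j) (hexpo : ∀ j, 0 < p.expo j)
    (j k : Link) {r : ℝ} (hr : 0 ≤ r) :
    equalLossDist p j k r ^ p.expo k = p.coef k / p.coef j * r ^ p.expo j := by
  have h1 : 0 ≤ p.coef k / p.coef j := div_nonneg (hcoef k).le (hcoef j).le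
  rw [equalLossDist, Real.mul_rpow (Real.rpow_nonneg h1 _) (Real.rpow_nonneg hr _),
    ← Real.rpow_mul h1, ← Real.rpow_mul hr, one_div_mul_cancel (hexpo k).ne', Real.rpow_one,
    div_mul_cancel₀ _ (hexpo k).ne']

lemma not_stronger_iff {p : Params} (hcoef : ∀ j, 0 < p.coef j) (hexpo : ∀ j, 0 < p.expo j)
    (j k : Link) {r t : ℝ} (hr : 0 ≤ r) (ht : 0 < t) :
    p.coef k * t ^ (-p.expo k) * r ^ p.expo j ≤ p.coef j ↔ equalLossDist p j k r ≤ t := by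
  rw [← Real.rpow_le_rpow_iff (equalLossDist_nonneg hcoef j k hr) ht.le (hexpo k),
    equalLossDist_rpow hcoef hexpo j k hr, Real.rpow_neg ht.le]
  have h1 : 0 < t ^ p.expo k := Real.rpow_pos_of_pos ht _
  have h2 := hcoef j
  rw [mul_right_comm, ← div_eq_mul_inv, div_le_iff₀ h1, div_mul_eq_mul_div, div_le_iff₀ h2,
    mul_comm (p.coef j)]

/-- The exponent in `Delta`. -/
def deltaExponent (p : Params) (k : Link) (s : Sector) (z : ℝ) (I : Set ℝ) (c d : ℝ) : ENNReal :=
  ENNReal.ofReal (2 * Real.pi * z * p.lam * sectorProb p s) *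
    ∫⁻ y in I, ENNReal.ofReal (F p k s c d y * y)

lemma Delta_nonneg (p : Params) (k : Link) (s : Sector) (z : ℝ) (I : Set ℝ) (c d : ℝ) :
    0 ≤ Delta p k s z I c d := ENNReal.toReal_nonneg

lemma Delta_le_one (p : Params) (k : Link) (s : Sector) (z : ℝ) (I : Set ℝ) (c d : ℝ) :
    Delta p k s z I c d ≤ 1 :=
  ENNReal.toReal_le_of_le_ofReal zero_le_one (ENNReal.ofReal_one ▸ nexp_le_one _)

lemma nexp_deltaExponent (p : Params) (k : Link) (s : Sector) (z : ℝ) (I : Set ℝ) (c d : ℝ) :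
    nexp (deltaExponent p k s z I c d) = ENNReal.ofReal (Delta p k s z I c d) :=
  (ENNReal.ofReal_toReal (nexp_ne_top _)).symm

lemma measurable_F (p : Params) (k : Link) (s : Sector) (c d : ℝ) : Measurable (F p k s c d) := by
  unfold F; fun_prop

lemma measurable_linkProb (p : Params) (k : Link) : Measurable fun t => linkProb p t k := by
  cases k
  · exact measurable_losProb p
  · exact measurable_const.sub (measurable_losProb p)

/-- Mean effect of a competing base station of type `k` at distance `t`, where those that are
closer than `h` are excluded. -/
def rivalEffect (p : Params) (k : Link) (c d h t : ℝ) : ENNReal :=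
  ∑ s, ENNReal.ofReal (sectorProb p s) * if h ≤ t then ENNReal.ofReal (F p k s c d t) else 1

lemma measurable_rivalEffect (p : Params) (k : Link) (c d h : ℝ) :
    Measurable (rivalEffect p k c d h) := by
  unfold rivalEffect
  exact Finset.measurable_fun_sum _ fun s _ => measurable_const.mul
    (Measurable.ite measurableSet_Ici (measurable_F p k s c d).ennreal_ofReal measurable_const)

/-- Split at `h`: below it every competitor is forbidden and contributes the full intensity, summed
over sectors; above it only `F` contributes, and the sectors stay separate. -/
lemma setLIntegral_rivalEffect {p : Params} (hlam : 0 ≤ p.lam) (h0 : 0 ≤ p.thetab)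
    (h1 : p.thetab ≤ 180) (k : Link) {c d h z : ℝ} (hz : 0 ≤ z)
    {R : Set ℝ} (hR : MeasurableSet R) (hR0 : R ⊆ Ioi 0) :
    ∫⁻ t in R, ENNReal.ofReal (2 * Real.pi * p.lam * t) *
        (ENNReal.ofReal z * rivalEffect p k c d h t) =
      (∫⁻ t in R ∩ Iio h, ENNReal.ofReal (2 * (Real.pi * p.lam * z) * t)) +
        ∑ s, deltaExponent p k s z (R ∩ Ici h) c d := by
  rw [← lintegral_inter_add_sdiff _ R (measurableSet_Iio (a := h))]
  have hdiff : R \ Iio h = R ∩ Ici h := by ext; simp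
  rw [hdiff]
  congr 1
  · refine setLIntegral_congr_fun (hR.inter measurableSet_Iio) fun t ht => ?_
    have ht0 : 0 < t := hR0 ht.1
    have hth : ¬ h ≤ t := not_le.2 ht.2
    simp only [rivalEffect, if_neg hth, mul_one, sum_sectorProb h0 h1]
    rw [← ENNReal.ofReal_mul (by positivity)]
    congr 1
    ring
  · have hm : ∀ s, Measurable fun t => ENNReal.ofReal (F p k s c d t * t) := fun s =>
      ((measurable_F p k s c d).mul measurable_id).ennreal_ofReal
    simp_rw [deltaExponent]
    simp_rw [← fun s => lintegral_const_mul (μ := volume.restrict (R ∩ Ici h))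
      (ENNReal.ofReal (2 * Real.pi * z * p.lam * sectorProb p s)) (hm s)]
    rw [← lintegral_finsetSum _ fun s _ => (hm s).const_mul _]
    refine setLIntegral_congr_fun (hR.inter measurableSet_Ici) fun t ht => ?_
    have ht0 : 0 < t := hR0 ht.1
    have hth : h ≤ t := ht.2
    simp only [rivalEffect, if_pos hth, Finset.mul_sum]
    refine Finset.sum_congr rfl fun s _ => ?_
    have hs := sectorProb_nonneg h0 h1 s
    rw [← ENNReal.ofReal_mul hs, ← ENNReal.ofReal_mul hz, ← ENNReal.ofReal_mul (by positivity),
      ← ENNReal.ofReal_mul (by positivity)]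
    congr 1
    ring

lemma ae_eq_of_forall_ne {A B : Set ℝ} (h : ℝ) (hAB : ∀ t, t ≠ h → (t ∈ A ↔ t ∈ B)) :
    A =ᵐ[volume] B := by
  have : ∀ᵐ t : ℝ, t ≠ h := by simp [ae_iff]
  filter_upwards [this] with t ht
  exact propext (hAB t ht)

lemma deltaExponent_congr (p : Params) (k : Link) (s : Sector) (z : ℝ) {I J : Set ℝ}
    (hIJ : I =ᵐ[volume] J) (c d : ℝ) : deltaExponent p k s z I c d = deltaExponent p k s z J c d := by
  rw [deltaExponent, deltaExponent, setLIntegral_congr hIJ]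

lemma Ioc_inter_Ici_ae (D h : ℝ) (hh : 0 ≤ h) :
    (Ioc 0 D ∩ Ici h : Set ℝ) =ᵐ[volume] Ioc (min h D) D :=
  ae_eq_of_forall_ne h fun t ht => by
    simp only [mem_inter_iff, mem_Ioc, mem_Ici, min_lt_iff]
    constructor
    · rintro ⟨⟨h1, h2⟩, h3⟩; exact ⟨Or.inl (lt_of_le_of_ne h3 ht.symm), h2⟩
    · rintro ⟨h1 | h1, h2⟩
      · exact ⟨⟨by linarith, h2⟩, h1.le⟩
      · linarith

lemma Ioi_inter_Ici_ae (D h : ℝ) : (Ioi D ∩ Ici h : Set ℝ) =ᵐ[volume] Ioi (max h D) :=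
  ae_eq_of_forall_ne h fun t ht => by
    simp only [mem_inter_iff, mem_Ioi, mem_Ici, max_lt_iff]
    constructor
    · rintro ⟨h1, h2⟩; exact ⟨lt_of_le_of_ne h2 ht.symm, h1⟩
    · rintro ⟨h1, h2⟩; exact ⟨h2, h1.le⟩

lemma Ioc_inter_Iio_ae (D h : ℝ) : (Ioc 0 D ∩ Iio h : Set ℝ) =ᵐ[volume] Ioc 0 (min h D) :=
  ae_eq_of_forall_ne h fun t ht => by
    simp only [mem_inter_iff, mem_Ioc, mem_Iio, le_min_iff]
    constructor
    · rintro ⟨⟨h1, h2⟩, h3⟩; exact ⟨h1, h3.le, h2⟩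
    · rintro ⟨h1, h2, h3⟩; exact ⟨⟨h1, h3⟩, lt_of_le_of_ne h2 ht⟩

lemma Ioi_inter_Iio_ae (D h : ℝ) : (Ioi D ∩ Iio h : Set ℝ) =ᵐ[volume] Ioc D (max h D) :=
  ae_eq_of_forall_ne h fun t ht => by
    simp only [mem_inter_iff, mem_Ioi, mem_Iio, mem_Ioc, le_max_iff]
    constructor
    · rintro ⟨h1, h2⟩; exact ⟨h1, Or.inl h2.le⟩
    · rintro ⟨h1, h2 | h2⟩
      · exact ⟨h1, lt_of_le_of_ne h2 ht⟩
      · linarith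

lemma lintegral_rivals_los {p : Params} (hlam : 0 ≤ p.lam) (hC₀ : 0 ≤ p.C) (hD : 0 < p.D)
    (h0 : 0 ≤ p.thetab) (h1 : p.thetab ≤ 180) {c d h : ℝ} (hh : 0 ≤ h) :
    ∫⁻ t in Ioi 0, ENNReal.ofReal (2 * Real.pi * p.lam * t) *
        (ENNReal.ofReal (linkProb p t Link.los) * rivalEffect p Link.los c d h t) =
      ENNReal.ofReal (Real.pi * p.lam * p.C * min h p.D ^ 2) +
        ∑ s, deltaExponent p Link.los s p.C (Ioc (min h p.D) p.D) c d := by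
  have hsplit : Ioi (0 : ℝ) = Ioc 0 p.D ∪ Ioi p.D := (Ioc_union_Ioi_eq_Ioi hD.le).symm
  rw [hsplit, lintegral_union measurableSet_Ioi (by
    rw [Set.disjoint_left]; exact fun t ht ht' => not_lt.2 ht.2 ht')]
  have e1 : ∫⁻ t in Ioc 0 p.D, ENNReal.ofReal (2 * Real.pi * p.lam * t) *
        (ENNReal.ofReal (linkProb p t Link.los) * rivalEffect p Link.los c d h t) =
      ∫⁻ t in Ioc 0 p.D, ENNReal.ofReal (2 * Real.pi * p.lam * t) *
        (ENNReal.ofReal p.C * rivalEffect p Link.los c d h t) :=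
    setLIntegral_congr_fun measurableSet_Ioc fun t ht => by
      simp [linkProb, losProb, ht.2]
  have e2 : ∫⁻ t in Ioi p.D, ENNReal.ofReal (2 * Real.pi * p.lam * t) *
        (ENNReal.ofReal (linkProb p t Link.los) * rivalEffect p Link.los c d h t) = 0 := by
    rw [← lintegral_zero (μ := volume.restrict (Ioi p.D))]
    exact setLIntegral_congr_fun measurableSet_Ioi fun t ht => by
      simp [linkProb, losProb, not_le.2 (show p.D < t from ht)]
  rw [e1, e2, add_zero, setLIntegral_rivalEffect hlam h0 h1 _ hC₀ measurableSet_Ioc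
    Ioc_subset_Ioi_self, setLIntegral_congr (Ioc_inter_Iio_ae p.D h),
    lintegral_Ioc_two_mul le_rfl (le_min hh hD.le) (by positivity)]
  congr 1
  · congr 1
    ring
  · exact Finset.sum_congr rfl fun s _ => deltaExponent_congr _ _ _ _ (Ioc_inter_Ici_ae p.D h hh) _ _

/-- The NLOS intensity is thinned by `1 - C` inside radius `D` and full outside. The forbidden disc
of radius `h` may reach beyond `D`; the two pieces of its mass combine through `max² - D² = h² -
min²`. -/
lemma lintegral_rivals_nlos {p : Params} (hlam : 0 ≤ p.lam) (hC₁ : p.C ≤ 1) (hD : 0 < p.D)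
    (h0 : 0 ≤ p.thetab) (h1 : p.thetab ≤ 180) {c d h : ℝ} (hh : 0 ≤ h) :
    ∫⁻ t in Ioi 0, ENNReal.ofReal (2 * Real.pi * p.lam * t) *
        (ENNReal.ofReal (linkProb p t Link.nlos) * rivalEffect p Link.nlos c d h t) =
      ENNReal.ofReal (Real.pi * p.lam * (h ^ 2 - p.C * min h p.D ^ 2)) +
        ∑ s, (deltaExponent p Link.nlos s (1 - p.C) (Ioc (min h p.D) p.D) c d +
          deltaExponent p Link.nlos s 1 (Ioi (max h p.D)) c d) := by
  have hC : 0 ≤ 1 - p.C := sub_nonneg.2 hC₁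
  have hsplit : Ioi (0 : ℝ) = Ioc 0 p.D ∪ Ioi p.D := (Ioc_union_Ioi_eq_Ioi hD.le).symm
  rw [hsplit, lintegral_union measurableSet_Ioi (by
    rw [Set.disjoint_left]; exact fun t ht ht' => not_lt.2 ht.2 ht')]
  have e1 : ∫⁻ t in Ioc 0 p.D, ENNReal.ofReal (2 * Real.pi * p.lam * t) *
        (ENNReal.ofReal (linkProb p t Link.nlos) * rivalEffect p Link.nlos c d h t) =
      ∫⁻ t in Ioc 0 p.D, ENNReal.ofReal (2 * Real.pi * p.lam * t) *
        (ENNReal.ofReal (1 - p.C) * rivalEffect p Link.nlos c d h t) :=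
    setLIntegral_congr_fun measurableSet_Ioc fun t ht => by
      simp [linkProb, losProb, ht.2]
  have e2 : ∫⁻ t in Ioi p.D, ENNReal.ofReal (2 * Real.pi * p.lam * t) *
        (ENNReal.ofReal (linkProb p t Link.nlos) * rivalEffect p Link.nlos c d h t) =
      ∫⁻ t in Ioi p.D, ENNReal.ofReal (2 * Real.pi * p.lam * t) *
        (ENNReal.ofReal 1 * rivalEffect p Link.nlos c d h t) :=
    setLIntegral_congr_fun measurableSet_Ioi fun t ht => by
      simp [linkProb, losProb, not_le.2 (show p.D < t from ht)]
  have hmax : max h p.D ^ 2 - p.D ^ 2 = h ^ 2 - min h p.D ^ 2 := by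
    rcases le_total h p.D with h' | h' <;> simp [h']
  have hmax0 : 0 ≤ max h p.D ^ 2 - p.D ^ 2 := sub_nonneg.2 (by gcongr; exact le_max_right _ _)
  rw [e1, e2, setLIntegral_rivalEffect hlam h0 h1 _ hC measurableSet_Ioc
    Ioc_subset_Ioi_self, setLIntegral_rivalEffect hlam h0 h1 _ zero_le_one measurableSet_Ioi
    (Ioi_subset_Ioi hD.le), setLIntegral_congr (Ioc_inter_Iio_ae p.D h),
    setLIntegral_congr (Ioi_inter_Iio_ae p.D h),
    lintegral_Ioc_two_mul le_rfl (le_min hh hD.le) (by positivity),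
    lintegral_Ioc_two_mul hD.le (le_max_right _ _) (by positivity), add_add_add_comm,
    ← Finset.sum_add_distrib, ← ENNReal.ofReal_add (mul_nonneg (by positivity)
      (by rw [zero_pow two_ne_zero, sub_zero]; positivity)) (mul_nonneg (by positivity) hmax0)]
  congr 1
  · congr 1
    rw [hmax]
    ring
  · exact Finset.sum_congr rfl fun s _ => by
      rw [deltaExponent_congr _ _ _ _ (Ioc_inter_Ici_ae p.D h hh),
        deltaExponent_congr _ _ _ _ (Ioi_inter_Ici_ae p.D h)]

/-- Mean of the exponential functional of all competing base stations. -/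
lemma nexp_lintegral_rivals {p : Params} (hlam : 0 ≤ p.lam) (hC₀ : 0 ≤ p.C) (hC₁ : p.C ≤ 1)
    (hD : 0 < p.D) (hnak : ∀ j, 1 ≤ p.nak j) (h0 : 0 ≤ p.thetab) (h1 : p.thetab ≤ 180)
    (hcoef : ∀ j, 0 < p.coef j) (hexpo : ∀ j, 0 < p.expo j) (hpow : ∀ s, 0 ≤ power p s)
    (j : Link) {c r : ℝ} (hc : 0 ≤ c) (hr : 0 ≤ r) :
    nexp (∫⁻ y, (1 - ∫⁻ m, nexp (rivalExponent p j c (r, y, m)) ∂markLaw p)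
        ∂(ENNReal.ofReal p.lam • (volume : Measure Plane))) =
      ENNReal.ofReal (Real.exp (-(Real.pi * p.lam * p.C *
          min (equalLossDist p j Link.los r) p.D ^ 2)) *
        Real.exp (-(Real.pi * p.lam * (equalLossDist p j Link.nlos r ^ 2 -
          p.C * min (equalLossDist p j Link.nlos r) p.D ^ 2))) *
        ∏ s, (Delta p Link.los s p.C (Ioc (min (equalLossDist p j Link.los r) p.D) p.D)
            c (r ^ p.expo j) *
          Delta p Link.nlos s (1 - p.C) (Ioc (min (equalLossDist p j Link.nlos r) p.D) p.D)
            c (r ^ p.expo j) *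
          Delta p Link.nlos s 1 (Ioi (max (equalLossDist p j Link.nlos r) p.D))
            c (r ^ p.expo j))) := by
  set d := r ^ p.expo j with hd
  set hL := equalLossDist p j Link.los r with hhL
  set hN := equalLossDist p j Link.nlos r with hhN
  have hL0 : 0 ≤ hL := equalLossDist_nonneg hcoef j _ hr
  have hN0 : 0 ≤ hN := equalLossDist_nonneg hcoef j _ hr
  let f : ℝ → ENNReal := fun t => ∑ k, ∑ s, ENNReal.ofReal (linkProb p t k) *
    (ENNReal.ofReal (sectorProb p s) * if p.coef k * t ^ (-p.expo k) * d ≤ p.coef j then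
      ENNReal.ofReal (F p k s c d t) else 1)
  have hf : Measurable f := by
    refine Finset.measurable_fun_sum _ fun k _ => Finset.measurable_fun_sum _ fun s _ => ?_
    refine (measurable_linkProb p k).ennreal_ofReal.mul (measurable_const.mul ?_)
    exact Measurable.ite (measurableSet_le (by fun_prop) measurable_const)
      (measurable_F p k s c d).ennreal_ofReal measurable_const
  rw [lintegral_congr (g := fun y : Plane => f ‖y‖) fun y =>
    one_sub_lintegral_nexp_rivalExponent hC₀ hC₁ hnak h0 h1 hcoef hpow j hc hr y,
    lintegral_radial hlam f hf]
  have hft : ∀ t ∈ Ioi (0 : ℝ), ENNReal.ofReal (2 * Real.pi * p.lam * t) * f t =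
      ENNReal.ofReal (2 * Real.pi * p.lam * t) *
        (ENNReal.ofReal (linkProb p t Link.los) * rivalEffect p Link.los c d hL t) +
      ENNReal.ofReal (2 * Real.pi * p.lam * t) *
        (ENNReal.ofReal (linkProb p t Link.nlos) * rivalEffect p Link.nlos c d hN t) := by
    intro t ht
    simp only [f, rivalEffect, sum_link, ← Finset.mul_sum, mul_add, hd,
      not_stronger_iff hcoef hexpo j _ hr (show 0 < t from ht)]
    rfl
  have hmin : 0 ≤ hN ^ 2 - p.C * min hN p.D ^ 2 := by
    have h2 : min hN p.D ^ 2 ≤ hN ^ 2 :=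
      pow_le_pow_left₀ (le_min hN0 hD.le) (min_le_left _ _) 2
    nlinarith [sq_nonneg (min hN p.D)]
  rw [setLIntegral_congr_fun measurableSet_Ioi hft, lintegral_add_left (by
      exact Measurable.mul (by fun_prop) ((measurable_linkProb p _).ennreal_ofReal.mul
        (measurable_rivalEffect p _ c d hL))),
    lintegral_rivals_los hlam hC₀ hD h0 h1 hL0, lintegral_rivals_nlos hlam hC₁ hD h0 h1 hN0,
    add_add_add_comm, ← Finset.sum_add_distrib, nexp_add, nexp_add, nexp_ofReal (by positivity),
    nexp_ofReal (by positivity), nexp_sum, ENNReal.ofReal_mul (by positivity),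
    ENNReal.ofReal_mul (by positivity), ENNReal.ofReal_prod_of_nonneg
      (fun s _ => by have := Delta_nonneg p; exact mul_nonneg (mul_nonneg (this _ _ _ _ _ _) (this _ _ _ _ _ _)) (this _ _ _ _ _ _))]
  congr 1
  refine Finset.prod_congr rfl fun s _ => ?_
  rw [nexp_add, nexp_add, nexp_deltaExponent, nexp_deltaExponent, nexp_deltaExponent,
    ← ENNReal.ofReal_mul (Delta_nonneg _ _ _ _ _ _ _), ← ENNReal.ofReal_mul (Delta_nonneg _ _ _ _ _ _ _),
    mul_assoc]

end Total

/-! ### Bounding the connection probability -/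

section Bound

open Filter Topology Set

lemma alzer_pos (p : Params) (j : Link) : 0 < alzer p j :=
  Real.rpow_pos_of_pos (by exact_mod_cast Nat.factorial_pos _) _

lemma alzer_pow {p : Params} (hnak : ∀ j, 1 ≤ p.nak j) (j : Link) :
    alzer p j ^ p.nak j * (p.nak j).factorial = 1 := by
  have h0 : (0 : ℝ) < (p.nak j).factorial := by exact_mod_cast Nat.factorial_pos _
  have hn : (p.nak j : ℝ) ≠ 0 := by have := hnak j; positivity
  rw [alzer, ← Real.rpow_natCast, ← Real.rpow_mul h0.le, neg_mul, one_div_mul_cancel hn,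
    Real.rpow_neg_one, inv_mul_cancel₀ h0.ne']

/-- Extends Alzer's bound to thresholds in `[0, ∞]`. A diverging interference gives `T = ∞`, where
both sides vanish; for `T = 0` the bound is `1`, which needs positive shape. -/
lemma gammaMeasure_tail_le {p : Params} (hnak : ∀ j, 1 ≤ p.nak j) (j : Link) (T : ENNReal) :
    gammaMeasure (p.nak j) 1 {h | T ≤ ENNReal.ofReal h} ≤
      1 - (1 - nexp (ENNReal.ofReal (alzer p j) * T)) ^ p.nak j := by
  have hprob := isProbabilityMeasure_fading hnak j
  obtain ⟨m, hm⟩ : ∃ m, p.nak j = m + 1 := ⟨p.nak j - 1, by have := hnak j; omega⟩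
  rcases eq_or_ne T ⊤ with rfl | hT
  · have : {h | (⊤ : ENNReal) ≤ ENNReal.ofReal h} = ∅ := by ext; simp
    rw [this]
    simp
  rcases eq_or_ne T 0 with rfl | hT0
  · refine prob_le_one.trans_eq ?_
    simp [hm]
  have hx : 0 < T.toReal := ENNReal.toReal_pos hT0 hT
  have hset : {h | T ≤ ENNReal.ofReal h} = Ici T.toReal := by
    ext h
    rw [mem_ofPred_eq, mem_Ici, ← ENNReal.ofReal_toReal hT, ENNReal.ofReal_le_ofReal_iff',
      ENNReal.toReal_ofReal hx.le]
    simp [not_le.2 hx]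
  have h := gammaMeasure_Ici_le (m := m) (alzer_pos p j) (by rw [← hm]; exact alzer_pow hnak j)
    hx.le
  rw [hset]
  rw [ENNReal.ofReal_mul (alzer_pos p j).le, ENNReal.ofReal_toReal hT] at h
  rw [hm]
  exact_mod_cast h

/-- The binomial theorem with the negative terms, those of even `n`, moved to the left, so that it
makes sense in `[0, ∞]`. -/
lemma one_sub_one_sub_pow_add_sum (N : ℕ) {u : ENNReal} (hu : u ≤ 1) :
    (1 - (1 - u) ^ N) + ∑ n ∈ Finset.Icc 1 N with Even n, (N.choose n : ENNReal) * u ^ n =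
      ∑ n ∈ Finset.Icc 1 N with ¬ Even n, (N.choose n : ENNReal) * u ^ n := by
  obtain ⟨x, hx0, rfl⟩ : ∃ x : ℝ, 0 ≤ x ∧ u = ENNReal.ofReal x :=
    ⟨u.toReal, ENNReal.toReal_nonneg,
      (ENNReal.ofReal_toReal (hu.trans_lt ENNReal.one_lt_top).ne).symm⟩
  have hx1 : x ≤ 1 := by simpa using hu
  have hterm : ∀ n, (N.choose n : ENNReal) * ENNReal.ofReal x ^ n =
      ENNReal.ofReal (N.choose n * x ^ n) := fun n => by
    rw [ENNReal.ofReal_mul (by positivity), ENNReal.ofReal_natCast, ENNReal.ofReal_pow hx0]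
  have hpow : (1 - x) ^ N ≤ 1 := pow_le_one₀ (by linarith) (by linarith)
  simp_rw [hterm]
  rw [← ENNReal.ofReal_one, ← ENNReal.ofReal_sub _ hx0, ← ENNReal.ofReal_pow (by linarith),
    ← ENNReal.ofReal_sub _ (by have : 0 ≤ 1 - x := by linarith
                               positivity),
    ← ENNReal.ofReal_sum_of_nonneg (fun _ _ => by positivity),
    ← ENNReal.ofReal_sum_of_nonneg (fun _ _ => by positivity),
    ← ENNReal.ofReal_add (by linarith) (Finset.sum_nonneg fun _ _ => by positivity)]
  congr 1
  have h1 : (1 - x) ^ N = 1 + ∑ n ∈ Finset.Icc 1 N, (-1 : ℝ) ^ n * (N.choose n * x ^ n) := by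
    rw [sub_eq_add_neg, add_comm, add_pow, Finset.range_eq_Ico, Finset.sum_eq_sum_Ico_succ_bot
      (Nat.succ_pos N)]
    simp only [pow_zero, one_pow, Nat.choose_zero_right]
    norm_num
    refine Finset.sum_congr rfl fun n _ => ?_
    rw [neg_pow]
    ring
  rw [← Finset.sum_filter_add_sum_filter_not (Finset.Icc 1 N) Even] at h1
  have h2 : ∑ n ∈ Finset.Icc 1 N with Even n, (-1 : ℝ) ^ n * (N.choose n * x ^ n) =
      ∑ n ∈ Finset.Icc 1 N with Even n, (N.choose n * x ^ n : ℝ) :=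
    Finset.sum_congr rfl fun n hn => by
      rw [(Finset.mem_filter.1 hn).2.neg_one_pow, one_mul]
  have h3 : ∑ n ∈ Finset.Icc 1 N with ¬ Even n, (-1 : ℝ) ^ n * (N.choose n * x ^ n) =
      -∑ n ∈ Finset.Icc 1 N with ¬ Even n, (N.choose n * x ^ n : ℝ) := by
    rw [← Finset.sum_neg_distrib]
    exact Finset.sum_congr rfl fun n hn => by
      rw [(Nat.not_even_iff_odd.1 (Finset.mem_filter.1 hn).2).neg_one_pow, neg_one_mul]
  rw [h1, h2, h3]
  ring

variable {p : Params}

/-- Infinite when a base station at `z.2.1` is stronger than one of type `j` at distance `z.1`. -/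
def barrier (p : Params) (j : Link) (z : ℝ × Plane × Mark) : ENNReal :=
  if markLoss p ‖z.2.1‖ z.2.2 * max z.1 0 ^ p.expo j ≤ p.coef j then 0 else ⊤

/-- Power received from an interfering base station. -/
def received (p : Params) (y : Plane) (m : Mark) : ENNReal :=
  ENNReal.ofReal (power p (markSector p m) * gain m (markLink p ‖y‖ m) * markLoss p ‖y‖ m)

lemma rivalExponent_eq (p : Params) (j : Link) (c : ℝ) (z : ℝ × Plane × Mark) :
    rivalExponent p j c z = barrier p j z +
      ENNReal.ofReal (c * max z.1 0 ^ p.expo j) * received p z.2.1 z.2.2 := rfl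

lemma measurable_barrier (p : Params) (j : Link) : Measurable (barrier p j) := by
  have h1 : Measurable fun z : ℝ × Plane × Mark => markLoss p ‖z.2.1‖ z.2.2 :=
    (measurable_markLoss p).comp (f := fun z : ℝ × Plane × Mark => (‖z.2.1‖, z.2.2)) (by fun_prop)
  exact Measurable.ite (measurableSet_le (h1.mul (by fun_prop)) measurable_const)
    measurable_const measurable_const

lemma measurable_received (p : Params) :
    Measurable fun z : Plane × Mark => received p z.1 z.2 :=
  ((measurable_markPower p).comp (f := fun z : Plane × Mark => (‖z.1‖, z.2))
    (by fun_prop)).ennreal_ofReal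

/-- Gain that a serving link of type `j` and length `r` needs per unit of interference. -/
def gainFactor (p : Params) (Tc : ℝ) (j : Link) (r : ℝ) : ℝ :=
  Tc * r ^ p.expo j / (p.phi * p.Pt * p.Ms * p.coef j)

/-- Total barrier of the competitors of the base station `i`. -/
def totalBarrier (p : Params) (j : Link) (i : ℕ) (x : ℕ → Plane) (m : {k : ℕ // k ≠ i} → Mark) :
    ENNReal :=
  ∑' k : {k : ℕ // k ≠ i}, barrier p j (‖x i‖, x k, m k)

/-- Interference plus noise for the serving base station `i`. -/
def interferenceNoise (p : Params) (i : ℕ) (x : ℕ → Plane) (m : {k : ℕ // k ≠ i} → Mark) :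
    ENNReal :=
  ∑' k : {k : ℕ // k ≠ i}, received p (x k) (m k) + ENNReal.ofReal p.N0

lemma measurable_totalBarrier (p : Params) (j : Link) (i : ℕ) :
    Measurable fun z : (ℕ → Plane) × ({k : ℕ // k ≠ i} → Mark) =>
      totalBarrier p j i z.1 z.2 := by
  refine Measurable.tsum fun k => (measurable_barrier p j).comp ?_
  fun_prop

lemma measurable_interferenceNoise (p : Params) (i : ℕ) :
    Measurable fun z : (ℕ → Plane) × ({k : ℕ // k ≠ i} → Mark) =>
      interferenceNoise p i z.1 z.2 := by
  refine Measurable.add (Measurable.tsum fun k => (measurable_received p).comp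
    (f := fun z : (ℕ → Plane) × ({k : ℕ // k ≠ i} → Mark) => (z.1 k, z.2 k)) ?_) measurable_const
  fun_prop

/-- Indicator of a connection through the base station `i` with a link of type `j`. -/
def connIndicator (p : Params) (Tc : ℝ) (j : Link) (i : ℕ) (x : ℕ → Plane) (m₀ : Mark)
    (m : {k : ℕ // k ≠ i} → Mark) : ENNReal :=
  (if markLink p ‖x i‖ m₀ = j then
    if ENNReal.ofReal (gainFactor p Tc j ‖x i‖) * interferenceNoise p i x m ≤
      ENNReal.ofReal (gain m₀ (markLink p ‖x i‖ m₀)) then 1 else 0 else 0) *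
    nexp (totalBarrier p j i x m)

lemma measurable_connIndicator (p : Params) (Tc : ℝ) (j : Link) (i : ℕ) :
    Measurable fun z : (ℕ → Plane) × Mark × ({k : ℕ // k ≠ i} → Mark) =>
      connIndicator p Tc j i z.1 z.2.1 z.2.2 := by
  have h1 : Measurable fun z : (ℕ → Plane) × Mark × ({k : ℕ // k ≠ i} → Mark) =>
      markLink p ‖z.1 i‖ z.2.1 :=
    (measurable_markLink p).comp (f := fun z : (ℕ → Plane) × Mark × ({k : ℕ // k ≠ i} → Mark) =>
      (‖z.1 i‖, z.2.1)) (by fun_prop)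
  have hpr : Measurable fun z : (ℕ → Plane) × Mark × ({k : ℕ // k ≠ i} → Mark) =>
      (z.1, z.2.2) := by fun_prop
  have hA : MeasurableSet {z : (ℕ → Plane) × Mark × ({k : ℕ // k ≠ i} → Mark) |
      markLink p ‖z.1 i‖ z.2.1 = j} := h1 (measurableSet_singleton j)
  have hg : Measurable fun z : (ℕ → Plane) × Mark × ({k : ℕ // k ≠ i} → Mark) =>
      ENNReal.ofReal (gainFactor p Tc j ‖z.1 i‖) := by
    unfold gainFactor
    fun_prop
  have hI := (measurable_interferenceNoise p i).comp hpr
  have hh : Measurable fun z : (ℕ → Plane) × Mark × ({k : ℕ // k ≠ i} → Mark) =>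
      gain z.2.1 (markLink p ‖z.1 i‖ z.2.1) :=
    measurable_link_apply (f := fun k (z : (ℕ → Plane) × Mark × ({k : ℕ // k ≠ i} → Mark)) =>
      gain z.2.1 k) (fun k => (measurable_gain k).comp (by fun_prop)) h1
  have hB : MeasurableSet {z : (ℕ → Plane) × Mark × ({k : ℕ // k ≠ i} → Mark) |
      ENNReal.ofReal (gainFactor p Tc j ‖z.1 i‖) * interferenceNoise p i z.1 z.2.2 ≤
      ENNReal.ofReal (gain z.2.1 (markLink p ‖z.1 i‖ z.2.1))} :=
    measurableSet_le (hg.mul hI) hh.ennreal_ofReal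
  have hV := measurable_nexp.comp ((measurable_totalBarrier p j i).comp hpr)
  exact (Measurable.ite hA (Measurable.ite hB measurable_const measurable_const)
    measurable_const).mul hV

lemma gainFactor_nonneg (hcoef : ∀ j, 0 < p.coef j) (hPt : 0 < p.Pt) (hMs : 0 < p.Ms)
    (hphi₀ : 0 < p.phi) {Tc : ℝ} (hTc : 0 < Tc) (j : Link) {r : ℝ} (hr : 0 ≤ r) :
    0 ≤ gainFactor p Tc j r := by
  have := hcoef j
  have := Real.rpow_nonneg hr (p.expo j)
  unfold gainFactor
  positivity

lemma fading_eq_gain (p : Params) {Ω : Type*} (S : Network Ω) (i : ℕ) (ω : Ω) :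
    fading p S i ω = gain (S.mark i ω) (link p S i ω) := by
  rw [fading]
  cases link p S i ω <;> rfl

/-- On the connection event, one of the indicators equals `1`. -/
lemma connIndicator_eq_one {Ω : Type*} {S : Network Ω} (hcoef : ∀ j, 0 < p.coef j)
    (hPt : 0 < p.Pt) (hMs : 0 < p.Ms) (hphi₀ : 0 < p.phi) (hN0 : 0 < p.N0) {Tc : ℝ}
    {i : ℕ} {ω : Ω} (hserve : Serves p S i ω) (hsinr : ENNReal.ofReal Tc ≤ sinr p S i ω) :
    connIndicator p Tc (link p S i ω) i (fun k => S.loc k ω) (S.mark i ω)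
      (fun k => S.mark k ω) = 1 := by
  set r := ‖S.loc i ω‖ with hr
  have hr0 : 0 ≤ r := norm_nonneg _
  set j := link p S i ω with hj
  have hcj := hcoef j
  -- The value `0` covers a station located exactly at the origin, where the inverse of `0` is `0`;
  -- the inequalities below hold in that case too, so it need not be excluded as a null event.
  have hrr : r ^ (-p.expo j) * r ^ p.expo j ≤ 1 ∧
      (r ^ (-p.expo j) * r ^ p.expo j = 1 ∨ r ^ (-p.expo j) * r ^ p.expo j = 0) := by
    rw [Real.rpow_neg hr0]
    rcases eq_or_ne (r ^ p.expo j) 0 with h | h <;> simp [h]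
  have hlink : markLink p r (S.mark i ω) = j := rfl
  have hbar : totalBarrier p j i (fun k => S.loc k ω) (fun k => S.mark k ω) = 0 := by
    rw [totalBarrier, ENNReal.tsum_eq_zero]
    intro k
    refine if_pos ?_
    have h := hserve k
    rw [max_eq_left (norm_nonneg _)]
    calc pathLoss p S k ω * r ^ p.expo j ≤ pathLoss p S i ω * r ^ p.expo j := by
          have := Real.rpow_nonneg hr0 (p.expo j)
          gcongr
      _ = p.coef j * (r ^ (-p.expo j) * r ^ p.expo j) := by
          simp only [pathLoss, ← hj, ← hr]
          ring
      _ ≤ p.coef j := mul_le_of_le_one_right hcj.le hrr.1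
  have hIN : interferenceNoise p i (fun k => S.loc k ω) (fun k => S.mark k ω) =
      interference p S i ω + ENNReal.ofReal p.N0 := by
    simp only [interference, fading_eq_gain]
    rfl
  have hle : ENNReal.ofReal (gainFactor p Tc j r) *
      (interference p S i ω + ENNReal.ofReal p.N0) ≤ ENNReal.ofReal (gain (S.mark i ω) j) := by
    have hfad : fading p S i ω = gain (S.mark i ω) j := fading_eq_gain p S i ω
    rw [sinr, ENNReal.le_div_iff_mul_le (Or.inl ?_) (Or.inr ENNReal.ofReal_ne_top)] at hsinr
    · set q := r ^ p.expo j / (p.phi * p.Pt * p.Ms * p.coef j) with hq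
      have hq0 : 0 ≤ q := by
        have := Real.rpow_nonneg hr0 (p.expo j)
        positivity
      have hg : gainFactor p Tc j r = q * Tc := by
        rw [gainFactor, hq]
        ring
      rw [hg, ENNReal.ofReal_mul hq0, mul_assoc]
      refine (mul_le_mul_right hsinr _).trans ?_
      rw [← ENNReal.ofReal_mul hq0]
      have e : q * (p.phi * p.Pt * p.Ms * fading p S i ω * pathLoss p S i ω) =
          gain (S.mark i ω) j * (r ^ (-p.expo j) * r ^ p.expo j) := by
        rw [hq, hfad]
        simp only [pathLoss, ← hj, ← hr]
        field_simp
      rw [e]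
      rcases hrr.2 with h | h <;> rw [h] <;> simp
    · have : ENNReal.ofReal p.N0 ≠ 0 := by simpa using hN0
      simp [this]
  rw [connIndicator, hbar, nexp_zero, mul_one, if_pos hlink, if_pos]
  rw [hIN, hlink]
  exact hle

end Bound

/-! ### Conditioning on the competitors and binomial expansion -/

section Bound

open Filter Topology Set

variable {Ω : Type*} [MeasurableSpace Ω] {P : Measure Ω} {p : Params} {S : Network Ω}

/-- Bound for the conditional probability of a connection through the base station `i` with a link
of type `j`. -/
def condBound (p : Params) (Tc : ℝ) (j : Link) (i : ℕ) (x : ℕ → Plane)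
    (m : {k : ℕ // k ≠ i} → Mark) : ENNReal :=
  ENNReal.ofReal (linkProb p ‖x i‖ j) * (nexp (totalBarrier p j i x m) *
    (1 - (1 - nexp (ENNReal.ofReal (alzer p j) * (ENNReal.ofReal (gainFactor p Tc j ‖x i‖) *
      interferenceNoise p i x m))) ^ p.nak j))

lemma measurable_condBound (p : Params) (Tc : ℝ) (j : Link) (i : ℕ) :
    Measurable fun z : (ℕ → Plane) × ({k : ℕ // k ≠ i} → Mark) => condBound p Tc j i z.1 z.2 := by
  have h1 := measurable_nexp.comp (measurable_totalBarrier p j i)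
  have h2 := measurable_interferenceNoise p i
  have h3 : Measurable fun z : (ℕ → Plane) × ({k : ℕ // k ≠ i} → Mark) =>
      ENNReal.ofReal (linkProb p ‖z.1 i‖ j) :=
    ((measurable_linkProb p j).comp (by fun_prop)).ennreal_ofReal
  have h4 : Measurable fun z : (ℕ → Plane) × ({k : ℕ // k ≠ i} → Mark) =>
      ENNReal.ofReal (gainFactor p Tc j ‖z.1 i‖) := by
    unfold gainFactor
    fun_prop
  exact h3.mul (h1.mul (measurable_const.sub
    ((measurable_const.sub (measurable_nexp.comp (measurable_const.mul (h4.mul h2)))).pow_const _)))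

/-- Only the mark of the server is averaged: its link type gives `linkProb`, its sector sums out,
and its gain is bounded by Alzer's inequality. The interference is a constant here. -/
lemma lintegral_connIndicator_le (hC₀ : 0 ≤ p.C) (hC₁ : p.C ≤ 1) (hnak : ∀ j, 1 ≤ p.nak j)
    (h0 : 0 ≤ p.thetab) (h1 : p.thetab ≤ 180) (Tc : ℝ) (j : Link) (i : ℕ) (x : ℕ → Plane)
    (m : {k : ℕ // k ≠ i} → Mark) :
    ∫⁻ m₀, connIndicator p Tc j i x m₀ m ∂markLaw p ≤ condBound p Tc j i x m := by
  set T := ENNReal.ofReal (gainFactor p Tc j ‖x i‖) * interferenceNoise p i x m with hT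
  let A : Set ℝ := {h | T ≤ ENNReal.ofReal h}
  have hA : MeasurableSet A := measurableSet_le measurable_const ENNReal.measurable_ofReal
  let G : Link → Sector → ℝ → ENNReal := fun k _ h =>
    if k = j then A.indicator 1 h * nexp (totalBarrier p j i x m) else 0
  have hG : ∀ k s, Measurable (G k s) := fun k s => by
    by_cases hk : k = j
    · simp only [G, if_pos hk]
      exact (measurable_one.indicator hA).mul_const _
    · simp only [G, if_neg hk]
      exact measurable_const
  have hpt : ∀ m₀, connIndicator p Tc j i x m₀ m =
      G (markLink p ‖x i‖ m₀) (markSector p m₀) (gain m₀ (markLink p ‖x i‖ m₀)) := by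
    intro m₀
    simp only [connIndicator, G, ← hT]
    by_cases hk : markLink p ‖x i‖ m₀ = j
    · simp [hk, A, indicator]
    · simp [hk]
  rw [lintegral_congr hpt, lintegral_markLaw hC₀ hC₁ hnak h0 h1 _ hG]
  have hGj : ∀ s, ∫⁻ h, G j s h ∂gammaMeasure (p.nak j) 1 =
      gammaMeasure (p.nak j) 1 A * nexp (totalBarrier p j i x m) := fun s => by
    simp only [G, if_pos]
    rw [lintegral_mul_const _ (measurable_one.indicator hA), lintegral_indicator_one hA]
  have hsum : ∑ k, ∑ s, ENNReal.ofReal (linkProb p ‖x i‖ k) * (ENNReal.ofReal (sectorProb p s) *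
      ∫⁻ h, G k s h ∂gammaMeasure (p.nak k) 1) = ENNReal.ofReal (linkProb p ‖x i‖ j) *
      (gammaMeasure (p.nak j) 1 A * nexp (totalBarrier p j i x m)) := by
    rw [Finset.sum_eq_single j]
    · simp_rw [hGj]
      rw [← Finset.mul_sum, ← Finset.sum_mul, sum_sectorProb h0 h1, one_mul]
    · intro k _ hk
      simp [G, hk]
    · simp
  rw [hsum, condBound, mul_comm (nexp _)]
  gcongr
  exact gammaMeasure_tail_le hnak j T

lemma measurable_splitMark (i : ℕ) : Measurable fun z : (ℕ → Plane) × (ℕ → Mark) =>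
    (z.1, z.2 i, fun k : {k : ℕ // k ≠ i} => z.2 k) :=
  measurable_fst.prodMk (((measurable_pi_apply i).comp measurable_snd).prodMk
    (measurable_pi_lambda _ fun k => (measurable_pi_apply (k : ℕ)).comp measurable_snd))

lemma measurable_dropMark (i : ℕ) : Measurable fun z : (ℕ → Plane) × (ℕ → Mark) =>
    (z.1, fun k : {k : ℕ // k ≠ i} => z.2 k) :=
  measurable_fst.prodMk
    (measurable_pi_lambda _ fun k => (measurable_pi_apply (k : ℕ)).comp measurable_snd)

lemma lintegral_connIndicator_le_lintegral [IsProbabilityMeasure P] (hS : IsModel p P S)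
    (hC₀ : 0 ≤ p.C) (hC₁ : p.C ≤ 1) (hnak : ∀ j, 1 ≤ p.nak j) (h0 : 0 ≤ p.thetab)
    (h1 : p.thetab ≤ 180) (Tc : ℝ) (j : Link) (i : ℕ) :
    ∫⁻ ω, connIndicator p Tc j i (fun k => S.loc k ω) (S.mark i ω) (fun k => S.mark k ω) ∂P ≤
      ∫⁻ ω, condBound p Tc j i (fun k => S.loc k ω) (fun k => S.mark k ω) ∂P := by
  have hloc := hS.poisson.measurable
  have hmark := hS.measurable_mark
  have hlaw : ∀ i, HasLaw (S.mark i) (markLaw p) P := hS.hasLaw_mark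
  have hΦ := (measurable_connIndicator p Tc j i).comp (measurable_splitMark i)
  have hΦ' := (measurable_condBound p Tc j i).comp (measurable_dropMark i)
  have e1 := lintegral_indep_eq_lintegral_lintegral hloc hmark hS.indep_loc_mark hΦ
  have e2 := lintegral_indep_eq_lintegral_lintegral hloc hmark hS.indep_loc_mark hΦ'
  refine (e1.trans_le (lintegral_mono fun ω => ?_)).trans_eq e2.symm
  have h := lintegral_mark_eq_lintegral_lintegral hmark hlaw hS.iIndep_mark i
    ((measurable_connIndicator p Tc j i).comp
      (measurable_prodMk_left (x := fun k => S.loc k ω)))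
  refine h.trans_le (lintegral_mono fun ω' => ?_)
  exact lintegral_connIndicator_le hC₀ hC₁ hnak h0 h1 Tc j i _ _

lemma measure_connIndicator_le {X : ℕ → Ω → Plane} {Y : ℕ → Ω → Mark}
    (hX : ∀ i, Measurable (X i)) (hY : ∀ i, Measurable (Y i)) (i : ℕ)
    {Φ : (ℕ → Plane) → Mark → ({k : ℕ // k ≠ i} → Mark) → ENNReal}
    (hΦ : Measurable fun z : (ℕ → Plane) × Mark × ({k : ℕ // k ≠ i} → Mark) =>
      Φ z.1 z.2.1 z.2.2) :
    P {ω | 1 ≤ Φ (fun k => X k ω) (Y i ω) (fun k => Y k ω)} ≤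
      ∫⁻ ω, Φ (fun k => X k ω) (Y i ω) (fun k => Y k ω) ∂P := by
  have hsplit : Measurable fun ω => ((fun k => X k ω : ℕ → Plane), Y i ω,
      (fun k => Y k ω : {k : ℕ // k ≠ i} → Mark)) :=
    (measurable_pi_lambda _ hX).prodMk
      ((hY i).prodMk (measurable_pi_lambda _ fun k => hY k))
  have hmarkov := mul_meas_ge_le_lintegral₀ (μ := P) (hΦ.comp hsplit).aemeasurable 1
  rwa [one_mul] at hmarkov

/-- A union bound over servers and link types, so uniqueness of the strongest station is not
required. -/
lemma measure_conn_le_tsum [IsProbabilityMeasure P] (hS : IsModel p P S) (hC₀ : 0 ≤ p.C)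
    (hC₁ : p.C ≤ 1) (hnak : ∀ j, 1 ≤ p.nak j) (h0 : 0 ≤ p.thetab) (h1 : p.thetab ≤ 180)
    (hcoef : ∀ j, 0 < p.coef j) (hPt : 0 < p.Pt) (hMs : 0 < p.Ms) (hphi₀ : 0 < p.phi)
    (hN0 : 0 < p.N0) (Tc : ℝ) :
    P {ω | ∃ i, Serves p S i ω ∧ ENNReal.ofReal Tc ≤ sinr p S i ω} ≤
      ∑ j, ∑' i, ∫⁻ ω, condBound p Tc j i (fun k => S.loc k ω) (fun k => S.mark k ω) ∂P := by
  have hsub : {ω | ∃ i, Serves p S i ω ∧ ENNReal.ofReal Tc ≤ sinr p S i ω} ⊆ ⋃ j : Link, ⋃ i : ℕ,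
      {ω | 1 ≤ connIndicator p Tc j i (fun k => S.loc k ω) (S.mark i ω)
        (fun k => S.mark k ω)} := by
    rintro ω ⟨i, hserve, hsinr⟩
    exact mem_iUnion₂.2 ⟨link p S i ω, i,
      (connIndicator_eq_one hcoef hPt hMs hphi₀ hN0 hserve hsinr).ge⟩
  refine (measure_mono hsub).trans ((measure_iUnion_le _).trans ?_)
  rw [tsum_fintype]
  refine Finset.sum_le_sum fun j _ => (measure_iUnion_le _).trans (ENNReal.tsum_le_tsum fun i => ?_)
  exact (measure_connIndicator_le hS.poisson.measurable hS.measurable_mark i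
    (measurable_connIndicator p Tc j i)).trans
      (lintegral_connIndicator_le_lintegral hS hC₀ hC₁ hnak h0 h1 Tc j i)

/-- One term of the binomial expansion of `condBound`. -/
def rivalTerm (p : Params) (j : Link) (c : ℝ) (i : ℕ) (x : ℕ → Plane)
    (m : {k : ℕ // k ≠ i} → Mark) : ENNReal :=
  ENNReal.ofReal (linkProb p ‖x i‖ j) *
      nexp (ENNReal.ofReal (c * ‖x i‖ ^ p.expo j * p.N0)) *
    nexp (∑' k : {k : ℕ // k ≠ i}, rivalExponent p j c (‖x i‖, x k, m k))

lemma condBound_add_sum_rivalTerm (hcoef : ∀ j, 0 < p.coef j) (hPt : 0 < p.Pt) (hMs : 0 < p.Ms)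
    (hphi₀ : 0 < p.phi) {Tc : ℝ} (hTc : 0 < Tc) (j : Link) (i : ℕ)
    (x : ℕ → Plane) (m : {k : ℕ // k ≠ i} → Mark) :
    condBound p Tc j i x m + ∑ n ∈ Finset.Icc 1 (p.nak j) with Even n,
        ((p.nak j).choose n : ENNReal) * rivalTerm p j (Theta p Tc j n) i x m =
      ∑ n ∈ Finset.Icc 1 (p.nak j) with ¬ Even n,
        ((p.nak j).choose n : ENNReal) * rivalTerm p j (Theta p Tc j n) i x m := by
  set r := ‖x i‖ with hr
  have hr0 : 0 ≤ r := norm_nonneg _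
  have hg := gainFactor_nonneg hcoef hPt hMs hphi₀ hTc j hr0
  have ha := (alzer_pos p j).le
  set u := nexp (ENNReal.ofReal (alzer p j) * (ENNReal.ofReal (gainFactor p Tc j r) *
      interferenceNoise p i x m)) with hu
  have hterm : ∀ n : ℕ, rivalTerm p j (Theta p Tc j n) i x m =
      ENNReal.ofReal (linkProb p r j) * (nexp (totalBarrier p j i x m) * u ^ n) := by
    intro n
    -- This is what `Theta` is made for: the `n`-th power of the exponential in Alzer's bound is the
    -- exponential with constant `Theta p Tc j n`.
    have hΘ : Theta p Tc j n * r ^ p.expo j = n * (alzer p j * gainFactor p Tc j r) := by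
      rw [Theta, gainFactor]
      ring
    have hΘ0 : 0 ≤ Theta p Tc j n * r ^ p.expo j := by rw [hΘ]; positivity
    rw [rivalTerm, mul_assoc, ← hr, hu, ← nexp_natCast_mul, ← nexp_add, ← nexp_add]
    simp_rw [rivalExponent_eq, max_eq_left hr0]
    rw [ENNReal.tsum_add, ENNReal.tsum_mul_left, ENNReal.ofReal_mul hΘ0, hΘ,
      ENNReal.ofReal_mul (by positivity), ENNReal.ofReal_natCast, ENNReal.ofReal_mul ha,
      totalBarrier, interferenceNoise]
    congr 2
    ring
  simp_rw [hterm]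
  have hbin := one_sub_one_sub_pow_add_sum (p.nak j) (nexp_le_one _ : u ≤ 1)
  have hfac : ∀ n : ℕ, ((p.nak j).choose n : ENNReal) *
      (ENNReal.ofReal (linkProb p r j) * (nexp (totalBarrier p j i x m) * u ^ n)) =
      ENNReal.ofReal (linkProb p r j) * nexp (totalBarrier p j i x m) *
        (((p.nak j).choose n : ENNReal) * u ^ n) := fun n => by ring
  simp_rw [hfac, ← Finset.mul_sum]
  rw [← hbin, condBound, mul_add, mul_assoc, mul_assoc]

end Bound

section Connection

open Filter Topology Set

variable {Ω : Type*} [MeasurableSpace Ω] {P : Measure Ω} {p : Params} {S : Network Ω}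

/-! ### The alternating sum -/

lemma tsum_lintegral_add_sum {b : ℕ → ENNReal} {A : ℕ → Ω → ENNReal} {T : ℕ → ℕ → Ω → ENNReal}
    (hA : ∀ i, Measurable (A i)) (hT : ∀ n i, Measurable (T n i)) {s t : Finset ℕ}
    (h : ∀ i ω, A i ω + ∑ n ∈ s, b n * T n i ω = ∑ n ∈ t, b n * T n i ω) :
    ∑' i, ∫⁻ ω, A i ω ∂P + ∑ n ∈ s, b n * ∑' i, ∫⁻ ω, T n i ω ∂P =
      ∑ n ∈ t, b n * ∑' i, ∫⁻ ω, T n i ω ∂P := by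
  have hsum : ∀ u : Finset ℕ, ∑ n ∈ u, b n * ∑' i, ∫⁻ ω, T n i ω ∂P =
      ∑' i, ∫⁻ ω, ∑ n ∈ u, b n * T n i ω ∂P := by
    intro u
    simp_rw [lintegral_finsetSum u fun n _ => (hT n _).const_mul (b n),
      lintegral_const_mul _ (hT _ _)]
    rw [Summable.tsum_finsetSum fun _ _ => ENNReal.summable]
    simp_rw [ENNReal.tsum_mul_left]
  rw [hsum, hsum, ← ENNReal.tsum_add]
  refine tsum_congr fun i => ?_
  rw [← lintegral_add_left (hA i)]
  simp_rw [h]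

/-- Once all terms are finite, the even ones can be subtracted and the identity becomes a signed
real sum. -/
lemma toReal_eq_alternating_sum {N : ℕ} {B : ENNReal} {M : ℕ → ENNReal} (hM : ∀ n, M n ≠ ⊤)
    (h : B + ∑ n ∈ Finset.Icc 1 N with Even n, (N.choose n : ENNReal) * M n =
      ∑ n ∈ Finset.Icc 1 N with ¬ Even n, (N.choose n : ENNReal) * M n) :
    B ≠ ⊤ ∧ B.toReal = ∑ n ∈ Finset.Icc 1 N, (-1 : ℝ) ^ (n + 1) * (N.choose n : ℝ) *
      (M n).toReal := by
  have hfin : ∀ n, (N.choose n : ENNReal) * M n ≠ ⊤ := fun n =>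
    ENNReal.mul_ne_top (ENNReal.natCast_ne_top _) (hM n)
  have hs : ∀ u : Finset ℕ, ∑ n ∈ u, (N.choose n : ENNReal) * M n ≠ ⊤ := fun u =>
    ENNReal.sum_ne_top.2 fun n _ => hfin n
  have hB : B ≠ ⊤ := ne_top_of_le_ne_top (hs _) (le_self_add.trans h.le)
  refine ⟨hB, ?_⟩
  have h' := congrArg ENNReal.toReal h
  rw [ENNReal.toReal_add hB (hs _), ENNReal.toReal_sum fun n _ => hfin n,
    ENNReal.toReal_sum fun n _ => hfin n] at h'
  simp_rw [ENNReal.toReal_mul, ENNReal.toReal_natCast] at h'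
  rw [← Finset.sum_filter_add_sum_filter_not (Finset.Icc 1 N) (fun n => Even n)]
  have he : ∑ n ∈ Finset.Icc 1 N with Even n, (-1 : ℝ) ^ (n + 1) * (N.choose n : ℝ) *
      (M n).toReal = -∑ n ∈ Finset.Icc 1 N with Even n, (N.choose n : ℝ) * (M n).toReal := by
    rw [← Finset.sum_neg_distrib]
    refine Finset.sum_congr rfl fun n hn => ?_
    rw [(Even.add_one (Finset.mem_filter.1 hn).2).neg_one_pow]
    ring
  have ho : ∑ n ∈ Finset.Icc 1 N with ¬ Even n, (-1 : ℝ) ^ (n + 1) * (N.choose n : ℝ) *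
      (M n).toReal = ∑ n ∈ Finset.Icc 1 N with ¬ Even n, (N.choose n : ℝ) * (M n).toReal := by
    refine Finset.sum_congr rfl fun n hn => ?_
    rw [(Nat.not_even_iff_odd.1 (Finset.mem_filter.1 hn).2).add_one.neg_one_pow]
    ring
  rw [he, ho]
  linarith

/-! ### Averaging over the base stations -/

/-- Density of the distance to the serving base station on the event that its link has type
`j`. -/
def servingDensity (p : Params) (j : Link) (r : ℝ) : ℝ :=
  2 * Real.pi * p.lam * r * linkProb p r j *
    (Real.exp (-(Real.pi * p.lam * p.C * min (equalLossDist p j Link.los r) p.D ^ 2)) *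
      Real.exp (-(Real.pi * p.lam * (equalLossDist p j Link.nlos r ^ 2 -
        p.C * min (equalLossDist p j Link.nlos r) p.D ^ 2))))

/-- Effect of the interference from the sector `s`. -/
def rivalFactor (p : Params) (j : Link) (c r : ℝ) (s : Sector) : ℝ :=
  Delta p Link.los s p.C (Ioc (min (equalLossDist p j Link.los r) p.D) p.D) c (r ^ p.expo j) *
  Delta p Link.nlos s (1 - p.C) (Ioc (min (equalLossDist p j Link.nlos r) p.D) p.D) c
    (r ^ p.expo j) *
  Delta p Link.nlos s 1 (Ioi (max (equalLossDist p j Link.nlos r) p.D)) c (r ^ p.expo j)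

/-- `servingDensity`, weighted with the Laplace transform of interference and noise. -/
def laplaceDensity (p : Params) (j : Link) (c r : ℝ) : ℝ :=
  servingDensity p j r * (Real.exp (-(c * r ^ p.expo j * p.N0)) * ∏ s, rivalFactor p j c r s)

lemma rivalFactor_nonneg (j : Link) (c r : ℝ) (s : Sector) : 0 ≤ rivalFactor p j c r s :=
  mul_nonneg (mul_nonneg (Delta_nonneg ..) (Delta_nonneg ..)) (Delta_nonneg ..)

lemma rivalFactor_le_one (j : Link) (c r : ℝ) (s : Sector) : rivalFactor p j c r s ≤ 1 :=
  mul_le_one₀ (mul_le_one₀ (Delta_le_one ..) (Delta_nonneg ..) (Delta_le_one ..))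
    (Delta_nonneg ..) (Delta_le_one ..)

lemma servingDensity_nonneg (hlam : 0 < p.lam) (hC₀ : 0 ≤ p.C) (hC₁ : p.C ≤ 1) (j : Link) {r : ℝ}
    (hr : 0 ≤ r) : 0 ≤ servingDensity p j r := by
  have := linkProb_nonneg hC₀ hC₁ r j
  unfold servingDensity
  positivity

/-- Only finiteness matters, so the bound is crude. For LOS the density vanishes beyond `D`; for
NLOS the forbidden NLOS disc has radius `r` itself, and the LOS correction costs at most `e^{πλD²}`.
-/
lemma servingDensity_le (hlam : 0 < p.lam) (hC₀ : 0 ≤ p.C) (hC₁ : p.C ≤ 1) (hD : 0 < p.D)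
    (hcoef : ∀ j, 0 < p.coef j) (hexpo : ∀ j, 0 < p.expo j) (j : Link) {r : ℝ} (hr : 0 ≤ r) :
    servingDensity p j r ≤ 2 * Real.pi * p.lam * Real.exp (Real.pi * p.lam * p.D ^ 2) *
      (r * Real.exp (-(Real.pi * p.lam) * r ^ 2)) := by
  have hpi := Real.pi_pos
  have hq : linkProb p r j ≤ 1 := by
    cases j
    · exact losProb_le_one hC₁ r
    · exact sub_le_self _ (losProb_nonneg hC₀ r)
  have hq0 := linkProb_nonneg hC₀ hC₁ r j
  have hpl : 0 ≤ Real.pi * p.lam := by positivity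
  have hm : ∀ t : ℝ, 0 ≤ t → p.C * min t p.D ^ 2 ≤ p.D ^ 2 ∧ p.C * min t p.D ^ 2 ≤ t ^ 2 := by
    intro t ht
    have h0 : 0 ≤ min t p.D := le_min ht hD.le
    have h1 : p.C * min t p.D ^ 2 ≤ min t p.D ^ 2 :=
      mul_le_of_le_one_left (sq_nonneg _) hC₁
    exact ⟨h1.trans (pow_le_pow_left₀ h0 (min_le_right _ _) 2),
      h1.trans (pow_le_pow_left₀ h0 (min_le_left _ _) 2)⟩
  have key : linkProb p r j *
      (Real.exp (-(Real.pi * p.lam * p.C * min (equalLossDist p j Link.los r) p.D ^ 2)) *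
      Real.exp (-(Real.pi * p.lam * (equalLossDist p j Link.nlos r ^ 2 -
        p.C * min (equalLossDist p j Link.nlos r) p.D ^ 2)))) ≤
      Real.exp (Real.pi * p.lam * p.D ^ 2) * Real.exp (-(Real.pi * p.lam) * r ^ 2) := by
    rw [← Real.exp_add, ← Real.exp_add]
    by_cases hz : linkProb p r j = 0
    · rw [hz, zero_mul]
      exact (Real.exp_pos _).le
    refine (mul_le_of_le_one_left (Real.exp_pos _).le hq).trans (Real.exp_le_exp.2 ?_)
    have ha := equalLossDist_nonneg hcoef j Link.nlos hr
    have hb : 0 ≤ p.C * min (equalLossDist p j Link.los r) p.D ^ 2 := by positivity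
    have hgoal : r ^ 2 ≤ p.D ^ 2 + p.C * min (equalLossDist p j Link.los r) p.D ^ 2 +
        (equalLossDist p j Link.nlos r ^ 2 -
          p.C * min (equalLossDist p j Link.nlos r) p.D ^ 2) := by
      cases j with
      | los =>
        have hrD : r ≤ p.D := by
          by_contra hlt
          exact hz (if_neg hlt)
        have := (hm _ ha).2
        have := pow_le_pow_left₀ hr hrD 2
        linarith
      | nlos =>
        rw [equalLossDist_self hcoef hexpo]
        have := (hm _ hr).1
        linarith
    nlinarith [mul_le_mul_of_nonneg_left hgoal hpl]
  calc servingDensity p j r = 2 * Real.pi * p.lam * r * (linkProb p r j * _) := mul_assoc _ _ _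
    _ ≤ 2 * Real.pi * p.lam * r * (Real.exp (Real.pi * p.lam * p.D ^ 2) *
        Real.exp (-(Real.pi * p.lam) * r ^ 2)) := by gcongr
    _ = _ := by ring

lemma ofReal_laplaceDensity (hlam : 0 < p.lam) (hC₀ : 0 ≤ p.C) (hC₁ : p.C ≤ 1)
    (hD : 0 < p.D) (hnak : ∀ j, 1 ≤ p.nak j) (h0 : 0 ≤ p.thetab) (h1 : p.thetab ≤ 180)
    (hcoef : ∀ j, 0 < p.coef j) (hexpo : ∀ j, 0 < p.expo j) (hpow : ∀ s, 0 ≤ power p s)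
    (hN0 : 0 < p.N0) (j : Link) {c r : ℝ} (hc : 0 ≤ c) (hr : 0 ≤ r) :
    ENNReal.ofReal (2 * Real.pi * p.lam * r) * (ENNReal.ofReal (linkProb p r j) *
      nexp (ENNReal.ofReal (c * r ^ p.expo j * p.N0)) *
      nexp (∫⁻ y, (1 - ∫⁻ m, nexp (rivalExponent p j c (r, y, m)) ∂markLaw p)
        ∂(ENNReal.ofReal p.lam • (volume : Measure Plane)))) =
      ENNReal.ofReal (laplaceDensity p j c r) := by
  have hq := linkProb_nonneg hC₀ hC₁ r j
  have hr' := Real.rpow_nonneg hr (p.expo j)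
  rw [nexp_lintegral_rivals hlam.le hC₀ hC₁ hD hnak h0 h1 hcoef hexpo hpow j hc hr,
    nexp_ofReal (by positivity), ← ENNReal.ofReal_mul hq, ← ENNReal.ofReal_mul (by positivity),
    ← ENNReal.ofReal_mul (by positivity), laplaceDensity, servingDensity]
  congr 1
  simp only [rivalFactor]
  ring

/-- The mean of `rivalTerm` given a base station at distance `r`. -/
def rivalTermMean (p : Params) (j : Link) (c r : ℝ) : ENNReal :=
  ENNReal.ofReal (linkProb p r j) * nexp (ENNReal.ofReal (c * r ^ p.expo j * p.N0)) *
    nexp (∫⁻ y, (1 - ∫⁻ m, nexp (rivalExponent p j c (r, y, m)) ∂markLaw p)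
      ∂(ENNReal.ofReal p.lam • (volume : Measure Plane)))

lemma isProbabilityMeasure_markLaw (hnak : ∀ j, 1 ≤ p.nak j) :
    IsProbabilityMeasure (markLaw p) := by
  have h1 := isProbabilityMeasure_uniformLaw (a := 0) (b := 1) (by norm_num)
  have h2 := isProbabilityMeasure_uniformLaw (a := -180) (b := 180) (by norm_num)
  have h3 := isProbabilityMeasure_fading hnak Link.los
  have h4 := isProbabilityMeasure_fading hnak Link.nlos
  unfold markLaw
  infer_instance

lemma measurable_weight (p : Params) (j : Link) (c : ℝ) : Measurable fun r : ℝ =>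
    ENNReal.ofReal (linkProb p r j) * nexp (ENNReal.ofReal (c * r ^ p.expo j * p.N0)) :=
  (measurable_linkProb p j).ennreal_ofReal.mul (measurable_nexp.comp (by fun_prop))

lemma measurable_rivalTermMean (hnak : ∀ j, 1 ≤ p.nak j) (j : Link) (c : ℝ) :
    Measurable (rivalTermMean p j c) := by
  have := isProbabilityMeasure_markLaw hnak
  have h1 : Measurable fun z : ℝ × Plane =>
      ∫⁻ m, nexp (rivalExponent p j c (z.1, z.2, m)) ∂markLaw p :=
    Measurable.lintegral_prod_right'
      (f := fun z : (ℝ × Plane) × Mark => nexp (rivalExponent p j c (z.1.1, z.1.2, z.2)))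
      (measurable_nexp.comp ((measurable_rivalExponent p j c).comp (by fun_prop)))
  have h2 : Measurable fun r : ℝ =>
      ∫⁻ y, (1 - ∫⁻ m, nexp (rivalExponent p j c (r, y, m)) ∂markLaw p)
        ∂(ENNReal.ofReal p.lam • (volume : Measure Plane)) :=
    Measurable.lintegral_prod_right' (f := fun z : ℝ × Plane =>
      1 - ∫⁻ m, nexp (rivalExponent p j c (z.1, z.2, m)) ∂markLaw p) (measurable_const.sub h1)
  exact (measurable_weight p j c).mul (measurable_nexp.comp h2)

/-- The marked Mecke formula followed by polar coordinates for the position of the server. -/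
lemma tsum_lintegral_rivalTerm [IsProbabilityMeasure P] (hS : IsModel p P S) (hlam : 0 < p.lam)
    (hC₀ : 0 ≤ p.C) (hC₁ : p.C ≤ 1)
    (hD : 0 < p.D) (hnak : ∀ j, 1 ≤ p.nak j) (h0 : 0 ≤ p.thetab) (h1 : p.thetab ≤ 180)
    (hcoef : ∀ j, 0 < p.coef j) (hexpo : ∀ j, 0 < p.expo j) (hpow : ∀ s, 0 ≤ power p s)
    (hN0 : 0 < p.N0) (j : Link) {c : ℝ} (hc : 0 ≤ c) :
    ∑' i, ∫⁻ ω, rivalTerm p j c i (fun k => S.loc k ω) (fun k => S.mark k ω) ∂P =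
      ∫⁻ r in Ioi 0, ENNReal.ofReal (laplaceDensity p j c r) := by
  have hlaw : ∀ i, HasLaw (S.mark i) (markLaw p) P := hS.hasLaw_mark
  have : SigmaFinite (ENNReal.ofReal p.lam • (volume : Measure Plane)) :=
    inferInstanceAs (SigmaFinite (p.lam.toNNReal • (volume : Measure Plane)))
  have h := hS.poisson.mecke_marked hS.measurable_mark hlaw hS.iIndep_mark hS.indep_loc_mark
    (measurable_rivalExponent p j c) (rivalExponent_monotone hcoef hexpo j hc)
    measurable_norm (measure_norm_preimage_singleton p.lam)
    ((measurable_weight p j c).comp measurable_norm)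
  refine h.trans ((lintegral_radial hlam.le _ (measurable_rivalTermMean hnak j c)).trans ?_)
  exact setLIntegral_congr_fun measurableSet_Ioi fun r hr =>
    ofReal_laplaceDensity hlam hC₀ hC₁ hD hnak h0 h1 hcoef hexpo hpow hN0 j hc (le_of_lt hr)

lemma laplaceDensity_nonneg (hlam : 0 < p.lam) (hC₀ : 0 ≤ p.C) (hC₁ : p.C ≤ 1) (j : Link)
    (c : ℝ) {r : ℝ} (hr : 0 ≤ r) : 0 ≤ laplaceDensity p j c r :=
  mul_nonneg (servingDensity_nonneg hlam hC₀ hC₁ j hr)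
    (mul_nonneg (Real.exp_pos _).le (Finset.prod_nonneg fun s _ => rivalFactor_nonneg j c r s))

lemma laplaceDensity_le (hlam : 0 < p.lam) (hC₀ : 0 ≤ p.C) (hC₁ : p.C ≤ 1) (hN0 : 0 < p.N0)
    (j : Link) {c r : ℝ} (hc : 0 ≤ c) (hr : 0 ≤ r) :
    laplaceDensity p j c r ≤ servingDensity p j r := by
  have hr' := Real.rpow_nonneg hr (p.expo j)
  refine mul_le_of_le_one_right (servingDensity_nonneg hlam hC₀ hC₁ j hr) (mul_le_one₀ ?_ ?_ ?_)
  · exact Real.exp_le_one_iff.2 (neg_nonpos.2 (by positivity))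
  · exact Finset.prod_nonneg fun s _ => rivalFactor_nonneg j c r s
  · exact Finset.prod_le_one (fun s _ => rivalFactor_nonneg j c r s)
      fun s _ => rivalFactor_le_one j c r s

lemma integrableOn_laplaceDensity (hlam : 0 < p.lam) (hC₀ : 0 ≤ p.C) (hC₁ : p.C ≤ 1)
    (hD : 0 < p.D) (hnak : ∀ j, 1 ≤ p.nak j) (h0 : 0 ≤ p.thetab) (h1 : p.thetab ≤ 180)
    (hcoef : ∀ j, 0 < p.coef j) (hexpo : ∀ j, 0 < p.expo j) (hpow : ∀ s, 0 ≤ power p s)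
    (hN0 : 0 < p.N0) (j : Link) {c : ℝ} (hc : 0 ≤ c) :
    IntegrableOn (laplaceDensity p j c) (Ioi 0) := by
  have hdom : IntegrableOn (fun r : ℝ => 2 * Real.pi * p.lam *
      Real.exp (Real.pi * p.lam * p.D ^ 2) * (r * Real.exp (-(Real.pi * p.lam) * r ^ 2)))
      (Ioi 0) :=
    ((integrable_mul_exp_neg_mul_sq (mul_pos Real.pi_pos hlam)).const_mul _).integrableOn
  refine hdom.mono' ?_ ?_
  -- Measurability in `r` is taken from the Mecke side, where it follows from Fubini, rather than
  -- from the formula with `Delta`, whose domains of integration move with `r`.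
  · have hm : Measurable fun r : ℝ =>
        (ENNReal.ofReal (2 * Real.pi * p.lam * r) * rivalTermMean p j c r).toReal :=
      (Measurable.mul (by fun_prop) (measurable_rivalTermMean hnak j c)).ennreal_toReal
    refine hm.aestronglyMeasurable.congr ?_
    refine (ae_restrict_iff' measurableSet_Ioi).2 (Eventually.of_forall fun r hr => ?_)
    have hr : 0 ≤ r := le_of_lt hr
    simp only [rivalTermMean]
    rw [
      ofReal_laplaceDensity hlam hC₀ hC₁ hD hnak h0 h1 hcoef hexpo hpow hN0 j hc hr,
      ENNReal.toReal_ofReal (laplaceDensity_nonneg hlam hC₀ hC₁ j c hr)]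
  · refine (ae_restrict_iff' measurableSet_Ioi).2 (Eventually.of_forall fun r hr => ?_)
    have hr : 0 ≤ r := le_of_lt hr
    rw [Real.norm_of_nonneg (laplaceDensity_nonneg hlam hC₀ hC₁ j c hr)]
    exact (laplaceDensity_le hlam hC₀ hC₁ hN0 j hc hr).trans
      (servingDensity_le hlam hC₀ hC₁ hD hcoef hexpo j hr)

lemma Theta_nonneg (hcoef : ∀ j, 0 < p.coef j) (hPt : 0 < p.Pt) (hMs : 0 < p.Ms)
    (hphi₀ : 0 < p.phi) {Tc : ℝ} (hTc : 0 < Tc) (j : Link) (n : ℕ) : 0 ≤ Theta p Tc j n := by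
  have := hcoef j
  have := alzer_pos p j
  unfold Theta
  positivity

lemma measurable_split {X : ℕ → Ω → Plane} {Y : ℕ → Ω → Mark}
    (hX : ∀ i, Measurable (X i)) (hY : ∀ i, Measurable (Y i)) (i : ℕ)
    {Φ : (ℕ → Plane) → ({k : ℕ // k ≠ i} → Mark) → ENNReal}
    (hΦ : Measurable fun z : (ℕ → Plane) × ({k : ℕ // k ≠ i} → Mark) => Φ z.1 z.2) :
    Measurable fun ω => Φ (fun k => X k ω) (fun k => Y k ω) :=
  hΦ.comp (g := fun z : (ℕ → Plane) × ({k : ℕ // k ≠ i} → Mark) => Φ z.1 z.2)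
    (f := fun ω => ((fun k => X k ω : ℕ → Plane), (fun k => Y k ω : {k : ℕ // k ≠ i} → Mark)))
    ((measurable_pi_lambda _ hX).prodMk (measurable_pi_lambda _ fun k => hY k))

lemma measurable_rivalTerm (p : Params) (j : Link) (c : ℝ) (i : ℕ) :
    Measurable fun z : (ℕ → Plane) × ({k : ℕ // k ≠ i} → Mark) => rivalTerm p j c i z.1 z.2 := by
  have h1 : Measurable fun z : (ℕ → Plane) × ({k : ℕ // k ≠ i} → Mark) => ‖z.1 i‖ := by fun_prop
  refine ((measurable_weight p j c).comp h1).mul (measurable_nexp.comp ?_)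
  exact Measurable.tsum fun k => (measurable_rivalExponent p j c).comp
    (f := fun z : (ℕ → Plane) × ({k : ℕ // k ≠ i} → Mark) => (‖z.1 i‖, z.1 k, z.2 k))
    (by fun_prop)

lemma tsum_lintegral_condBound [IsProbabilityMeasure P] (hS : IsModel p P S) (hlam : 0 < p.lam)
    (hC₀ : 0 ≤ p.C) (hC₁ : p.C ≤ 1)
    (hD : 0 < p.D) (hnak : ∀ j, 1 ≤ p.nak j) (h0 : 0 ≤ p.thetab) (h1 : p.thetab ≤ 180)
    (hcoef : ∀ j, 0 < p.coef j) (hexpo : ∀ j, 0 < p.expo j) (hpow : ∀ s, 0 ≤ power p s)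
    (hPt : 0 < p.Pt) (hMs : 0 < p.Ms) (hphi₀ : 0 < p.phi)
    (hN0 : 0 < p.N0) {Tc : ℝ} (hTc : 0 < Tc) (j : Link) :
    ∑' i, ∫⁻ ω, condBound p Tc j i (fun k => S.loc k ω) (fun k => S.mark k ω) ∂P ≠ ⊤ ∧
    (∑' i, ∫⁻ ω, condBound p Tc j i (fun k => S.loc k ω) (fun k => S.mark k ω) ∂P).toReal =
      ∑ n ∈ Finset.Icc 1 (p.nak j), (-1 : ℝ) ^ (n + 1) * ((p.nak j).choose n : ℝ) *
        ∫ r in Ioi 0, laplaceDensity p j (Theta p Tc j n) r := by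
  have hΘ := Theta_nonneg hcoef hPt hMs hphi₀ hTc j
  have hM : ∀ n, ∑' i, ∫⁻ ω, rivalTerm p j (Theta p Tc j n) i (fun k => S.loc k ω)
      (fun k => S.mark k ω) ∂P =
      ENNReal.ofReal (∫ r in Ioi 0, laplaceDensity p j (Theta p Tc j n) r) := fun n => by
    rw [tsum_lintegral_rivalTerm hS hlam hC₀ hC₁ hD hnak h0 h1 hcoef hexpo hpow hN0 j (hΘ n),
      ofReal_integral_eq_lintegral_ofReal
        (integrableOn_laplaceDensity hlam hC₀ hC₁ hD hnak h0 h1 hcoef hexpo hpow hN0 j (hΘ n))]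
    exact (ae_restrict_iff' measurableSet_Ioi).2 (Eventually.of_forall fun r hr =>
      laplaceDensity_nonneg hlam hC₀ hC₁ j _ (le_of_lt hr))
  have hsum := tsum_lintegral_add_sum (P := P)
    (b := fun n => ((p.nak j).choose n : ENNReal))
    (A := fun i ω => condBound p Tc j i (fun k => S.loc k ω) (fun k => S.mark k ω))
    (T := fun n i ω => rivalTerm p j (Theta p Tc j n) i (fun k => S.loc k ω)
      (fun k => S.mark k ω))
    (fun i => measurable_split hS.poisson.measurable hS.measurable_mark i
      (measurable_condBound p Tc j i))
    (fun n i => measurable_split hS.poisson.measurable hS.measurable_mark i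
      (measurable_rivalTerm p j _ i))
    (fun i ω => condBound_add_sum_rivalTerm hcoef hPt hMs hphi₀ hTc j i _ _)
  simp_rw [hM] at hsum
  obtain ⟨hB, h⟩ := toReal_eq_alternating_sum (fun n => ENNReal.ofReal_ne_top) hsum
  refine ⟨hB, h.trans (Finset.sum_congr rfl fun n _ => ?_)⟩
  rw [ENNReal.toReal_ofReal]
  exact setIntegral_nonneg measurableSet_Ioi fun r hr =>
    laplaceDensity_nonneg hlam hC₀ hC₁ j _ (le_of_lt hr)

/-- The weighted density of the connection over links of type `j`. -/
def connDensity (p : Params) (Tc : ℝ) (j : Link) (r : ℝ) : ℝ :=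
  ∑ n ∈ Finset.Icc 1 (p.nak j), (-1 : ℝ) ^ (n + 1) * ((p.nak j).choose n : ℝ) *
    laplaceDensity p j (Theta p Tc j n) r

lemma integrableOn_connDensity (hlam : 0 < p.lam) (hC₀ : 0 ≤ p.C) (hC₁ : p.C ≤ 1)
    (hD : 0 < p.D) (hnak : ∀ j, 1 ≤ p.nak j) (h0 : 0 ≤ p.thetab) (h1 : p.thetab ≤ 180)
    (hcoef : ∀ j, 0 < p.coef j) (hexpo : ∀ j, 0 < p.expo j) (hpow : ∀ s, 0 ≤ power p s)
    (hPt : 0 < p.Pt) (hMs : 0 < p.Ms) (hphi₀ : 0 < p.phi)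
    (hN0 : 0 < p.N0) {Tc : ℝ} (hTc : 0 < Tc) (j : Link) :
    IntegrableOn (connDensity p Tc j) (Ioi 0) :=
  integrable_finsetSum _ fun n _ => (integrableOn_laplaceDensity hlam hC₀ hC₁ hD hnak h0 h1 hcoef
    hexpo hpow hN0 j (Theta_nonneg hcoef hPt hMs hphi₀ hTc j n)).const_mul _

lemma connProb_le [IsProbabilityMeasure P] (hS : IsModel p P S) (hlam : 0 < p.lam)
    (hC₀ : 0 ≤ p.C) (hC₁ : p.C ≤ 1)
    (hD : 0 < p.D) (hnak : ∀ j, 1 ≤ p.nak j) (h0 : 0 ≤ p.thetab) (h1 : p.thetab ≤ 180)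
    (hcoef : ∀ j, 0 < p.coef j) (hexpo : ∀ j, 0 < p.expo j) (hpow : ∀ s, 0 ≤ power p s)
    (hPt : 0 < p.Pt) (hMs : 0 < p.Ms) (hphi₀ : 0 < p.phi)
    (hN0 : 0 < p.N0) {Tc : ℝ} (hTc : 0 < Tc) :
    connProb p S P Tc ≤ ∑ j, ∫ r in Ioi 0, connDensity p Tc j r := by
  have hB := tsum_lintegral_condBound hS hlam hC₀ hC₁ hD hnak h0 h1 hcoef hexpo hpow hPt hMs
    hphi₀ hN0 hTc
  have h := ENNReal.toReal_mono (ENNReal.sum_ne_top.2 fun j _ => (hB j).1)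
    (measure_conn_le_tsum hS hC₀ hC₁ hnak h0 h1 hcoef hPt hMs hphi₀ hN0 Tc)
  rw [ENNReal.toReal_sum fun j _ => (hB j).1] at h
  refine h.trans_eq (Finset.sum_congr rfl fun j _ => ?_)
  rw [(hB j).2]
  simp only [connDensity]
  rw [integral_finsetSum _ fun n _ => (integrableOn_laplaceDensity hlam hC₀ hC₁ hD hnak h0 h1
    hcoef hexpo hpow hN0 j (Theta_nonneg hcoef hPt hMs hphi₀ hTc j n)).const_mul _]
  simp_rw [integral_const_mul]

end Connection

section Association

open Filter Topology Set

variable {p : Params}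

/-! ### Association probabilities and distance distributions -/

lemma toNlos_eq (p : Params) (r : ℝ) : toNlos p r = equalLossDist p Link.los Link.nlos r := rfl

lemma toLos_eq (p : Params) (r : ℝ) : toLos p r = equalLossDist p Link.nlos Link.los r := rfl

lemma equalLossDist_equalLossDist (hcoef : ∀ j, 0 < p.coef j) (hexpo : ∀ j, 0 < p.expo j)
    (j k : Link) {r : ℝ} (hr : 0 ≤ r) :
    equalLossDist p k j (equalLossDist p j k r) = r := by
  have h1 := equalLossDist_nonneg hcoef j k hr
  rw [← Real.rpow_left_inj (equalLossDist_nonneg hcoef k j h1) hr (hexpo j).ne',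
    equalLossDist_rpow hcoef hexpo k j h1, equalLossDist_rpow hcoef hexpo j k hr]
  have := (hcoef j).ne'
  have := (hcoef k).ne'
  field_simp

lemma equalLossDist_mono (hcoef : ∀ j, 0 < p.coef j) (hexpo : ∀ j, 0 < p.expo j)
    (j k : Link) {r s : ℝ} (hr : 0 ≤ r) (hrs : r ≤ s) :
    equalLossDist p j k r ≤ equalLossDist p j k s := by
  have h := div_pos (hexpo j) (hexpo k)
  have h2 := div_pos (hcoef k) (hcoef j)
  unfold equalLossDist
  gcongr

/-- The place where the comparison of the two path losses at `D` is used; it is `ρ_N(D) ≤ D` after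
taking powers. -/
lemma toNlos_le (hcoef : ∀ j, 0 < p.coef j) (hexpo : ∀ j, 0 < p.expo j) (hD : 0 < p.D)
    (hLN : p.coef Link.nlos * p.D ^ (-p.expo Link.nlos) ≤
      p.coef Link.los * p.D ^ (-p.expo Link.los)) : toNlos p p.D ≤ p.D := by
  have h1 := Real.rpow_pos_of_pos hD (p.expo Link.nlos)
  have h2 := Real.rpow_pos_of_pos hD (p.expo Link.los)
  have hc := hcoef Link.los
  rw [toNlos_eq, ← Real.rpow_le_rpow_iff (equalLossDist_nonneg hcoef _ _ hD.le) hD.le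
    (hexpo Link.nlos), equalLossDist_rpow hcoef hexpo _ _ hD.le]
  rw [Real.rpow_neg hD.le, Real.rpow_neg hD.le, ← div_eq_mul_inv, ← div_eq_mul_inv,
    div_le_div_iff₀ h1 h2] at hLN
  rw [div_mul_eq_mul_div, div_le_iff₀ hc]
  linarith

lemma toLos_toNlos (hcoef : ∀ j, 0 < p.coef j) (hexpo : ∀ j, 0 < p.expo j) {r : ℝ} (hr : 0 ≤ r) :
    toLos p (toNlos p r) = r :=
  equalLossDist_equalLossDist hcoef hexpo Link.los Link.nlos hr

lemma toLos_le (hcoef : ∀ j, 0 < p.coef j) (hexpo : ∀ j, 0 < p.expo j) (hD : 0 < p.D) {r : ℝ}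
    (hr : 0 ≤ r) (hrD : r ≤ toNlos p p.D) : toLos p r ≤ p.D :=
  (equalLossDist_mono hcoef hexpo Link.nlos Link.los hr hrD).trans_eq
    (toLos_toNlos hcoef hexpo hD.le)

lemma le_toLos (hcoef : ∀ j, 0 < p.coef j) (hexpo : ∀ j, 0 < p.expo j) (hD : 0 < p.D) {r : ℝ}
    (hrD : toNlos p p.D ≤ r) : p.D ≤ toLos p r :=
  (toLos_toNlos hcoef hexpo hD.le).symm.trans_le (equalLossDist_mono hcoef hexpo Link.nlos Link.los
    (equalLossDist_nonneg hcoef _ _ hD.le) hrD)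

lemma continuous_toLos (hexpo : ∀ j, 0 < p.expo j) : Continuous (toLos p) :=
  continuous_const.mul (Real.continuous_rpow_const (div_pos (hexpo _) (hexpo _)).le)

lemma assocN_pos (hlam : 0 < p.lam) (hC₀ : 0 ≤ p.C) (hC₁ : p.C ≤ 1) (hD : 0 < p.D)
    (hcoef : ∀ j, 0 < p.coef j) (hexpo : ∀ j, 0 < p.expo j) : 0 < assocN p := by
  refine add_pos_of_nonneg_of_pos (intervalIntegral.integral_nonneg
    (equalLossDist_nonneg hcoef Link.los Link.nlos hD.le) fun x hx => ?_) (Real.exp_pos _)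
  have h1 : 0 ≤ toLos p x := equalLossDist_nonneg hcoef _ _ hx.1
  have h2 := toLos_le hcoef hexpo hD hx.1 hx.2
  have h3 := pow_le_pow_left₀ h1 h2 2
  have h4 : Real.exp (-(Real.pi * p.C * p.lam * p.D ^ 2)) ≤
      Real.exp (-(Real.pi * p.C * p.lam * toLos p x ^ 2)) := by
    refine Real.exp_le_exp.2 (neg_le_neg ?_)
    have := Real.pi_pos
    gcongr
  have h5 : 0 ≤ 1 - p.C := by linarith
  have := Real.pi_pos
  have := hx.1
  have := sub_nonneg.2 h4
  positivity

/-- Bounding the exponential of `ρ_L(x)²` by `1` leaves an elementary integral: with `e =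
e^{-πCλD²}` and `b = π(1-C)λ`, `A_N ≤ (1 - e)(1 - e^{-bμ²}) + e < 1`, where `e < 1` because `C > 0`.
-/
lemma assocL_pos (hlam : 0 < p.lam) (hC₀ : 0 < p.C) (hC₁ : p.C ≤ 1) (hD : 0 < p.D)
    (hcoef : ∀ j, 0 < p.coef j) (hexpo : ∀ j, 0 < p.expo j) : 0 < assocL p := by
  have hpi := Real.pi_pos
  set e := Real.exp (-(Real.pi * p.C * p.lam * p.D ^ 2)) with he
  set b := Real.pi * (1 - p.C) * p.lam with hb
  have h5 : 0 ≤ 1 - p.C := by linarith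
  have he1 : e < 1 := Real.exp_lt_one_iff.2 (neg_lt_zero.2 (by positivity))
  have hμ : 0 ≤ toNlos p p.D := equalLossDist_nonneg hcoef Link.los Link.nlos hD.le
  have hc := continuous_toLos hexpo
  have hder : ∀ x : ℝ, HasDerivAt (fun x => -((1 - e) * Real.exp (-(b * x ^ 2))))
      ((1 - e) * (2 * Real.pi * (1 - p.C) * p.lam * x) *
        Real.exp (-(Real.pi * (1 - p.C) * p.lam * x ^ 2))) x := by
    intro x
    have h := (((((hasDerivAt_id x).pow 2).const_mul b).neg.exp).const_mul (1 - e)).neg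
    refine h.congr_deriv ?_
    simp only [id, hb, Pi.neg_apply, Pi.pow_apply]
    push_cast
    ring_nf
  have hint : assocN p ≤ (∫ x in (0 : ℝ)..toNlos p p.D,
      (1 - e) * (2 * Real.pi * (1 - p.C) * p.lam * x) *
        Real.exp (-(Real.pi * (1 - p.C) * p.lam * x ^ 2))) + e := by
    refine add_le_add_left (intervalIntegral.integral_mono_on hμ ?_ ?_ fun x hx => ?_) _
    · exact Continuous.intervalIntegrable (by fun_prop) _ _
    · exact Continuous.intervalIntegrable (by fun_prop) _ _
    · have hx0 := hx.1
      have : Real.exp (-(Real.pi * p.C * p.lam * toLos p x ^ 2)) ≤ 1 :=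
        Real.exp_le_one_iff.2 (neg_nonpos.2 (by positivity))
      gcongr
  rw [intervalIntegral.integral_eq_sub_of_hasDerivAt (fun x _ => hder x)
    (Continuous.intervalIntegrable (by fun_prop) _ _)] at hint
  have hpos : 0 < (1 - e) * Real.exp (-(b * toNlos p p.D ^ 2)) :=
    mul_pos (sub_pos.2 he1) (Real.exp_pos _)
  have h0 : Real.exp (-(b * 0 ^ 2)) = 1 := by simp
  rw [h0] at hint
  unfold assocL
  linarith

lemma pdfL_eq (hcoef : ∀ j, 0 < p.coef j) (hexpo : ∀ j, 0 < p.expo j) (hD : 0 < p.D)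
    (hLN : p.coef Link.nlos * p.D ^ (-p.expo Link.nlos) ≤
      p.coef Link.los * p.D ^ (-p.expo Link.los)) {r : ℝ} (hr : r ∈ Ioc 0 p.D) :
    pdfL p r = servingDensity p Link.los r / assocL p := by
  have h1 : toNlos p r ≤ p.D :=
    (equalLossDist_mono hcoef hexpo Link.los Link.nlos hr.1.le hr.2).trans
      (toNlos_le hcoef hexpo hD hLN)
  have h2 : linkProb p r Link.los = p.C := if_pos hr.2
  rw [pdfL, servingDensity, equalLossDist_self hcoef hexpo, h2, ← toNlos_eq, min_eq_left hr.2,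
    min_eq_left h1]
  congr 1
  rw [mul_comm (Real.exp _) (_ * _), mul_assoc (2 * Real.pi * p.C * p.lam * r)]
  rw [show Real.pi * p.lam * p.C * r ^ 2 = p.C * p.lam * Real.pi * r ^ 2 by ring,
    show Real.pi * p.lam * (toNlos p r ^ 2 - p.C * toNlos p r ^ 2) =
      (1 - p.C) * p.lam * Real.pi * toNlos p r ^ 2 by ring]
  ring

/-- The point `r = D` is excluded because both indicators of `pdfN` equal `1` there. For `r < D` the
first term of `pdfN` is the density with `ρ_L(r)` replaced by `D`, and the second term corrects this
when `r ≤ μ`. -/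
lemma pdfN_eq (hcoef : ∀ j, 0 < p.coef j) (hexpo : ∀ j, 0 < p.expo j) (hD : 0 < p.D)
    (hLN : p.coef Link.nlos * p.D ^ (-p.expo Link.nlos) ≤
      p.coef Link.los * p.D ^ (-p.expo Link.los)) {r : ℝ} (hr : 0 < r) (hrD : r ≠ p.D) :
    pdfN p r = servingDensity p Link.nlos r / assocN p := by
  have hμ := toNlos_le hcoef hexpo hD hLN
  rw [pdfN, servingDensity, equalLossDist_self hcoef hexpo, ← toLos_eq]
  rcases lt_or_gt_of_ne hrD with h | h
  · have hq : linkProb p r Link.nlos = 1 - p.C := by rw [linkProb, losProb, if_pos h.le]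
    have e1 : Real.exp (-(Real.pi * p.lam * r ^ 2)) *
        Real.exp (Real.pi * p.C * p.lam * (r ^ 2 - p.D ^ 2)) =
        Real.exp (-((1 - p.C) * p.lam * Real.pi * r ^ 2)) *
          Real.exp (-(p.C * p.lam * Real.pi * p.D ^ 2)) := by
      rw [← Real.exp_add, ← Real.exp_add]
      ring_nf
    have e2 : Real.pi * p.lam * (r ^ 2 - p.C * r ^ 2) = (1 - p.C) * p.lam * Real.pi * r ^ 2 := by
      ring
    have e3 : ∀ t : ℝ, Real.pi * p.lam * p.C * t ^ 2 = p.C * p.lam * Real.pi * t ^ 2 := fun t => by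
      ring
    rw [hq, if_pos h.le, if_neg h.not_ge, min_eq_left h.le, e2, e3]
    by_cases hrμ : r ≤ toNlos p p.D
    · rw [if_pos hrμ, min_eq_left (toLos_le hcoef hexpo hD hr.le hrμ)]
      linear_combination (2 * Real.pi * p.lam * r * (1 - p.C) / assocN p) * e1
    · rw [if_neg hrμ, min_eq_right (le_toLos hcoef hexpo hD (not_le.1 hrμ).le)]
      linear_combination (2 * Real.pi * p.lam * r * (1 - p.C) / assocN p) * e1
  · have hq : linkProb p r Link.nlos = 1 := by rw [linkProb, losProb, if_neg h.not_ge, sub_zero]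
    have e1 : Real.exp (-(Real.pi * p.lam * p.C * p.D ^ 2)) *
        Real.exp (-(Real.pi * p.lam * (r ^ 2 - p.C * p.D ^ 2))) =
        Real.exp (-(Real.pi * p.lam * r ^ 2)) := by
      rw [← Real.exp_add]
      ring_nf
    rw [hq, if_neg h.not_ge, if_pos h.le, if_neg (hμ.trans_lt h).not_ge, min_eq_right h.le,
      min_eq_right (le_toLos hcoef hexpo hD (hμ.trans h.le)), e1]
    ring

lemma prod_sector {α : Type*} [CommMonoid α] (f : Sector → α) :
    ∏ s, f s = f Sector.signal * f Sector.noise :=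
  Fintype.prod_eq_mul _ _ (by simp) (by rintro (_ | _) <;> simp)

lemma XiL_mul_pdfL (hcoef : ∀ j, 0 < p.coef j) (hexpo : ∀ j, 0 < p.expo j) (hD : 0 < p.D)
    (hLN : p.coef Link.nlos * p.D ^ (-p.expo Link.nlos) ≤
      p.coef Link.los * p.D ^ (-p.expo Link.los)) (Tc : ℝ) {r : ℝ} (hr : r ∈ Ioc 0 p.D) :
    XiL p Tc r * pdfL p r = connDensity p Tc Link.los r / assocL p := by
  rw [pdfL_eq hcoef hexpo hD hLN hr, ← mul_div_assoc]
  congr 1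
  simp only [XiL, connDensity, laplaceDensity, Finset.sum_mul]
  refine Finset.sum_congr rfl fun n _ => ?_
  rw [prod_sector]
  simp only [rivalFactor, varpi, toNlos_eq, equalLossDist_self hcoef hexpo, min_eq_left hr.2]
  ring

lemma XiN_mul_pdfN (hcoef : ∀ j, 0 < p.coef j) (hexpo : ∀ j, 0 < p.expo j) (hD : 0 < p.D)
    (hLN : p.coef Link.nlos * p.D ^ (-p.expo Link.nlos) ≤
      p.coef Link.los * p.D ^ (-p.expo Link.los)) (Tc : ℝ) {r : ℝ} (hr : 0 < r) (hrD : r ≠ p.D) :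
    XiN p Tc r * pdfN p r = connDensity p Tc Link.nlos r / assocN p := by
  rw [pdfN_eq hcoef hexpo hD hLN hr hrD, ← mul_div_assoc]
  congr 1
  simp only [XiN, connDensity, laplaceDensity, Finset.sum_mul]
  refine Finset.sum_congr rfl fun n _ => ?_
  rw [prod_sector]
  simp only [rivalFactor, varphi, toLos_eq, equalLossDist_self hcoef hexpo]
  ring

lemma connDensity_eq_zero {Tc : ℝ} {j : Link} {r : ℝ} (h : linkProb p r j = 0) :
    connDensity p Tc j r = 0 := by
  simp [connDensity, laplaceDensity, servingDensity, h]

lemma XiN_mul_pdfN_ae (hcoef : ∀ j, 0 < p.coef j) (hexpo : ∀ j, 0 < p.expo j) (hD : 0 < p.D)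
    (hLN : p.coef Link.nlos * p.D ^ (-p.expo Link.nlos) ≤
      p.coef Link.los * p.D ^ (-p.expo Link.los)) (Tc : ℝ) :
    (fun r => connDensity p Tc Link.nlos r / assocN p) =ᵐ[volume.restrict (Ioi 0)]
      fun r => XiN p Tc r * pdfN p r := by
  rw [EventuallyEq, ae_restrict_iff' measurableSet_Ioi]
  have hne : ∀ᵐ r : ℝ, r ≠ p.D := by simp [ae_iff]
  filter_upwards [hne] with r hrD hr
  exact (XiN_mul_pdfN hcoef hexpo hD hLN Tc hr hrD).symm

lemma assocL_mul_integral (hlam : 0 < p.lam) (hC₀ : 0 ≤ p.C) (hC₁ : p.C ≤ 1) (hD : 0 < p.D)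
    (hcoef : ∀ j, 0 < p.coef j) (hexpo : ∀ j, 0 < p.expo j)
    (hLN : p.coef Link.nlos * p.D ^ (-p.expo Link.nlos) ≤
      p.coef Link.los * p.D ^ (-p.expo Link.los)) (Tc : ℝ) :
    assocL p * (∫ r in Ioc 0 p.D, XiL p Tc r * pdfL p r) =
      ∫ r in Ioi 0, connDensity p Tc Link.los r := by
  have hsub : ∫ r in Ioi 0, connDensity p Tc Link.los r =
      ∫ r in Ioc 0 p.D, connDensity p Tc Link.los r := by
    refine setIntegral_eq_of_subset_of_forall_sdiff_eq_zero measurableSet_Ioi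
      Ioc_subset_Ioi_self fun r hr => connDensity_eq_zero (if_neg fun h => hr.2 ⟨hr.1, h⟩)
  rw [hsub, setIntegral_congr_fun measurableSet_Ioc fun r hr =>
    XiL_mul_pdfL hcoef hexpo hD hLN Tc hr, integral_div]
  -- For `C = 0` no link is LOS and both sides vanish; for `C > 0` the factor `assocL p` is nonzero
  -- and cancels.
  rcases hC₀.eq_or_lt with hC | hC
  · have h0 : ∫ r in Ioc 0 p.D, connDensity p Tc Link.los r = 0 := by
      refine setIntegral_eq_zero_of_forall_eq_zero fun r _ => connDensity_eq_zero ?_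
      simp [linkProb, losProb, ← hC]
    rw [h0, zero_div, mul_zero]
  · exact mul_div_cancel₀ _ (assocL_pos hlam hC hC₁ hD hcoef hexpo).ne'

lemma assocN_mul_integral (hlam : 0 < p.lam) (hC₀ : 0 ≤ p.C) (hC₁ : p.C ≤ 1) (hD : 0 < p.D)
    (hcoef : ∀ j, 0 < p.coef j) (hexpo : ∀ j, 0 < p.expo j)
    (hLN : p.coef Link.nlos * p.D ^ (-p.expo Link.nlos) ≤
      p.coef Link.los * p.D ^ (-p.expo Link.los)) (Tc : ℝ) :
    assocN p * (∫ r in Ioi 0, XiN p Tc r * pdfN p r) =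
      ∫ r in Ioi 0, connDensity p Tc Link.nlos r := by
  rw [← integral_congr_ae (XiN_mul_pdfN_ae hcoef hexpo hD hLN Tc), integral_div]
  exact mul_div_cancel₀ _ (assocN_pos hlam hC₀ hC₁ hD hcoef hexpo).ne'

end Association

end MmWave

end

/-! ### Assembly of the bound -/

theorem theorem6 {Ω : Type*} [MeasurableSpace Ω] (P : MeasureTheory.Measure Ω)
    [MeasureTheory.IsProbabilityMeasure P]
    (p : MmWave.Params) (S : MmWave.Network Ω) (hS : MmWave.IsModel p P S)
    (hlam : 0 < p.lam) (hC₀ : 0 ≤ p.C) (hC₁ : p.C ≤ 1) (hD : 0 < p.D)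
    (hcoef : ∀ j, 0 < p.coef j) (hexpo : ∀ j, 0 < p.expo j) (hnak : ∀ j, 1 ≤ p.nak j)
    -- at distance `D`, a LOS link is at least as strong as a NLOS link
    (hLN : p.coef MmWave.Link.nlos * p.D ^ (-p.expo MmWave.Link.nlos) ≤
      p.coef MmWave.Link.los * p.D ^ (-p.expo MmWave.Link.los))
    (hPt : 0 < p.Pt) (hMs : 0 < p.Ms) (hMa : 0 ≤ p.Ma)
    (hphi₀ : 0 < p.phi) (hphi₁ : p.phi ≤ 1) (hthetab₀ : 0 ≤ p.thetab) (hthetab₁ : p.thetab ≤ 180)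
    (hN0 : 0 < p.N0) (Tc : ℝ) (hTc : 0 < Tc) :
    MeasureTheory.IntegrableOn (fun r => MmWave.XiL p Tc r * MmWave.pdfL p r) (Set.Ioc 0 p.D) ∧
    MeasureTheory.IntegrableOn (fun r => MmWave.XiN p Tc r * MmWave.pdfN p r) (Set.Ioi 0) ∧
    MmWave.connProb p S P Tc ≤
      MmWave.assocL p * (∫ r in Set.Ioc 0 p.D, MmWave.XiL p Tc r * MmWave.pdfL p r) +
      MmWave.assocN p * (∫ r in Set.Ioi 0, MmWave.XiN p Tc r * MmWave.pdfN p r) := by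
  have hpow := MmWave.power_nonneg hPt hMs hMa hphi₀ hphi₁
  have hint := MmWave.integrableOn_connDensity hlam hC₀ hC₁ hD hnak hthetab₀ hthetab₁ hcoef hexpo
    hpow hPt hMs hphi₀ hN0 hTc
  refine ⟨?_, ?_, ?_⟩
  · refine MeasureTheory.IntegrableOn.congr_fun (((hint MmWave.Link.los).mono_set
      Set.Ioc_subset_Ioi_self).div_const (MmWave.assocL p)) (fun r hr => ?_) measurableSet_Ioc
    exact (MmWave.XiL_mul_pdfL hcoef hexpo hD hLN Tc hr).symm
  · exact ((hint MmWave.Link.nlos).div_const (MmWave.assocN p)).congr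
      (MmWave.XiN_mul_pdfN_ae hcoef hexpo hD hLN Tc)
  · rw [MmWave.assocL_mul_integral hlam hC₀ hC₁ hD hcoef hexpo hLN,
      MmWave.assocN_mul_integral hlam hC₀ hC₁ hD hcoef hexpo hLN]
    exact (MmWave.connProb_le hS hlam hC₀ hC₁ hD hnak hthetab₀ hthetab₁ hcoef hexpo hpow hPt hMs
      hphi₀ hN0 hTc).trans_eq (MmWave.sum_link _)
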